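/- All graphs are finite and simple; the length of a path is its number of edges. For a graph $G$ let $\lambda(G)$ be the length of a longest path of $G$, with $\lambda = -\infty$ for the graph without vertices. A vertex $v$ of $G$ is a \emph{Gallai vertex} if it lies on every longest path of $G$. The decision problem \textsc{Gallai Vertex} asks, for a given connected graph $G$ (encoded by its adjacency matrix), whether $G$ has a Gallai vertex; strings that do not encode a connected graph are no-instances. (1) \textsc{Gallai Vertex} belongs to $\Theta_2^p = \mathrm{P}^{\mathrm{NP}[\log n]}$: it is decided by a deterministic polynomial-time oracle Turing machine that asks at most $O(\log n)$ (adaptive) queries to a language in NP, where $n$ is the input length. (2) \textsc{Gallai Vertex} belongs to $\mathrm{P}^{\mathrm{NP}}_{\parallel}$: there are a language $A$ in NP, a polynomial-time computable function that maps every input $x$ to a list of queries, and a polynomial-time computable predicate that decides from $x$ and the list of answers to all queries ("is the query in $A$?") whether $x$ is a yes-instance. (3) For every graph $G$ with $n$ vertices, $\lambda(G)$ is the largest $k \in \{0,\dots,n\}$ such that $G$ has a path of length at least $k$, and for every vertex $v$, $\lambda(G-v)$ is the largest $k \in \{0,\dots,n\}$ such that $G-v$ has a path of length at least $k$ (with the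 maximum of the empty set being $-\infty$). A vertex $v$ is a Gallai vertex of $G$ if and only if $\lambda(G-v) < \lambda(G)$; in particular, $G$ has a Gallai vertex if and only if $\lambda(G-v)<\lambda(G)$ for some vertex $v$. -/

import Mathlib

/-! ### Longest paths and Gallai vertices -/

section Graphs

universe u

variable {V : Type u}

/-- `G` has a path with at least `k` edges. -/
def HasPathOfLengthGE (G : SimpleGraph V) (k : ℕ) : Prop :=
  ∃ (a b : V) (p : G.Walk a b), p.IsPath ∧ k ≤ p.length

/-- The length (number of edges) of a longest path of a finite graph `G`, with value `⊥`
(that is, `-∞`) for the graph without vertices, which has no path at all. -/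
noncomputable def longestPathLength (G : SimpleGraph V) : WithBot ℕ :=
  sSup {m : WithBot ℕ | ∃ (a b : V) (p : G.Walk a b), p.IsPath ∧ m = (p.length : WithBot ℕ)}

/-- `p` is a longest path of `G`. -/
def IsLongestPath (G : SimpleGraph V) {a b : V} (p : G.Walk a b) : Prop :=
  p.IsPath ∧ ∀ (c d : V) (q : G.Walk c d), q.IsPath → q.length ≤ p.length

/-- `v` lies on every longest path of `G`. -/
def IsGallaiVertex (G : SimpleGraph V) (v : V) : Prop :=
  ∀ (a b : V) (p : G.Walk a b), IsLongestPath G p → v ∈ p.support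

/-- The graph `G - v`. -/
def deleteVertex (G : SimpleGraph V) (v : V) : SimpleGraph ({v}ᶜ : Set V) :=
  G.induce ({v}ᶜ : Set V)

end Graphs

/-! ### NP, parallel access to NP, and logarithmically many queries to NP

Languages are over arbitrary alphabets in `Type`; having a machine that reads the input forces the
alphabet to be finite. Polynomial time is with respect to Mathlib's multi-stack Turing machines. -/

section Classes

open Turing

/-- The pair of the word `x` and the bit string `w`, as a word over the disjoint union of the two
alphabets. -/
def encodePair {Γ : Type} (p : List Γ × List Bool) : List (Γ ⊕ Bool) :=
  p.1.map Sum.inl ++ p.2.map Sum.inr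

/-- A list of words as one word: every entry is followed by the separator `none`. -/
def encodeTable {Δ : Type} (t : List (List Δ)) : List (Option Δ) :=
  t.flatMap fun q => q.map some ++ [none]

/-- `L` is in NP: membership has certificates of polynomial length that are checked
in polynomial time. -/
def InNP {Γ : Type} (L : Language Γ) : Prop :=
  ∃ (verify : List Γ × List Bool → Bool) (p : Polynomial ℕ),
    Nonempty (TM2ComputableInPolyTime encodePair Computability.encodeBool verify) ∧
    ∀ x : List Γ, x ∈ L ↔ ∃ w : List Bool, w.length ≤ p.eval x.length ∧ verify (x, w) = true

open Classical in
/-- `L` is decided in polynomial time with parallel (non-adaptive) access to NP: from the input `x`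
a table of queries to an NP language is written in polynomial time, and the decision is made
in polynomial time from `x` and the list of all answers. -/
def InPParallelNP {Γ : Type} (L : Language Γ) : Prop :=
  ∃ (Δ : Type) (A : Language Δ) (table : List Γ → List (List Δ))
    (decision : List Γ × List Bool → Bool),
    InNP A ∧
    Nonempty (TM2ComputableInPolyTime id encodeTable table) ∧
    Nonempty (TM2ComputableInPolyTime encodePair Computability.encodeBool decision) ∧
    ∀ x : List Γ, x ∈ L ↔ decision (x, (table x).map fun q => decide (q ∈ A)) = true

/-- A deterministic oracle Turing machine that decides words over `Γ` and asks membership queries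
for words over `Δ`: a multi-stack machine with a designated query stack and labels
`ask`, `yes`, `no`. -/
structure OracleTM (Γ Δ : Type) where
  /-- the underlying machine; its program at the label `ask` is never executed -/
  tm : FinTM2
  /-- the alphabet of the input stack -/
  inputAlphabet : tm.Γ tm.k₀ ≃ Γ
  /-- the alphabet of the output stack -/
  outputAlphabet : tm.Γ tm.k₁ ≃ Bool
  /-- the query stack -/
  query : tm.K
  /-- the alphabet of the query stack -/
  queryAlphabet : tm.Γ query ≃ Δ
  /-- at this label the content of the query stack is submitted to the oracle -/
  ask : tm.Λ
  /-- the label after a positive answer -/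
  yes : tm.Λ
  /-- the label after a negative answer -/
  no : tm.Λ

namespace OracleTM

variable {Γ Δ : Type} (M : OracleTM Γ Δ) (A : Language Δ)

open Classical in
/-- The configuration after the oracle `A` has answered the word on the query stack; the query
stack is emptied. -/
noncomputable def answer (c : M.tm.Cfg) : M.tm.Cfg where
  l := some (if (c.stk M.query).map M.queryAlphabet ∈ A then M.yes else M.no)
  var := c.var
  stk := Function.update c.stk M.query []

/-- `M.Runs A c t q d`: with oracle `A`, the machine `M` gets from configuration `c` to
configuration `d` in exactly `t` steps, exactly `q` of which are oracle queries. -/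
inductive Runs : M.tm.Cfg → ℕ → ℕ → M.tm.Cfg → Prop
  | refl (c : M.tm.Cfg) : Runs c 0 0 c
  | step {c c' d : M.tm.Cfg} {t q : ℕ} (hc : c.l ≠ some M.ask) (hs : M.tm.step c = some c')
      (h : Runs c' t q d) : Runs c (t + 1) q d
  | query {c d : M.tm.Cfg} {t q : ℕ} (hc : c.l = some M.ask) (h : Runs (M.answer A c) t q d) :
      Runs c (t + 1) (q + 1) d

/-- With oracle `A`, the machine `M` halts on input `x` with exactly the bit `b` on its output
stack, after at most `T` steps and at most `Q` oracle queries. -/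
def DecidesInTime (x : List Γ) (b : Bool) (T Q : ℕ) : Prop :=
  ∃ (t q : ℕ) (d : M.tm.Cfg),
    M.Runs A (initList M.tm (x.map M.inputAlphabet.symm)) t q d ∧
    d.l = none ∧ d.stk M.tm.k₁ = [M.outputAlphabet.symm b] ∧ t ≤ T ∧ q ≤ Q

end OracleTM

open Classical in
/-- `L` is in `Θ₂ᵖ = P^{NP[log n]}`: it is decided by a deterministic polynomial-time oracle machine
that asks `O(log n)` adaptive queries to an NP language, where `n` is the length of the input. -/
def InThetaTwoP {Γ : Type} (L : Language Γ) : Prop :=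
  ∃ (Δ : Type) (A : Language Δ) (M : OracleTM Γ Δ) (p : Polynomial ℕ) (c : ℕ),
    InNP A ∧
    ∀ x : List Γ, M.DecidesInTime A x (decide (x ∈ L)) (p.eval x.length)
      (c * (Nat.log 2 x.length + 1))

end Classes

/-! ### The decision problem -/

open Classical in
/-- A graph on the vertex set `{0, …, n - 1}` as a bit string: `n` in unary, a `false`, and the
rows of the adjacency matrix. -/
noncomputable def encodeGraph {n : ℕ} (G : SimpleGraph (Fin n)) : List Bool :=
  List.replicate n true ++
    false :: (List.finRange n).flatMap fun i => (List.finRange n).map fun j => decide (G.Adj i j)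

/-- The problem Gallai Vertex: given a connected graph, does it have a Gallai vertex? -/
def GallaiVertexProblem : Language Bool :=
  {x | ∃ (n : ℕ) (G : SimpleGraph (Fin n)),
    x = encodeGraph G ∧ G.Connected ∧ ∃ v, IsGallaiVertex G v}

/-! ### Programs for machines with several heads on a read-only input -/

/-! The graph theory is short. A path of `G - v` is a path of `G` that misses `v`, so `v` lies on
all longest paths exactly when some `k` is reached by a path of `G` but by none of `G - v`
(`isGallaiVertex_iff`). Since `k ≤ λ` means that there is a path with at least `k` edges, this is
the inequality between the two values of `λ`.

For the complexity bounds, one NP language `pathQueries` answers two kinds of questions about a word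
`x` and a number `k`. Kind `false` asks whether `x` encodes a connected graph with a path of `k`
edges. Kind `true` asks whether `x` encodes a connected graph which for every vertex `v` has a path
of `k` edges that avoids `v`; a certificate lists all these paths together. The positive queries of
kind `false` are those with `k < K`, where `K = λ(G) + 1`, or `K = 0` if `x` encodes no connected
graph. So `x` is a yes-instance exactly if `0 < K` and the query of kind `true` at `K - 1` is
negative (`exists_query_threshold`). Binary search finds `K` with logarithmically many queries
(`rounds_searching`). With all queries asked at once, it suffices to look for some `k` at which the
first kind is positive and the second negative (`mem_gallaiVertexProblem_iff_query`).

The bulk of the proof provides the Turing machines. Programs are written for a machine with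
boundedly many heads on a read-only word and a write-only output. Such a machine has only
polynomially many configurations apart from its output. Being deterministic, it runs in polynomial
time as soon as it terminates (`exists_iterate_le_card`, `exists_iterate_le_timeBound`), so no
program needs a running time analysis. A stack machine simulates a head by two stacks
(`stepAux_opStmt`). This gives `polyTime_of_exec` for functions and `inThetaTwoP_of_rounds` for
oracle computations.

The predicates to be decided are first-order formulas about positions in a word, with addition and
multiplication. They are evaluated by brute force, with one head for every variable
(`Formula.runs_prog`). The NP verifier is a single such formula (`VFormula.holds_verifier`), whose
soundness and completeness are `hasPaths_of_verifier` and `exists_verifier`. -/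

namespace HeadMachine

/-- A state of a machine with heads `H` on a read-only word: a finite memory, the positions of the
heads, and a write-only output word (the symbol written last comes first). -/
structure St (σ H Ω : Type) where
  var : σ
  pos : H → ℕ
  out : List Ω

/-- Elementary operations. A head is at a position between `0` and the length of the word, and
reads `none` at the latter. -/
inductive Op (α σ H Ω : Type)
  | load (f : σ → σ)
  | right (h : H)
  | left (h : H)
  | read (h : H) (f : σ → Option α → σ)
  | atStart (h : H) (f : σ → Bool → σ)
  | emit (h : H) (f : σ → Option α → Ω)

variable {α σ H Ω : Type}

/-- The effect of an operation on a state. -/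
def Op.apply [DecidableEq H] (u : List α) : Op α σ H Ω → St σ H Ω → St σ H Ω
  | load f, s => { s with var := f s.var }
  | right h, s => { s with pos := Function.update s.pos h (min (s.pos h + 1) u.length) }
  | left h, s => { s with pos := Function.update s.pos h (s.pos h - 1) }
  | read h f, s => { s with var := f s.var u[s.pos h]? }
  | atStart h f, s => { s with var := f s.var (s.pos h == 0) }
  | emit h f, s => { s with out := f s.var u[s.pos h]? :: s.out }

/-- Structured programs. -/
inductive Prog (α σ H Ω : Type)
  | op (o : Op α σ H Ω)
  | seq (p q : Prog α σ H Ω)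
  | ite (c : σ → Bool) (p q : Prog α σ H Ω)
  | loop (c : σ → Bool) (p : Prog α σ H Ω)

/-- `Exec u p s s'`: on the word `u`, the program `p` terminates from `s` in `s'`. -/
inductive Exec [DecidableEq H] (u : List α) : Prog α σ H Ω → St σ H Ω → St σ H Ω → Prop
  | op (o : Op α σ H Ω) (s : St σ H Ω) : Exec u (.op o) s (o.apply u s)
  | seq {p q : Prog α σ H Ω} {s s' s'' : St σ H Ω} : Exec u p s s' → Exec u q s' s'' →
      Exec u (.seq p q) s s''
  | iteTrue {c : σ → Bool} {p q : Prog α σ H Ω} {s s' : St σ H Ω} : c s.var = true →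
      Exec u p s s' → Exec u (.ite c p q) s s'
  | iteFalse {c : σ → Bool} {p q : Prog α σ H Ω} {s s' : St σ H Ω} : c s.var = false →
      Exec u q s s' → Exec u (.ite c p q) s s'
  | loopStep {c : σ → Bool} {p : Prog α σ H Ω} {s s' s'' : St σ H Ω} : c s.var = true →
      Exec u p s s' → Exec u (.loop c p) s' s'' → Exec u (.loop c p) s s''
  | loopEnd {c : σ → Bool} {p : Prog α σ H Ω} {s : St σ H Ω} : c s.var = false →
      Exec u (.loop c p) s s

/-! ### Compilation of structured programs to flowcharts -/

/-- A node of a flowchart; the label `none` is the exit. -/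
inductive Node (α σ H Ω L : Type)
  | op (o : Op α σ H Ω) (next : Option L)
  | test (c : σ → Bool) (yes no : Option L)

/-- Relabelling of the targets of a node. -/
def Node.map {L L' : Type} (g : Option L → Option L') : Node α σ H Ω L → Node α σ H Ω L'
  | op o next => op o (g next)
  | test c yes no => test c (g yes) (g no)

/-- Flowcharts. -/
structure Flow (α σ H Ω : Type) where
  Λ : Type
  fin : Fintype Λ
  entry : Λ
  code : Λ → Node α σ H Ω Λ

namespace Flow

variable [DecidableEq H]

/-- One step of a flowchart; nothing happens at the exit. -/
def step (F : Flow α σ H Ω) (u : List α) : Option F.Λ × St σ H Ω → Option F.Λ × St σ H Ω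
  | (none, s) => (none, s)
  | (some l, s) =>
    match F.code l with
    | .op o next => (next, o.apply u s)
    | .test c yes no => (bif c s.var then yes else no, s)

/-- Renaming of labels, where the exit is replaced by `e`. -/
def rename {L L' : Type} (i : L → L') (e : Option L') (o : Option L) : Option L' :=
  o.elim e (some ∘ i)

theorem step_rename {F G : Flow α σ H Ω} {i : F.Λ → G.Λ} {e : Option G.Λ}
    (hi : ∀ l, G.code (i l) = (F.code l).map (rename i e)) (u : List α) (l : F.Λ)
    (s : St σ H Ω) :
    G.step u (some (i l), s) = (rename i e (F.step u (some l, s)).1, (F.step u (some l, s)).2) := by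
  simp only [step, hi]
  cases F.code l with
  | op o next => rfl
  | test c yes no => cases h : c s.var <;> simp [Node.map, h]

/-- `F` gets from `a` to `b` in some number of steps. -/
def Reach (F : Flow α σ H Ω) (u : List α) (a b : Option F.Λ × St σ H Ω) : Prop :=
  ∃ n, (F.step u)^[n] a = b

theorem Reach.trans {F : Flow α σ H Ω} {u : List α} {a b c : Option F.Λ × St σ H Ω}
    (h₁ : F.Reach u a b) (h₂ : F.Reach u b c) : F.Reach u a c := by
  obtain ⟨n, rfl⟩ := h₁
  obtain ⟨m, rfl⟩ := h₂
  exact ⟨m + n, Function.iterate_add_apply _ _ _ _⟩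

theorem Reach.head {F : Flow α σ H Ω} {u : List α} {a c : Option F.Λ × St σ H Ω}
    (h : F.Reach u (F.step u a) c) : F.Reach u a c :=
  Reach.trans ⟨1, rfl⟩ h

/-- Inside `G`, the exit of `F` is redirected to `e`, where `G` may go on while `F` idles. The idle
steps of `F` are dropped, which is possible because `Reach` leaves the number of steps open. -/
theorem reach_rename {F G : Flow α σ H Ω} {i : F.Λ → G.Λ} {e : Option G.Λ}
    (hi : ∀ l, G.code (i l) = (F.code l).map (rename i e)) {u : List α}
    {a b : Option F.Λ × St σ H Ω} (h : F.Reach u a b) :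
    G.Reach u (rename i e a.1, a.2) (rename i e b.1, b.2) := by
  obtain ⟨n, hn⟩ := h
  induction n generalizing a with
  | zero => exact ⟨0, by rw [← hn]; rfl⟩
  | succ n ih =>
    rw [Function.iterate_succ_apply] at hn
    obtain ⟨l, s⟩ := a
    cases l with
    | none => exact ih hn
    | some l =>
      refine Reach.head ?_
      have := ih hn
      rw [show (rename i e (some l, s).1 : Option G.Λ) = some (i l) from rfl, step_rename hi]
      exact this

end Flow

/-- Sequential composition of flowcharts. -/
def Flow.seq (F G : Flow α σ H Ω) : Flow α σ H Ω where
  Λ := F.Λ ⊕ G.Λ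
  fin := letI := F.fin; letI := G.fin; inferInstance
  entry := .inl F.entry
  code l := match l with
    | .inl l => (F.code l).map (Flow.rename .inl (some (.inr G.entry)))
    | .inr l => (G.code l).map (Flow.rename .inr none)

/-- Case distinction between flowcharts. -/
def Flow.ite (c : σ → Bool) (F G : Flow α σ H Ω) : Flow α σ H Ω where
  Λ := Option (F.Λ ⊕ G.Λ)
  fin := letI := F.fin; letI := G.fin; inferInstance
  entry := none
  code l := match l with
    | none => .test c (some (some (.inl F.entry))) (some (some (.inr G.entry)))
    | some (.inl l) => (F.code l).map (Flow.rename (some ∘ Sum.inl) none)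
    | some (.inr l) => (G.code l).map (Flow.rename (some ∘ Sum.inr) none)

/-- Iteration of a flowchart. -/
def Flow.loop (c : σ → Bool) (F : Flow α σ H Ω) : Flow α σ H Ω where
  Λ := Option F.Λ
  fin := letI := F.fin; inferInstance
  entry := none
  code l := match l with
    | none => .test c (some (some F.entry)) none
    | some l => (F.code l).map (Flow.rename some (some none))

/-- The flowchart of a structured program. -/
def compile : Prog α σ H Ω → Flow α σ H Ω
  | .op o => ⟨Unit, inferInstance, (), fun _ => .op o none⟩
  | .seq p q => (compile p).seq (compile q)
  | .ite c p q => (compile p).ite c (compile q)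
  | .loop c p => (compile p).loop c

/-- Each part of a program sits in the compiled flowchart with its exit redirected: to the entry of
the next part, to the test of the enclosing loop, or to the common exit. So `reach_rename`
transports the runs of the parts. -/
theorem reach_of_exec [DecidableEq H] {u : List α} {p : Prog α σ H Ω} {s s' : St σ H Ω}
    (h : Exec u p s s') : (compile p).Reach u (some (compile p).entry, s) (none, s') := by
  induction h with
  | op o s => exact ⟨1, rfl⟩
  | @seq p q s s' s'' _ _ ih₁ ih₂ =>
    exact (Flow.reach_rename (G := compile (.seq p q)) (i := Sum.inl)
      (e := some (Sum.inr (compile q).entry)) (fun l => by rfl) ih₁).trans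
      (Flow.reach_rename (G := compile (.seq p q)) (i := Sum.inr) (e := none) (fun l => by rfl) ih₂)
  | @iteTrue c p q s s' hc _ ih =>
    refine Flow.Reach.head ?_
    have := Flow.reach_rename (G := compile (.ite c p q)) (i := some ∘ Sum.inl) (e := none)
      (fun l => by rfl) ih
    simp only [Flow.step, compile, Flow.ite, hc, cond_true]
    exact this
  | @iteFalse c p q s s' hc _ ih =>
    refine Flow.Reach.head ?_
    have := Flow.reach_rename (G := compile (.ite c p q)) (i := some ∘ Sum.inr) (e := none)
      (fun l => by rfl) ih
    simp only [Flow.step, compile, Flow.ite, hc, cond_false]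
    exact this
  | @loopStep c p s s' s'' hc _ _ ih₁ ih₂ =>
    refine Flow.Reach.head (Flow.Reach.trans ?_ ih₂)
    have := Flow.reach_rename (G := compile (.loop c p)) (i := some) (e := some none)
      (fun l => by rfl) ih₁
    simp only [Flow.step, compile, Flow.loop, hc, cond_true]
    exact this
  | @loopEnd c p s hc =>
    refine ⟨1, ?_⟩
    simp only [Function.iterate_one, Flow.step, compile, Flow.loop, hc, cond_false]

/-! ### Running times by counting configurations -/

/-- A deterministic system whose behaviour is determined by a projection to a finite set halts
within the cardinality of that set, if it halts at all. -/
theorem exists_iterate_le_card {C X : Type*} [Fintype X] (f : C → C) (halted : C → Prop)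
    (I : C → Prop) (π : C → X) (hI : ∀ c, I c → I (f c))
    (hπ : ∀ a b, I a → I b → π a = π b → π (f a) = π (f b))
    (hh : ∀ a b, I a → I b → π a = π b → halted a → halted b)
    (hf : ∀ c, halted c → f c = c) {a b : C} (ha : I a) {n : ℕ} (hn : f^[n] a = b)
    (hb : halted b) : ∃ t ≤ Fintype.card X, f^[t] a = b := by
  classical
  have hex : ∃ t, halted (f^[t] a) := ⟨n, hn ▸ hb⟩
  set t := Nat.find hex with ht
  have hall : ∀ m, I (f^[m] a) := by
    intro m
    induction m with
    | zero => exact ha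
    | succ m ih => rw [Function.iterate_succ_apply']; exact hI _ ih
  have heq : f^[t] a = b := by
    have htn : t ≤ n := Nat.find_min' hex (hn ▸ hb)
    obtain ⟨d, rfl⟩ := Nat.exists_eq_add_of_le' htn
    rw [Function.iterate_add_apply, Function.iterate_fixed (hf _ (Nat.find_spec hex))] at hn
    exact hn
  refine ⟨t, ?_, heq⟩
  by_contra! hlt
  -- Two of the first `card X + 1` configurations have the same projection, and from there on the
  -- two orbits have equal projections.
  obtain ⟨i, j, hij, hpi⟩ := Fintype.exists_ne_map_eq_of_card_lt
    (fun i : Fin (Fintype.card X + 1) => π (f^[i] a)) (by simp)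
  wlog hlt' : i < j generalizing i j
  · exact this j i hij.symm hpi.symm (lt_of_le_of_ne (not_lt.1 hlt') hij.symm)
  have key : ∀ m, π (f^[i + m] a) = π (f^[j + m] a) := by
    intro m
    induction m with
    | zero => exact hpi
    | succ m ih =>
      rw [← add_assoc, ← add_assoc, Function.iterate_succ_apply', Function.iterate_succ_apply']
      exact hπ _ _ (hall _) (hall _) ih
  have hjt : (j : ℕ) ≤ t := by omega
  have hk := key (t - j)
  rw [Nat.add_sub_cancel' hjt] at hk
  -- Shifting the first halting time `t` back by `j - i` gives an earlier halting time.
  refine Nat.find_min hex (m := i + (t - j)) ?_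
    (hh _ _ (hall _) (hall _) hk.symm (Nat.find_spec hex))
  have : (i : ℕ) < j := hlt'
  omega

/-- All heads are on the word or at its end. -/
def Valid (u : List α) (s : St σ H Ω) : Prop := ∀ h, s.pos h ≤ u.length

theorem Op.valid_apply [DecidableEq H] {u : List α} (o : Op α σ H Ω) {s : St σ H Ω}
    (hs : Valid u s) : Valid u (o.apply u s) := by
  intro h
  have := hs h
  cases o with
  | right k =>
    by_cases e : h = k
    · subst e; simp [Op.apply]
    · simpa [Op.apply, e] using this
  | left k =>
    by_cases e : h = k
    · subst e; simp only [Op.apply, Function.update_self]; omega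
    · simpa [Op.apply, e] using this
  | _ => exact this

theorem Exec.valid [DecidableEq H] {u : List α} {p : Prog α σ H Ω} {s s' : St σ H Ω}
    (h : Exec u p s s') (hs : Valid u s) : Valid u s' := by
  induction h with
  | op o s => exact o.valid_apply hs
  | seq _ _ ih₁ ih₂ => exact ih₂ (ih₁ hs)
  | iteTrue _ _ ih => exact ih hs
  | iteFalse _ _ ih => exact ih hs
  | loopStep _ _ _ ih₁ ih₂ => exact ih₂ (ih₁ hs)
  | loopEnd _ => exact hs

theorem Flow.valid_step [DecidableEq H] {u : List α} (F : Flow α σ H Ω)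
    {c : Option F.Λ × St σ H Ω} (hc : Valid u c.2) : Valid u (F.step u c).2 := by
  obtain ⟨l, s⟩ := c
  cases l with
  | none => exact hc
  | some l =>
    simp only [Flow.step]
    cases F.code l with
    | op o next => exact o.valid_apply hc
    | test c yes no => exact hc

/-- A bound on the running time of a program on words of length `N`. -/
noncomputable def timeBound [Fintype σ] [Fintype H] (p : Prog α σ H Ω) (N : ℕ) : ℕ :=
  letI := (compile p).fin
  (Fintype.card (Option (compile p).Λ) * Fintype.card σ) * (N + 1) ^ Fintype.card H

/-- The output is never read, so label, memory and head positions determine the further course. For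
heads that stay on the word there are only `timeBound` many such triples. -/
theorem exists_iterate_le_timeBound [Fintype σ] [Fintype H] [DecidableEq H] {u : List α}
    {p : Prog α σ H Ω} {s s' : St σ H Ω} (h : Exec u p s s') (hs : Valid u s) :
    ∃ t ≤ timeBound p u.length,
      ((compile p).step u)^[t] (some (compile p).entry, s) = (none, s') := by
  classical
  let _ := (compile p).fin
  obtain ⟨n, hn⟩ := reach_of_exec h
  suffices h : ∃ t ≤ Fintype.card ((Option (compile p).Λ × σ) × (H → Fin (u.length + 1))),
      ((compile p).step u)^[t] (some (compile p).entry, s) = (none, s') by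
    obtain ⟨t, ht, hts⟩ := h
    exact ⟨t, ht.trans (le_of_eq (by simp [timeBound])), hts⟩
  refine exists_iterate_le_card ((compile p).step u) (fun c => c.1 = none)
    (fun c => Valid u c.2) (fun c => ((c.1, c.2.var), fun h => Fin.ofNat _ (c.2.pos h)))
    (fun c hc => (compile p).valid_step hc) ?_ ?_ ?_ hs hn rfl
  · rintro ⟨l, v, P, o⟩ ⟨l', v', P', o'⟩ ha hb hab
    simp only [Prod.mk.injEq] at hab
    obtain ⟨⟨rfl, rfl⟩, hP⟩ := hab
    -- `Fin.ofNat` reduces modulo `u.length + 1`, which loses nothing for valid head positions.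
    obtain rfl : P = P' := by
      funext h
      have := congrArg Fin.val (congrFun hP h)
      simp only [Fin.val_ofNat] at this
      rwa [Nat.mod_eq_of_lt (Nat.lt_succ_of_le (ha h)),
        Nat.mod_eq_of_lt (Nat.lt_succ_of_le (hb h))] at this
    cases l with
    | none => rfl
    | some l =>
      simp only [Flow.step]
      cases (compile p).code l with
      | op op next => cases op <;> rfl
      | test c yes no => rfl
  · rintro ⟨l, s⟩ ⟨l', s'⟩ - - hab rfl
    simp only [Prod.mk.injEq] at hab
    exact hab.1.1.symm
  · rintro ⟨l, s⟩ rfl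
    rfl

end HeadMachine

/-! ### Simulation of heads by stacks -/

namespace HeadMachine

open Turing

variable {α σ H Ω : Type}

/-- `Steps f P n c d`: the partial function `f` gets from `c` to `d` in `n` steps, and each of
the configurations before `d` satisfies `P`. -/
inductive Steps {C : Type*} (f : C → Option C) (P : C → Prop) : ℕ → C → C → Prop
  | refl (c : C) : Steps f P 0 c c
  | head {c c' d : C} {n : ℕ} : P c → f c = some c' → Steps f P n c' d → Steps f P (n + 1) c d

theorem Steps.trans {C : Type*} {f : C → Option C} {P : C → Prop} {n m : ℕ} {a b c : C}
    (h₁ : Steps f P n a b) (h₂ : Steps f P m b c) : Steps f P (n + m) a c := by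
  induction h₁ with
  | refl => simpa using h₂
  | head hP hf _ ih => rw [Nat.add_right_comm]; exact .head hP hf (ih h₂)

theorem Steps.iterate_eq {C : Type*} {f : C → Option C} {P : C → Prop} {n : ℕ} {a b : C}
    (h : Steps f P n a b) : (flip bind f)^[n] (some a) = some b := by
  induction h with
  | refl => rfl
  | head _ hf _ ih =>
    rw [Function.iterate_succ_apply, ← ih, ← hf]
    rfl

/-- The stacks of the simulating machine: input, output, a second output, and for every head the
parts of the word to the left and to the right of it. -/
inductive Stk (H : Type)
  | inp
  | out
  | res
  | lft (h : H)
  | rgt (h : H)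
  deriving DecidableEq

noncomputable instance [Fintype H] : Fintype (Stk H) :=
  Fintype.ofInjective
    (fun k : Stk H => (match k with
      | .inp => .inl 0
      | .out => .inl 1
      | .res => .inl 2
      | .lft h => .inr (.inl h)
      | .rgt h => .inr (.inr h) : Fin 3 ⊕ H ⊕ H))
    (by rintro (_ | _ | _ | h | h) (_ | _ | _ | h' | h') <;> simp)

/-- The alphabets of the stacks. -/
abbrev Alph (α Ω : Type) : Stk H → Type
  | .inp => α
  | .out => Ω
  | .res => Bool
  | .lft _ => α
  | .rgt _ => α

/-- The contents of the stacks in a given state. -/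
def stkOf (u : List α) (s : St σ H Ω) : (k : Stk H) → List (Alph α Ω k)
  | .inp => []
  | .out => s.out
  | .res => []
  | .lft h => (u.take (s.pos h)).reverse
  | .rgt h => u.drop (s.pos h)

/-- The stacks that hold `w` as input, `acc` to the left of each head, and `o` as output. -/
def ioStk (w acc : List α) (o : List Ω) : (k : Stk H) → List (Alph α Ω k)
  | .inp => w
  | .out => o
  | .res => []
  | .lft _ => acc
  | .rgt _ => []

section Simulation

variable [DecidableEq H] [Inhabited α] {L : Type}

/-- The statement that executes an operation. -/
def opStmt : Op α σ H Ω → TM2.Stmt (Alph (H := H) α Ω) L (σ × Option α) →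
    TM2.Stmt (Alph (H := H) α Ω) L (σ × Option α)
  | .load f, k => .load (fun v => (f v.1, v.2)) k
  | .right h, k => .pop (.rgt h) (fun v o => (v.1, o)) <| .branch (fun v => v.2.isSome)
      (.push (.lft h) (fun v => v.2.getD default) <| .load (fun v => (v.1, none)) k) k
  | .left h, k => .pop (.lft h) (fun v o => (v.1, o)) <| .branch (fun v => v.2.isSome)
      (.push (.rgt h) (fun v => v.2.getD default) <| .load (fun v => (v.1, none)) k) k
  | .read h f, k => .peek (.rgt h) (fun v o => (f v.1 o, none)) k
  | .atStart h f, k => .peek (.lft h) (fun v o => (f v.1 o.isNone, none)) k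
  | .emit h f, k => .peek (.rgt h) (fun v o => (v.1, o)) <| .push .out (fun v => f v.1 v.2) <|
      .load (fun v => (v.1, none)) k

/-- Moving a head pops a letter from one of its two stacks and pushes it on the other; the register
carries the letter in between and is reset to `none`. At either end of the word the pop yields
nothing and the branch leaves the stacks alone, in agreement with the truncation in `Op.apply`. -/
theorem stepAux_opStmt {u : List α} {s : St σ H Ω} (hs : Valid u s) (o : Op α σ H Ω)
    (k : TM2.Stmt (Alph (H := H) α Ω) L (σ × Option α)) :
    TM2.stepAux (opStmt o k) (s.var, none) (stkOf u s) =
      TM2.stepAux k ((o.apply u s).var, none) (stkOf u (o.apply u s)) := by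
  cases o with
  | load f => rfl
  | read h f => simp [opStmt, stkOf, Op.apply]; rfl
  | atStart h f =>
    have h1 : (List.take (s.pos h) u).reverse.head?.isNone = (s.pos h == 0) := by
      have := hs h
      rw [Bool.eq_iff_iff, Option.isNone_iff_eq_none, List.head?_eq_none_iff,
        List.reverse_eq_nil_iff, List.take_eq_nil_iff, beq_iff_eq]
      -- The left stack is also empty if the whole word is; then validity forces the position `0`.
      refine ⟨fun h => h.elim id fun h => ?_, Or.inl⟩
      subst h
      simpa using this
    change TM2.stepAux k (f s.var (List.take (s.pos h) u).reverse.head?.isNone, none) _ = _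
    rw [h1]
    rfl
  | emit h f =>
    simp only [opStmt, TM2.stepAux, Op.apply]
    congr 1
    funext k
    cases k <;> simp [stkOf]
  | right h =>
    simp only [opStmt, TM2.stepAux, Op.apply]
    have := hs h
    rcases Nat.lt_or_ge (s.pos h) u.length with h1 | h1
    · have hp : min (s.pos h + 1) u.length = s.pos h + 1 := Nat.min_eq_left h1
      have hd : (stkOf u s (.rgt h)).head? = some (u[s.pos h]) := by
        simp [stkOf, h1]
      rw [hd]
      simp only [Option.isSome_some, cond_true, Option.getD_some]
      congr 1
      funext k
      rcases k with _ | _ | _ | k | k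
      · simp [stkOf]
      · simp [stkOf]
      · simp [stkOf]
      · by_cases e : k = h
        · subst e
          simp only [stkOf, Function.update_self, hp, ne_eq, reduceCtorEq, not_false_eq_true,
            Function.update_of_ne]
          rw [List.take_succ_eq_append_getElem h1, List.reverse_append]
          rfl
        · simp [stkOf, e]
      · by_cases e : k = h
        · subst e
          simp only [stkOf, Function.update_self, hp, List.tail_drop, ne_eq, reduceCtorEq,
            not_false_eq_true, Function.update_of_ne]
        · simp [stkOf, e]
    · have h2 : s.pos h = u.length := le_antisymm this h1
      have hd : (stkOf u s (.rgt h)) = [] := by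
        simp [stkOf, h2]
      rw [hd]
      simp only [List.head?_nil, Option.isSome_none, cond_false, List.tail_nil]
      congr 1
      funext k
      rcases k with _ | _ | _ | k | k
      · simp [stkOf]
      · simp [stkOf]
      · simp [stkOf]
      · by_cases e : k = h
        · subst e
          simp [stkOf, h2]
        · simp [stkOf, e]
      · by_cases e : k = h
        · subst e
          simp [stkOf, h2]
        · simp [stkOf, e]
  | left h =>
    simp only [opStmt, TM2.stepAux, Op.apply]
    have := hs h
    rcases Nat.eq_zero_or_pos (s.pos h) with h1 | h1
    · have hd : (stkOf u s (.lft h)) = [] := by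
        simp [stkOf, h1]
      rw [hd]
      simp only [List.head?_nil, Option.isSome_none, cond_false, List.tail_nil]
      congr 1
      funext k
      rcases k with _ | _ | _ | k | k
      · simp [stkOf]
      · simp [stkOf]
      · simp [stkOf]
      · by_cases e : k = h
        · subst e
          simp [stkOf, h1]
        · simp [stkOf, e]
      · by_cases e : k = h
        · subst e
          simp [stkOf, h1]
        · simp [stkOf, e]
    · obtain ⟨m, hm⟩ := Nat.exists_eq_succ_of_ne_zero h1.ne'
      have h2 : m < u.length := by omega
      have hd : (stkOf u s (.lft h)) = u[m] :: (u.take m).reverse := by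
        simp only [stkOf, hm, Nat.succ_eq_add_one]
        rw [List.take_add_one]
        simp [h2]
      rw [hd]
      simp only [List.head?_cons, Option.isSome_some, cond_true, List.tail_cons, Option.getD_some]
      congr 1
      funext k
      rcases k with _ | _ | _ | k | k
      · simp [stkOf]
      · simp [stkOf]
      · simp [stkOf]
      · by_cases e : k = h
        · subst e
          simp [stkOf, hm]
        · simp [stkOf, e]
      · by_cases e : k = h
        · subst e
          simp only [stkOf, Function.update_self, hm, Nat.succ_eq_add_one, Nat.add_sub_cancel, ne_eq,
            reduceCtorEq, not_false_eq_true, Function.update_of_ne, List.getElem_cons_drop]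
        · simp [stkOf, e]

/-- The statement at a node of a flowchart. -/
def nodeStmt {Λ : Type} (run : Λ → L) (exit : L) :
    Node α σ H Ω Λ → TM2.Stmt (Alph (H := H) α Ω) L (σ × Option α)
  | .op o next => opStmt o (.goto fun _ => next.elim exit run)
  | .test c yes no => .goto fun v => (bif c v.1 then yes else no).elim exit run

/-- The configuration at a given label in a given state. -/
def cfgOf (u : List α) (l : L) (s : St σ H Ω) : TM2.Cfg (Alph (H := H) α Ω) L (σ × Option α) :=
  ⟨some l, (s.var, none), stkOf u s⟩

/-- Every node of the flowchart costs one machine step. The number of steps is only bounded by `t`,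
because the flowchart may already idle at its exit. -/
theorem steps_of_iterate {m : L → TM2.Stmt (Alph (H := H) α Ω) L (σ × Option α)}
    {F : Flow α σ H Ω} {run : F.Λ → L} {exit : L}
    (hm : ∀ l, m (run l) = nodeStmt run exit (F.code l))
    {P : TM2.Cfg (Alph (H := H) α Ω) L (σ × Option α) → Prop}
    (hP : ∀ l c, c.l = some (run l) → P c) {u : List α} {t : ℕ} {l : Option F.Λ}
    {s s' : St σ H Ω} (hs : Valid u s) (h : (F.step u)^[t] (l, s) = (none, s')) :
    ∃ n ≤ t, Steps (TM2.step m) P n (cfgOf u (l.elim exit run) s) (cfgOf u exit s') := by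
  induction t generalizing l s with
  | zero =>
    simp only [Function.iterate_zero, id_eq, Prod.mk.injEq] at h
    obtain ⟨rfl, rfl⟩ := h
    exact ⟨0, le_rfl, .refl _⟩
  | succ t ih =>
    rw [Function.iterate_succ_apply] at h
    cases l with
    | none =>
      obtain ⟨n, hn, hst⟩ := ih hs h
      exact ⟨n, by omega, hst⟩
    | some l =>
      have hv := F.valid_step (c := (some l, s)) hs
      obtain ⟨n, hn, hst⟩ := ih hv h
      refine ⟨n + 1, by omega, .head (hP l _ rfl) ?_ hst⟩
      simp only [cfgOf, TM2.step, Option.elim_some, hm, Flow.step]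
      cases F.code l with
      | op o next => rw [nodeStmt, stepAux_opStmt hs]; rfl
      | test c yes no => rfl

theorem steps_of_exec [Fintype σ] [Fintype H]
    {m : L → TM2.Stmt (Alph (H := H) α Ω) L (σ × Option α)}
    {p : Prog α σ H Ω} {run : (compile p).Λ → L} {exit : L}
    (hm : ∀ l, m (run l) = nodeStmt run exit ((compile p).code l))
    {P : TM2.Cfg (Alph (H := H) α Ω) L (σ × Option α) → Prop}
    (hP : ∀ l c, c.l = some (run l) → P c) {u : List α}
    {s s' : St σ H Ω} (hs : Valid u s) (h : Exec u p s s') :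
    ∃ n ≤ timeBound p u.length, Steps (TM2.step m) P n
      (cfgOf u (run (compile p).entry) s) (cfgOf u exit s') := by
  obtain ⟨t, ht, hts⟩ := exists_iterate_le_timeBound h hs
  obtain ⟨n, hn, hst⟩ := steps_of_iterate hm hP hs hts
  exact ⟨n, hn.trans ht, hst⟩

/-- Push the symbol in the register to the left of all heads in the list. -/
def pushAll (hs : List H) (k : TM2.Stmt (Alph (H := H) α Ω) L (σ × Option α)) :
    TM2.Stmt (Alph (H := H) α Ω) L (σ × Option α) :=
  hs.foldr (fun h k => .push (.lft h) (fun v => v.2.getD default) k) k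

theorem stepAux_pushAll (hs : List H) (hn : hs.Nodup)
    (k : TM2.Stmt (Alph (H := H) α Ω) L (σ × Option α)) (v : σ) (a : α)
    (S : (k : Stk H) → List (Alph α Ω k)) :
    TM2.stepAux (pushAll hs k) (v, some a) S = TM2.stepAux k (v, some a) (fun k => match k with
      | .inp => S .inp
      | .out => S .out
      | .res => S .res
      | .lft h => if h ∈ hs then a :: S (.lft h) else S (.lft h)
      | .rgt h => S (.rgt h)) := by
  induction hs generalizing S with
  | nil =>
    simp only [pushAll, List.foldr_nil]
    congr 1
    funext k
    cases k <;> simp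
  | cons h hs ih =>
    obtain ⟨h1, h2⟩ := List.nodup_cons.1 hn
    simp only [pushAll, List.foldr_cons, TM2.stepAux]
    refine (ih h2 _).trans ?_
    congr 1
    funext k
    rcases k with _ | _ | _ | k | k
    · simp
    · simp
    · simp
    · by_cases e : k = h
      · subst e; simp [h1]
      · simp [e]
    · simp

/-- The statement that moves one symbol of the input to all heads. -/
noncomputable def bootStmt [Fintype H] (boot start : L) : TM2.Stmt (Alph (H := H) α Ω) L (σ × Option α) :=
  .pop .inp (fun v o => (v.1, o)) <| .branch (fun v => v.2.isSome)
    (pushAll Finset.univ.toList <| .load (fun v => (v.1, none)) <| .goto fun _ => boot)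
    (.goto fun _ => start)

/-- Popping the input and pushing every letter to the left of all heads reverses the word on each
left stack. This is the representation of a head at the end of the word, which is why programs start
in `startSt`. -/
theorem steps_boot [Fintype H] {m : L → TM2.Stmt (Alph (H := H) α Ω) L (σ × Option α)}
    {boot start : L} (hm : m boot = bootStmt boot start)
    {P : TM2.Cfg (Alph (H := H) α Ω) L (σ × Option α) → Prop}
    (hP : ∀ c, c.l = some boot → P c) (v : σ) (w acc : List α) :
    Steps (TM2.step m) P (w.length + 1)
      ⟨some boot, (v, none), ioStk w acc []⟩
      ⟨some start, (v, none), ioStk [] (w.reverse ++ acc) []⟩ := by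
  induction w generalizing acc with
  | nil =>
    refine .head (hP _ rfl) ?_ (.refl _)
    simp only [TM2.step, hm, bootStmt, TM2.stepAux, ioStk, List.head?_nil, Option.isSome_none,
      cond_false, List.tail_nil]
    congr 2
    funext k
    cases k <;> simp [ioStk]
  | cons a w ih =>
    refine .head (hP _ rfl) ?_ ((ih (a :: acc)).trans (m := 0) ?_)
    · simp only [TM2.step, hm, bootStmt, TM2.stepAux, ioStk, List.head?_cons, Option.isSome_some,
        cond_true, List.tail_cons]
      rw [stepAux_pushAll _ (Finset.nodup_toList _)]
      simp only [TM2.stepAux]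
      congr 2
      funext k
      cases k <;> simp [ioStk]
    · simp only [List.reverse_cons, List.append_assoc, List.singleton_append]
      exact .refl _

/-- The state in which a program is started. -/
def startSt (v : σ) (u : List α) : St σ H Ω := ⟨v, fun _ => u.length, []⟩

omit [DecidableEq H] [Inhabited α] in
theorem valid_startSt (v : σ) (u : List α) : Valid u (startSt v u : St σ H Ω) := fun _ => le_rfl

theorem steps_boot_startSt [Fintype H]
    {m : L → TM2.Stmt (Alph (H := H) α Ω) L (σ × Option α)}
    {boot start : L} (hm : m boot = bootStmt boot start)
    {P : TM2.Cfg (Alph (H := H) α Ω) L (σ × Option α) → Prop}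
    (hP : ∀ c, c.l = some boot → P c) (v : σ) (u : List α) :
    Steps (TM2.step m) P (u.length + 1)
      ⟨some boot, (v, none), ioStk u [] []⟩
      (cfgOf u start (startSt v u)) := by
  have := steps_boot hm hP v u []
  convert this using 1
  simp only [cfgOf, startSt]
  congr 1
  funext k
  cases k <;> simp [stkOf, ioStk]

/-- Pop the stacks of all heads in the list, and remember some symbol if there is one. -/
def popAll (hs : List H) (k : TM2.Stmt (Alph (H := H) α Ω) L (σ × Option α)) :
    TM2.Stmt (Alph (H := H) α Ω) L (σ × Option α) :=
  hs.foldr (fun h k => .pop (.lft h) (fun v o => (v.1, v.2.or o)) <|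
    .pop (.rgt h) (fun v o => (v.1, v.2.or o)) k) k

-- The register collects a letter from any nonempty stack, so that one pass both shortens all stacks
-- and finds out whether they were empty already.
omit [Inhabited α] in
theorem stepAux_popAll (hs : List H) (hn : hs.Nodup)
    (k : TM2.Stmt (Alph (H := H) α Ω) L (σ × Option α)) (v : σ) (c : Option α)
    (S : (k : Stk H) → List (Alph α Ω k)) :
    ∃ c', (c' = none ↔ c = none ∧ ∀ h ∈ hs, S (.lft h) = [] ∧ S (.rgt h) = []) ∧
      TM2.stepAux (popAll hs k) (v, c) S = TM2.stepAux k (v, c') (fun k => match k with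
      | .inp => S .inp
      | .out => S .out
      | .res => S .res
      | .lft h => if h ∈ hs then (S (.lft h)).tail else S (.lft h)
      | .rgt h => if h ∈ hs then (S (.rgt h)).tail else S (.rgt h)) := by
  induction hs generalizing S c with
  | nil =>
    refine ⟨c, by simp, ?_⟩
    simp only [popAll, List.foldr_nil]
    congr 1
    funext k
    cases k <;> simp
  | cons h hs ih =>
    obtain ⟨h1, h2⟩ := List.nodup_cons.1 hn
    obtain ⟨c', hc', hstep⟩ := ih h2 ((c.or (S (.lft h)).head?).or (S (.rgt h)).head?)
      (Function.update (Function.update S (.lft h) (S (.lft h)).tail) (.rgt h) (S (.rgt h)).tail)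
    refine ⟨c', ?_, ?_⟩
    · rw [hc']
      have hne : ∀ k ∈ hs, k ≠ h := fun k hk e => h1 (e ▸ hk)
      simp only [Option.or_eq_none_iff, List.head?_eq_none_iff, List.mem_cons, forall_eq_or_imp]
      constructor
      · rintro ⟨⟨⟨h3, h4⟩, h5⟩, h6⟩
        refine ⟨h3, ⟨h4, h5⟩, fun k hk => ?_⟩
        simpa [hne k hk] using h6 k hk
      · rintro ⟨h3, ⟨h4, h5⟩, h6⟩
        refine ⟨⟨⟨h3, h4⟩, h5⟩, fun k hk => ?_⟩
        simpa [hne k hk] using h6 k hk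
    · simp only [popAll, List.foldr_cons, TM2.stepAux]
      refine Eq.trans ?_ (hstep.trans ?_)
      · simp [popAll]
      · congr 1
        funext k
        rcases k with _ | _ | _ | k | k
        · simp
        · simp
        · simp
        · by_cases e : k = h
          · subst e; simp [h1]
          · simp [e]
        · by_cases e : k = h
          · subst e; simp [h1]
          · simp [e]

/-- The statement that empties the stacks of all heads, halting when this is done. -/
noncomputable def cleanStmt [Fintype H] (init : σ) (clean : L) :
    TM2.Stmt (Alph (H := H) α Ω) L (σ × Option α) :=
  .load (fun v => (v.1, none)) <| popAll Finset.univ.toList <| .branch (fun v => v.2.isSome)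
    (.goto fun _ => clean) (.load (fun _ => (init, none)) .halt)

-- A halting configuration in the sense of `haltList` has the initial memory and nothing but the
-- output on its stacks, hence the stacks of the heads have to be cleared. Each pass shortens all of
-- them by one letter, and the last one finds them empty.
omit [Inhabited α] in
theorem steps_clean [Fintype H] {m : L → TM2.Stmt (Alph (H := H) α Ω) L (σ × Option α)}
    {init : σ} {clean : L} (hm : m clean = cleanStmt init clean) (N : ℕ) (v : σ × Option α)
    (S : (k : Stk H) → List (Alph α Ω k)) (hl : ∀ h, (S (.lft h)).length ≤ N)
    (hr : ∀ h, (S (.rgt h)).length ≤ N) :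
    ∃ n ≤ N + 1, Steps (TM2.step m) (fun _ => True) n ⟨some clean, v, S⟩
      ⟨none, (init, none), fun k => match k with
        | .inp => S .inp
        | .out => S .out
        | .res => S .res
        | .lft _ => []
        | .rgt _ => []⟩ := by
  induction N generalizing v S with
  | zero =>
    refine ⟨1, le_rfl, .head trivial ?_ (.refl _)⟩
    obtain ⟨c', hc', hstep⟩ := stepAux_popAll (L := L) (Finset.univ : Finset H).toList
      (Finset.nodup_toList _) (.branch (fun v => v.2.isSome)
      (.goto fun _ => clean) (.load (fun _ => (init, none)) .halt)) v.1 none S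
    have hl' : ∀ h, S (.lft h) = [] := fun h => List.length_eq_zero_iff.1 (Nat.le_zero.1 (hl h))
    have hr' : ∀ h, S (.rgt h) = [] := fun h => List.length_eq_zero_iff.1 (Nat.le_zero.1 (hr h))
    obtain rfl : c' = none := hc'.2 ⟨rfl, fun h _ => ⟨hl' h, hr' h⟩⟩
    simp only [TM2.step, hm, cleanStmt, TM2.stepAux, hstep, Option.isSome_none, cond_false]
    congr 2
    funext k
    cases k <;> simp [hl', hr']
  | succ N ih =>
    obtain ⟨c', hc', hstep⟩ := stepAux_popAll (L := L) (Finset.univ : Finset H).toList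
      (Finset.nodup_toList _) (.branch (fun v => v.2.isSome)
      (.goto fun _ => clean) (.load (fun _ => (init, none)) .halt)) v.1 none S
    cases c' with
    | none =>
      refine ⟨1, by omega, .head trivial ?_ (.refl _)⟩
      have hS := (hc'.1 rfl).2
      simp only [Finset.mem_toList, Finset.mem_univ, true_imp_iff] at hS
      simp only [TM2.step, hm, cleanStmt, TM2.stepAux, hstep, Option.isSome_none, cond_false]
      congr 2
      funext k
      cases k <;> simp [hS]
    | some a =>
      obtain ⟨n, hn, hst⟩ := ih (v.1, some a) (fun k => match k with
        | .inp => S .inp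
        | .out => S .out
        | .res => S .res
        | .lft h => (S (.lft h)).tail
        | .rgt h => (S (.rgt h)).tail)
        (fun h => by have := hl h; simp only [List.length_tail]; omega)
        (fun h => by have := hr h; simp only [List.length_tail]; omega)
      refine ⟨n + 1, by omega, .head trivial ?_ hst⟩
      simp only [TM2.step, hm, cleanStmt, TM2.stepAux, hstep, Option.isSome_some, cond_true]
      congr 2
      funext k
      cases k <;> simp

end Simulation

end HeadMachine

/-! ### Polynomial-time functions and oracle computations from programs -/

namespace HeadMachine

open Turing

variable {α σ H Ω : Type}

/-- The bound on the running time of a program, as a polynomial. -/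
noncomputable def timePoly [Fintype σ] [Fintype H] (p : Prog α σ H Ω) : Polynomial ℕ :=
  letI := (compile p).fin
  Polynomial.C (Fintype.card (Option (compile p).Λ) * Fintype.card σ) *
    (Polynomial.X + 1) ^ Fintype.card H

theorem eval_timePoly [Fintype σ] [Fintype H] (p : Prog α σ H Ω) (N : ℕ) :
    (timePoly p).eval N = timeBound p N := by
  simp [timePoly, timeBound]

variable [Fintype α] [Inhabited α] [Fintype σ] [Fintype H] [DecidableEq H]

/-- The Turing machine that executes a program and leaves its output. -/
noncomputable def computer (p : Prog α σ H Ω) (init : σ) : FinTM2 where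
  K := Stk H
  k₀ := .inp
  k₁ := .out
  Γ := Alph α Ω
  Λ := Option (Option (compile p).Λ)
  ΛFin := letI := (compile p).fin; inferInstance
  main := none
  σ := σ × Option α
  initialState := (init, none)
  Γk₀Fin := inferInstanceAs (Fintype α)
  m l := match l with
    | none => bootStmt none (some (some (compile p).entry))
    | some none => cleanStmt init (some none)
    | some (some l) => nodeStmt (fun l => some (some l)) (some none) ((compile p).code l)

theorem initList_computer (p : Prog α σ H Ω) (init : σ) (u : List α) :
    initList (computer p init) u = ⟨some none, (init, none), ioStk u [] []⟩ := by
  refine congrArg (TM2.Cfg.mk (some none) (init, none)) ?_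
  funext k
  cases k <;> rfl

theorem haltList_computer (p : Prog α σ H Ω) (init : σ) (u : List Ω) :
    haltList (computer p init) u = ⟨none, (init, none), ioStk [] [] u⟩ := by
  refine congrArg (TM2.Cfg.mk none (init, none)) ?_
  funext k
  cases k <;> rfl

theorem computer_outputs (p : Prog α σ H Ω) (init : σ) {u : List α} {s : St σ H Ω}
    (h : Exec u p (startSt init u) s) :
    Nonempty (TM2OutputsInTime (computer p init) u (some s.out)
      (timeBound p u.length + 2 * u.length + 2)) := by
  have hv := h.valid (valid_startSt init u)
  have h₁ := steps_boot_startSt (m := (computer p init).m) (boot := none)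
    (start := some (some (compile p).entry)) rfl (P := fun _ => True) (fun _ _ => trivial) init u
  obtain ⟨n₂, hn₂, h₂⟩ := steps_of_exec (m := (computer p init).m)
    (run := fun l => some (some l)) (exit := some none) (fun l => rfl) (P := fun _ => True)
    (fun _ _ _ => trivial) (valid_startSt init u) h
  obtain ⟨n₃, hn₃, h₃⟩ := steps_clean (m := (computer p init).m) (init := init)
    (clean := some none) rfl u.length (s.var, none) (stkOf u s)
    (fun h => by simp [stkOf]) (fun h => by simp [stkOf])
  have h₄ := Steps.iterate_eq (f := (computer p init).step) (P := fun _ => True)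
    ((h₁.trans h₂).trans h₃)
  have hle : u.length + 1 + n₂ + n₃ ≤ timeBound p u.length + 2 * u.length + 2 := by omega
  refine ⟨⟨⟨u.length + 1 + n₂ + n₃, ?_⟩, hle⟩⟩
  rw [initList_computer]
  change _ = some (haltList (computer p init) s.out)
  refine Eq.trans ?_ (congrArg some (haltList_computer p init s.out).symm)
  refine Eq.trans h₄ (congrArg some ?_)
  refine congrArg (TM2.Cfg.mk none (init, none)) ?_
  funext k
  cases k <;> rfl

/-- A function that is computed by a program is computable in polynomial time. -/
theorem polyTime_of_exec {A B : Type} {ea : A → List α} {eb : B → List Ω} {f : A → B}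
    (p : Prog α σ H Ω) (init : σ)
    (h : ∀ a, ∃ s, Exec (ea a) p (startSt init (ea a)) s ∧ s.out = eb (f a)) :
    Nonempty (TM2ComputableInPolyTime ea eb f) := by
  refine ⟨{ tm := computer p init, inputAlphabet := Equiv.refl α, outputAlphabet := Equiv.refl Ω,
            time := timePoly p + 2 * Polynomial.X + 2, outputsFun := fun a => ?_ }⟩
  have this := (computer_outputs p init (h a).choose_spec.1).some
  simp only [(h a).choose_spec.2] at this
  have e₁ : List.map (Equiv.refl α).invFun (ea a) = ea a := List.map_id _
  have e₂ : List.map (Equiv.refl Ω).invFun (eb (f a)) = eb (f a) := List.map_id _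
  have e₃ : (timePoly p + 2 * Polynomial.X + 2).eval (ea a).length =
      timeBound p (ea a).length + 2 * (ea a).length + 2 := by
    simp [eval_timePoly]
  rw [e₃]
  exact (e₁.symm ▸ e₂.symm ▸ this)

/-- The labels of the oracle machine. -/
inductive OracleLabel (Λ : Type)
  | boot
  | run (l : Λ)
  | exit
  | ask
  | yes
  | no

noncomputable instance {Λ : Type} [Fintype Λ] : Fintype (OracleLabel Λ) :=
  Fintype.ofInjective
    (fun k : OracleLabel Λ => (match k with
      | .boot => .inl 0
      | .exit => .inl 1
      | .ask => .inl 2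
      | .yes => .inl 3
      | .no => .inl 4
      | .run l => .inr l : Fin 5 ⊕ Λ))
    (by rintro (_ | _ | _ | h | h) (_ | _ | _ | h' | h') <;> simp)

/-- The statement at the end of a round of the oracle machine. -/
def exitStmt {Λ : Type} (halts result : σ → Bool) :
    TM2.Stmt (Alph (H := H) α Ω) (OracleLabel Λ) (σ × Option α) :=
  .branch (fun v => halts v.1) (.push .res (fun v => result v.1) .halt) (.goto fun _ => .ask)

/-- The oracle machine that executes the program `p` again and again, with its output as a query
in between, until the memory satisfies `halts`. -/
noncomputable def oracleComputer (p : Prog α σ H Ω) (init : σ) (halts result : σ → Bool)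
    (note : σ → Bool → σ) : OracleTM α Ω where
  tm := {
    K := Stk H
    k₀ := .inp
    k₁ := .res
    Γ := Alph α Ω
    Λ := OracleLabel (compile p).Λ
    ΛFin := letI := (compile p).fin; inferInstance
    main := .boot
    σ := σ × Option α
    initialState := (init, none)
    Γk₀Fin := inferInstanceAs (Fintype α)
    m := fun l => match l with
      | .boot => bootStmt .boot (.run (compile p).entry)
      | .run l => nodeStmt .run .exit ((compile p).code l)
      | .exit => exitStmt halts result
      | .ask => .halt
      | .yes => .load (fun v => (note v.1 true, v.2)) (.goto fun _ => .run (compile p).entry)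
      | .no => .load (fun v => (note v.1 false, v.2)) (.goto fun _ => .run (compile p).entry) }
  inputAlphabet := Equiv.refl α
  outputAlphabet := Equiv.refl Bool
  query := .out
  queryAlphabet := Equiv.refl Ω
  ask := .ask
  yes := .yes
  no := .no

open Classical in
/-- `Rounds u p halts note A s q s'`: if the program `p` is executed again and again, beginning in
`s`, and its outputs are submitted to the oracle `A`, then after `q` queries a state `s'` is
reached that satisfies `halts`. -/
inductive Rounds (u : List α) (p : Prog α σ H Ω) (halts : σ → Bool) (note : σ → Bool → σ)
    (A : Language Ω) : St σ H Ω → ℕ → St σ H Ω → Prop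
  | done {s s' : St σ H Ω} : Exec u p s s' → halts s'.var = true →
      Rounds u p halts note A s 0 s'
  | ask {s s' s'' : St σ H Ω} {q : ℕ} : Exec u p s s' → halts s'.var = false →
      Rounds u p halts note A ⟨note s'.var (decide (s'.out ∈ A)), s'.pos, []⟩ q s'' →
      Rounds u p halts note A s (q + 1) s''

theorem runs_of_steps {α Δ : Type} {M : OracleTM α Δ} {A : Language Δ} {n t q : ℕ}
    {c d e : M.tm.Cfg} (h : Steps M.tm.step (fun c => c.l ≠ some M.ask) n c d)
    (h' : M.Runs A d t q e) : M.Runs A c (n + t) q e := by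
  induction h with
  | refl => simpa using h'
  | head hP hf _ ih => rw [Nat.add_right_comm]; exact .step hP hf (ih h')

/-- Only the output stack is emptied by a query; heads and memory carry over to the next round.
Besides the program, a round with a query costs three steps: one at `exit`, the query, and one to
note the answer. Nothing is cleaned up at the end, since `DecidesInTime` inspects only the result
stack. -/
theorem runs_of_rounds {u : List α} {p : Prog α σ H Ω} {init : σ} {halts result : σ → Bool}
    {note : σ → Bool → σ} {A : Language Ω} {s s' : St σ H Ω} {q : ℕ} (hs : Valid u s)
    (h : Rounds u p halts note A s q s') :
    ∃ t ≤ (q + 1) * (timeBound p u.length + 3), ∃ d,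
      (oracleComputer p init halts result note).Runs A
        (cfgOf u (.run (compile p).entry) s) t q d ∧ d.l = none ∧
        d.stk .res = [result s'.var] := by
  classical
  induction h with
  | @done s s' he hh =>
    obtain ⟨n, hn, hst⟩ := steps_of_exec (m := (oracleComputer p init halts result note).tm.m)
      (run := .run) (exit := .exit) (fun l => rfl)
      (P := fun c => c.l ≠ some (oracleComputer p init halts result note).ask)
      (fun l c hc => by rw [hc]; exact fun h => nomatch h) hs he
    refine ⟨n + 1, by omega, _, runs_of_steps (M := oracleComputer p init halts result note) hst
      (.step (fun h => nomatch h) rfl (.refl _)), ?_⟩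
    change (TM2.stepAux (exitStmt (Λ := (compile p).Λ) halts result) (s'.var, none)
        (stkOf u s')).l = none ∧
      (TM2.stepAux (exitStmt (Λ := (compile p).Λ) halts result) (s'.var, none)
        (stkOf u s')).stk .res = _
    simp only [exitStmt, TM2.stepAux, hh, cond_true, Function.update_self]
    exact ⟨trivial, rfl⟩
  | @ask s s' s'' q he hh _ ih =>
    obtain ⟨n, hn, hst⟩ := steps_of_exec (m := (oracleComputer p init halts result note).tm.m)
      (run := .run) (exit := .exit) (fun l => rfl)
      (P := fun c => c.l ≠ some (oracleComputer p init halts result note).ask)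
      (fun l c hc => by rw [hc]; exact fun h => nomatch h) hs he
    have hs' := he.valid hs
    obtain ⟨t, ht, d, hr, hd⟩ := ih hs'
    have ha : (oracleComputer p init halts result note).answer A
          (cfgOf u OracleLabel.ask s' : TM2.Cfg _ (OracleLabel (compile p).Λ) _) =
          ⟨some (if s'.out ∈ A then OracleLabel.yes else .no), (s'.var, none),
            stkOf u ⟨s'.var, s'.pos, []⟩⟩ := by
      have : List.map (Equiv.refl Ω) (stkOf u s' .out) = s'.out := List.map_id _
      rw [← this]
      refine congrArg (TM2.Cfg.mk _ (s'.var, none)) ?_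
      funext k
      cases k <;> rfl
    refine ⟨n + (t + 1 + 1 + 1), by linarith, d,
      runs_of_steps (M := oracleComputer p init halts result note) hst
      (.step (M := oracleComputer p init halts result note) (c' := cfgOf u OracleLabel.ask s')
        (fun h => nomatch h) ?_ (.query rfl (.step ?_ ?_ hr))), hd⟩
    · change some (TM2.stepAux (exitStmt (Λ := (compile p).Λ) halts result) (s'.var, none)
        (stkOf u s')) = _
      simp only [exitStmt, TM2.stepAux, hh, cond_false]
      rfl
    · intro h
      have h' := (congrArg TM2.Cfg.l ha).symm.trans h
      revert h'
      change some (if s'.out ∈ A then OracleLabel.yes else .no) ≠ some OracleLabel.ask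
      split_ifs <;> exact fun h => nomatch h
    · refine (congrArg (oracleComputer p init halts result note).tm.step ha).trans ?_
      by_cases h : s'.out ∈ A
      · simp only [h, decide_true]
        rfl
      · simp only [h, decide_false]
        rfl

open Classical in
/-- A language that is decided by iterating a program with logarithmically many queries to an NP
language is in `Θ₂ᵖ`. -/
theorem inThetaTwoP_of_rounds {L : Language α} {A : Language Ω} (hA : InNP A)
    (p : Prog α σ H Ω) (init : σ) (halts result : σ → Bool) (note : σ → Bool → σ) (c : ℕ)
    (h : ∀ u, ∃ q s, Rounds u p halts note A (startSt init u) q s ∧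
      result s.var = decide (u ∈ L) ∧ q ≤ c * (Nat.log 2 u.length + 1)) :
    InThetaTwoP L := by
  refine ⟨Ω, A, oracleComputer p init halts result note,
    Polynomial.X + 1 + (Polynomial.C c * (Polynomial.X + 1) + 1) * (timePoly p + 3), c, hA,
    fun u => ?_⟩
  obtain ⟨q, s, hr, hres, hq⟩ := h u
  obtain ⟨t, ht, d, hruns, hd, hd'⟩ := runs_of_rounds (init := init) (result := result)
    (valid_startSt init u) hr
  have h₁ := steps_boot_startSt (m := (oracleComputer p init halts result note).tm.m)
    (boot := .boot) (start := .run (compile p).entry) rfl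
    (P := fun c => c.l ≠ some (oracleComputer p init halts result note).ask)
    (fun c hc => by rw [hc]; exact fun h => nomatch h) init u
  have h₂ := runs_of_steps (M := oracleComputer p init halts result note) h₁ hruns
  refine ⟨u.length + 1 + t, q, d, ?_, hd, hres ▸ hd', ?_, hq⟩
  · have e : List.map (oracleComputer p init halts result note).inputAlphabet.symm u = u :=
      List.map_id _
    rw [e]
    refine (congrArg (fun c => (oracleComputer p init halts result note).Runs A c _ q d) ?_).mpr h₂
    refine congrArg (TM2.Cfg.mk (some OracleLabel.boot) (init, none)) ?_
    funext k
    cases k <;> rfl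
  -- The time bound has to be a polynomial, so the logarithmic number of rounds is estimated by a
  -- linear one.
  · have hlog : Nat.log 2 u.length ≤ u.length := Nat.log_le_self _ _
    have hq' : q ≤ c * (u.length + 1) := hq.trans (Nat.mul_le_mul_left _ (by omega))
    have : (q + 1) * (timeBound p u.length + 3) ≤
        (c * (u.length + 1) + 1) * (timeBound p u.length + 3) :=
      Nat.mul_le_mul_right _ (by omega)
    simp only [Polynomial.eval_add, Polynomial.eval_mul, Polynomial.eval_X, Polynomial.eval_one,
      Polynomial.eval_C, eval_timePoly, Polynomial.eval_ofNat]
    omega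

end HeadMachine

/-! ### Basic programs: tests, loops, copying of heads -/

namespace HeadMachine

/-- The memory of the programs below: the result of the last test, an auxiliary bit that controls
loops, and the phase of the computation. -/
structure Flags where
  res : Bool
  aux : Bool
  phase : Fin 4

noncomputable instance : Fintype Flags :=
  Fintype.ofInjective (fun f : Flags => (f.res, f.aux, f.phase)) (by
    rintro ⟨a, b, c⟩ ⟨a', b', c'⟩ h
    simpa using h)

variable {α H Ω : Type}

/-- The part of a state that matters apart from the auxiliary bit and the phase. -/
structure Core (H Ω : Type) where
  pos : H → ℕ
  res : Bool
  out : List Ω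

/-- The state with the given components. -/
def Core.st (c : Core H Ω) (a : Bool) (ph : Fin 4) : St Flags H Ω := ⟨⟨c.res, a, ph⟩, c.pos, c.out⟩

/-- Skip. -/
def skip : Prog α Flags H Ω := .op (.load id)

/-- Set the result bit. -/
def setRes (b : Bool) : Prog α Flags H Ω := .op (.load fun f => { f with res := b })

/-- Invert the result bit. -/
def notRes : Prog α Flags H Ω := .op (.load fun f => { f with res := !f.res })

/-- Branch on whether a head is at the start. -/
def ifStart (h : H) (p q : Prog α Flags H Ω) : Prog α Flags H Ω :=
  .seq (.op (.atStart h fun f b => { f with aux := b })) (.ite Flags.aux p q)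

/-- Repeat until a head is at the start. -/
def untilStart (h : H) (p : Prog α Flags H Ω) : Prog α Flags H Ω :=
  .seq (.op (.atStart h fun f b => { f with aux := b }))
    (.loop (fun f => !f.aux) (.seq p (.op (.atStart h fun f b => { f with aux := b }))))

/-- Repeat until a head is at the end. -/
def untilEnd (h : H) (p : Prog α Flags H Ω) : Prog α Flags H Ω :=
  .seq (.op (.read h fun f o => { f with aux := o.isNone }))
    (.loop (fun f => !f.aux) (.seq p (.op (.read h fun f o => { f with aux := o.isNone }))))

/-- Repeat `p` until the test `t` has a positive result. -/
def untilRes (t p : Prog α Flags H Ω) : Prog α Flags H Ω :=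
  .seq t (.loop (fun f => !f.res) (.seq p t))

variable [DecidableEq H] {u : List α}

/-- The program gets from one core to another, whatever the auxiliary bit, in the same phase. -/
def Runs (u : List α) (p : Prog α Flags H Ω) (c c' : Core H Ω) : Prop :=
  ∀ a ph, ∃ a', Exec u p (c.st a ph) (c'.st a' ph)

theorem Runs.le {p : Prog α Flags H Ω} {c c' : Core H Ω} (h : Runs u p c c')
    (hc : ∀ h, c.pos h ≤ u.length) (h : H) : c'.pos h ≤ u.length := by
  obtain ⟨a, ha⟩ := ‹Runs u p c c'› true 0
  exact ha.valid hc h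

theorem Runs.seq {p q : Prog α Flags H Ω} {c c' c'' : Core H Ω} (h₁ : Runs u p c c')
    (h₂ : Runs u q c' c'') : Runs u (.seq p q) c c'' := by
  intro a ph
  obtain ⟨a', h₁⟩ := h₁ a ph
  obtain ⟨a'', h₂⟩ := h₂ a' ph
  exact ⟨a'', .seq h₁ h₂⟩

theorem runs_skip (c : Core H Ω) : Runs u skip c c := fun a _ => ⟨a, .op _ _⟩

theorem runs_setRes (b : Bool) (P : H → ℕ) (r : Bool) (o : List Ω) :
    Runs u (setRes b) ⟨P, r, o⟩ ⟨P, b, o⟩ := fun a _ => ⟨a, .op _ _⟩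

theorem runs_notRes (P : H → ℕ) (r : Bool) (o : List Ω) :
    Runs u notRes ⟨P, r, o⟩ ⟨P, !r, o⟩ := fun a _ => ⟨a, .op _ _⟩

theorem runs_left (h : H) (P : H → ℕ) (r : Bool) (o : List Ω) :
    Runs u (.op (.left h)) ⟨P, r, o⟩ ⟨Function.update P h (P h - 1), r, o⟩ :=
  fun a _ => ⟨a, .op _ _⟩

theorem runs_right (h : H) (P : H → ℕ) (r : Bool) (o : List Ω) :
    Runs u (.op (.right h)) ⟨P, r, o⟩
      ⟨Function.update P h (min (P h + 1) u.length), r, o⟩ :=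
  fun a _ => ⟨a, .op _ _⟩

theorem runs_iteRes {p q : Prog α Flags H Ω} {c c' : Core H Ω}
    (h₁ : c.res = true → Runs u p c c') (h₂ : c.res = false → Runs u q c c') :
    Runs u (.ite Flags.res p q) c c' := by
  intro a ph
  cases hr : c.res with
  | true =>
    obtain ⟨a', h⟩ := h₁ hr a ph
    exact ⟨a', .iteTrue hr h⟩
  | false =>
    obtain ⟨a', h⟩ := h₂ hr a ph
    exact ⟨a', .iteFalse hr h⟩

theorem runs_ifStart {h : H} {p q : Prog α Flags H Ω} {c c' : Core H Ω}
    (h₁ : c.pos h = 0 → Runs u p c c') (h₂ : c.pos h ≠ 0 → Runs u q c c') :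
    Runs u (ifStart h p q) c c' := by
  intro a ph
  by_cases h0 : c.pos h = 0
  · obtain ⟨a', h'⟩ := h₁ h0 true ph
    refine ⟨a', .seq (.op _ _) (.iteTrue ?_ ?_)⟩
    · simp [Op.apply, Core.st, h0]
    · simpa [Op.apply, Core.st, h0] using h'
  · obtain ⟨a', h'⟩ := h₂ h0 false ph
    have h0' : (c.pos h == 0) = false := by simpa using h0
    refine ⟨a', .seq (.op _ _) (.iteFalse ?_ ?_)⟩
    · simp [Op.apply, Core.st, h0]
    · simpa [Op.apply, Core.st, h0'] using h'

theorem runs_untilStart_zero {h : H} {p : Prog α Flags H Ω} {c : Core H Ω} (h0 : c.pos h = 0) :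
    Runs u (untilStart h p) c c := by
  intro a ph
  refine ⟨true, .seq (s' := c.st true ph) ?_ (.loopEnd rfl)⟩
  convert Exec.op (u := u) (.atStart h fun f b => { f with aux := b }) (c.st a ph) using 1
  simp [Op.apply, Core.st, h0]

theorem runs_untilStart_step {h : H} {p : Prog α Flags H Ω} {c c' c'' : Core H Ω}
    (h0 : c.pos h ≠ 0) (h₁ : Runs u p c c') (h₂ : Runs u (untilStart h p) c' c'') :
    Runs u (untilStart h p) c c'' := by
  intro a ph
  obtain ⟨a', h₁⟩ := h₁ false ph
  obtain ⟨a'', h₂⟩ := h₂ a' ph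
  have h0' : (c.pos h == 0) = false := by simpa using h0
  -- The test that opens the remaining run becomes the test at the end of the first iteration. It
  -- overwrites the auxiliary bit, so the body may leave any value there.
  cases h₂ with
  | seq h₂ h₃ =>
    refine ⟨a'', .seq (s' := c.st false ph) ?_ (.loopStep rfl (.seq h₁ h₂) h₃)⟩
    convert Exec.op (u := u) (.atStart h fun f b => { f with aux := b }) (c.st a ph) using 1
    simp [Op.apply, Core.st, h0']

theorem runs_untilEnd_end {h : H} {p : Prog α Flags H Ω} {c : Core H Ω}
    (h0 : u.length ≤ c.pos h) : Runs u (untilEnd h p) c c := by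
  intro a ph
  refine ⟨true, .seq (s' := c.st true ph) ?_ (.loopEnd rfl)⟩
  convert Exec.op (u := u) (.read h fun f o => { f with aux := o.isNone }) (c.st a ph) using 1
  simp [Op.apply, Core.st, h0]

theorem runs_untilEnd_step {h : H} {p : Prog α Flags H Ω} {c c' c'' : Core H Ω}
    (h0 : c.pos h < u.length) (h₁ : Runs u p c c') (h₂ : Runs u (untilEnd h p) c' c'') :
    Runs u (untilEnd h p) c c'' := by
  intro a ph
  obtain ⟨a', h₁⟩ := h₁ false ph
  obtain ⟨a'', h₂⟩ := h₂ a' ph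
  cases h₂ with
  | seq h₂ h₃ =>
    refine ⟨a'', .seq (s' := c.st false ph) ?_ (.loopStep rfl (.seq h₁ h₂) h₃)⟩
    convert Exec.op (u := u) (.read h fun f o => { f with aux := o.isNone }) (c.st a ph) using 1
    simp [Op.apply, Core.st, h0]

theorem runs_untilRes_true {t p : Prog α Flags H Ω} {c c' : Core H Ω} (h : Runs u t c c')
    (hr : c'.res = true) : Runs u (untilRes t p) c c' := by
  intro a ph
  obtain ⟨a', h⟩ := h a ph
  exact ⟨a', .seq h (.loopEnd (by simp [Core.st, hr]))⟩

theorem runs_untilRes_false {t p : Prog α Flags H Ω} {c c₁ c₂ c' : Core H Ω}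
    (h : Runs u t c c₁) (hr : c₁.res = false) (h₁ : Runs u p c₁ c₂)
    (h₂ : Runs u (untilRes t p) c₂ c') : Runs u (untilRes t p) c c' := by
  intro a ph
  obtain ⟨a', h⟩ := h a ph
  obtain ⟨a₁, h₁⟩ := h₁ a' ph
  obtain ⟨a₂, h₂⟩ := h₂ a₁ ph
  cases h₂ with
  | seq h₂ h₃ => exact ⟨a₂, .seq h (.loopStep (by simp [Core.st, hr]) (.seq h₁ h₂) h₃)⟩

/-- Move a head to the start. -/
def rewind (h : H) : Prog α Flags H Ω := untilStart h (.op (.left h))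

theorem runs_rewind (h : H) (P : H → ℕ) (r : Bool) (o : List Ω) :
    Runs u (rewind h) ⟨P, r, o⟩ ⟨Function.update P h 0, r, o⟩ := by
  induction hn : P h generalizing P with
  | zero =>
    rw [← hn, Function.update_eq_self]
    exact runs_untilStart_zero hn
  | succ n ih =>
    refine runs_untilStart_step (by simp [hn]) (runs_left h P r o) ?_
    have := ih (Function.update P h (P h - 1)) (by simp [hn])
    simp only [Function.update_idem] at this
    exact this

/-- Add the position of `y` to the positions of `x` and `t`, moving `y` to the start. -/
def drain (y x t : H) : Prog α Flags H Ω :=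
  untilStart y (.seq (.op (.left y)) (.seq (.op (.right x)) (.op (.right t))))

theorem runs_drain {x y t : H} (hyx : y ≠ x) (hyt : y ≠ t) (hxt : x ≠ t) (P : H → ℕ) (r : Bool)
    (o : List Ω) (hx : P x + P y ≤ u.length) (ht : P t + P y ≤ u.length) :
    Runs u (drain y x t) ⟨P, r, o⟩
      ⟨Function.update (Function.update (Function.update P x (P x + P y)) t (P t + P y)) y 0,
        r, o⟩ := by
  induction hn : P y generalizing P with
  | zero =>
    have : Function.update (Function.update (Function.update P x (P x + 0)) t (P t + 0)) y 0
        = P := by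
      funext h
      simp only [Function.update_apply, add_zero]
      split_ifs <;> simp_all
    rw [this]
    exact runs_untilStart_zero hn
  | succ n ih =>
    refine runs_untilStart_step (by simp [hn]) ((runs_left _ _ _ _).seq
      ((runs_right _ _ _ _).seq (runs_right _ _ _ _))) ?_
    change Runs u (drain y x t) _ _
    convert ih _ ?_ ?_ ?_ using 2
    · funext h
      simp only [Function.update_apply, hxt, hyx.symm, hyt.symm, hxt.symm, if_true,
        if_false]
      split_ifs <;> omega
    all_goals
      simp only [Function.update_apply, hyx, hyt, hxt, hyx.symm, hyt.symm, hxt.symm, if_true,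
        if_false]
      omega

/-- Move `x` to the position of `y`, using the head `t`, which is left at the start. -/
def copy (y x t : H) : Prog α Flags H Ω :=
  .seq (rewind x) (.seq (rewind t) (.seq (drain y x t)
    (untilStart t (.seq (.op (.left t)) (.op (.right y))))))

theorem runs_restore {y t : H} (hyt : y ≠ t) (P : H → ℕ) (r : Bool)
    (o : List Ω) (hy : P y + P t ≤ u.length) :
    Runs u (untilStart t (.seq (.op (.left t)) (.op (.right y)))) ⟨P, r, o⟩
      ⟨Function.update (Function.update P y (P y + P t)) t 0, r, o⟩ := by
  induction hn : P t generalizing P with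
  | zero =>
    have : Function.update (Function.update P y (P y + 0)) t 0 = P := by
      funext h
      simp only [Function.update_apply, add_zero]
      split_ifs <;> simp_all
    rw [this]
    exact runs_untilStart_zero hn
  | succ n ih =>
    refine runs_untilStart_step (by simp [hn]) ((runs_left _ _ _ _).seq (runs_right _ _ _ _)) ?_
    convert ih _ ?_ ?_ using 2
    · funext h
      simp only [Function.update_apply, hyt, if_true, if_false]
      split_ifs <;> omega
    all_goals
      simp only [Function.update_apply, hyt, hyt.symm, if_true, if_false]
      omega

/-- No operation compares or assigns head positions. So `y` is counted down to the start while `x`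
and `t` are counted up, and afterwards `t` is counted down to restore `y`. -/
theorem runs_copy {x y t : H} (hyx : y ≠ x) (hyt : y ≠ t) (hxt : x ≠ t) (P : H → ℕ) (r : Bool)
    (o : List Ω) (hy : P y ≤ u.length) :
    Runs u (copy y x t) ⟨P, r, o⟩
      ⟨Function.update (Function.update P x (P y)) t 0, r, o⟩ := by
  refine (runs_rewind _ _ _ _).seq ((runs_rewind _ _ _ _).seq
    ((runs_drain hyx hyt hxt _ _ _ ?_ ?_).seq ?_))
  · simpa [Function.update_apply, hyx, hyt, hxt, hyx.symm, hyt.symm, hxt.symm] using hy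
  · simpa [Function.update_apply, hyx, hyt, hxt, hyx.symm, hyt.symm, hxt.symm] using hy
  · convert runs_restore hyt _ _ _ ?_ using 2
    · funext h
      simp only [Function.update_apply, hyx, hyt, hxt, hyt.symm, hxt.symm, if_true, if_false]
      split_ifs <;> simp_all
    · simpa [Function.update_apply, hyx, hyt, hxt, hyx.symm, hyt.symm, hxt.symm] using hy

end HeadMachine

/-! ### First-order formulas with arithmetic and their evaluation -/

namespace HeadMachine

variable {α V Ω : Type}

theorem isSome_getElem?_eq (l : List α) (i : ℕ) : l[i]?.isSome = decide (i < l.length) := by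
  by_cases h : i < l.length <;> simp [h]

theorem exec_op_of_eq {σ H : Type} [DecidableEq H] {u : List α} {o : Op α σ H Ω}
    {s s' : St σ H Ω} (h : s' = o.apply u s) : Exec u (.op o) s s' := h ▸ .op o s

/-- Terms of formulas: variables, which stand for positions in a word, and constants. -/
inductive Term (V : Type)
  | var (v : V)
  | const (c : ℕ)

/-- The value of a term. -/
def Term.val (e : V → ℕ) : Term V → ℕ
  | var v => e v
  | const c => c

/-- First-order formulas with arithmetic about a word over `α`. -/
inductive Formula (α V : Type)
  | letter (v : V) (c : α → Bool)
  | arith (t₁ t₂ t₃ : Term V) (v : V)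
  | not (φ : Formula α V)
  | and (φ ψ : Formula α V)
  | ex (v : V) (φ : Formula α V)

namespace Formula

variable [DecidableEq V]

/-- Truth of a formula in the word `u`; quantifiers range over the positions in `u`, and
`arith t₁ t₂ t₃ v` says that `t₁ * t₂ + t₃ = v`. -/
def Holds (u : List α) : Formula α V → (V → ℕ) → Prop
  | letter v c, e => ∃ a, u[e v]? = some a ∧ c a = true
  | arith t₁ t₂ t₃ v, e => t₁.val e * t₂.val e + t₃.val e = e v
  | not φ, e => ¬ φ.Holds u e
  | and φ ψ, e => φ.Holds u e ∧ ψ.Holds u e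
  | ex v φ, e => ∃ i < u.length, φ.Holds u (Function.update e v i)

/-- The variables of a term. -/
def _root_.HeadMachine.Term.vars : Term V → Finset V
  | .var v => {v}
  | .const _ => ∅

/-- The free variables of a formula. -/
def free : Formula α V → Finset V
  | letter v _ => {v}
  | arith t₁ t₂ t₃ v => t₁.vars ∪ t₂.vars ∪ t₃.vars ∪ {v}
  | not φ => φ.free
  | and φ ψ => φ.free ∪ ψ.free
  | ex v φ => φ.free.erase v

/-- The bound variables of a formula. -/
def bound : Formula α V → Finset V
  | letter _ _ => ∅
  | arith _ _ _ _ => ∅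
  | not φ => φ.bound
  | and φ ψ => φ.bound ∪ ψ.bound
  | ex v φ => insert v φ.bound

/-- No bound variable is reused in a way that would spoil the evaluation. -/
def Tidy : Formula α V → Prop
  | letter _ _ => True
  | arith _ _ _ _ => True
  | not φ => φ.Tidy
  | and φ ψ => φ.Tidy ∧ ψ.Tidy ∧ Disjoint φ.bound ψ.free
  | ex v φ => φ.Tidy ∧ v ∉ φ.bound ∧ Disjoint φ.bound φ.free

instance decidableTidy : (φ : Formula α V) → Decidable φ.Tidy
  | letter _ _ => inferInstanceAs (Decidable True)
  | arith _ _ _ _ => inferInstanceAs (Decidable True)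
  | not φ => decidableTidy φ
  | and φ ψ =>
    letI := decidableTidy φ
    letI := decidableTidy ψ
    inferInstanceAs (Decidable (_ ∧ _ ∧ _))
  | ex _ φ =>
    letI := decidableTidy φ
    inferInstanceAs (Decidable (_ ∧ _ ∧ _))

omit [DecidableEq V] in
theorem _root_.HeadMachine.Term.val_congr {t : Term V} {e e' : V → ℕ}
    (h : ∀ v ∈ t.vars, e v = e' v) : t.val e = t.val e' := by
  cases t with
  | var v => exact h v (by simp [Term.vars])
  | const c => rfl

theorem holds_congr (u : List α) {φ : Formula α V} {e e' : V → ℕ}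
    (h : ∀ v ∈ φ.free, e v = e' v) : φ.Holds u e ↔ φ.Holds u e' := by
  induction φ generalizing e e' with
  | letter v c => simp only [Holds, h v (by simp [free])]
  | arith t₁ t₂ t₃ v =>
    simp only [free, Finset.mem_union, Finset.mem_singleton] at h
    simp only [Holds, h v (by simp), Term.val_congr (fun w hw => h w (.inl (.inl (.inl hw)))),
      Term.val_congr (fun w hw => h w (.inl (.inl (.inr hw)))),
      Term.val_congr (fun w hw => h w (.inl (.inr hw)))]
  | not φ ih => exact not_congr (ih h)
  | and φ ψ ih₁ ih₂ =>
    exact and_congr (ih₁ fun v hv => h v (Finset.mem_union_left _ hv))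
      (ih₂ fun v hv => h v (Finset.mem_union_right _ hv))
  | ex v φ ih =>
    refine exists_congr fun i => and_congr_right fun _ => ih fun w hw => ?_
    by_cases e : w = v
    · subst e; simp
    · simpa [e] using h w (Finset.mem_erase.2 ⟨e, hw⟩)

/-! #### Evaluation of formulas by programs

The heads are the variables and four auxiliary ones. -/

/-- Count down the auxiliary head `0`, with negative result if this is not possible. -/
def dec : Prog α Flags (V ⊕ Fin 4) Ω := ifStart (.inr 0) (setRes false) (.op (.left (.inr 0)))

/-- Repeat a program a constant number of times. -/
def rep (p : Prog α Flags (V ⊕ Fin 4) Ω) : ℕ → Prog α Flags (V ⊕ Fin 4) Ω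
  | 0 => skip
  | n + 1 => .seq p (rep p n)

/-- Repeat a program as many times as a term says. -/
def times (i : Fin 4) (p : Prog α Flags (V ⊕ Fin 4) Ω) : Term V → Prog α Flags (V ⊕ Fin 4) Ω
  | .const c => rep p c
  | .var v => .seq (copy (.inl v) (.inr i) (.inr 1))
      (untilStart (.inr i) (.seq (.op (.left (.inr i))) p))

/-- The program that evaluates a formula. -/
def prog : Formula α V → Prog α Flags (V ⊕ Fin 4) Ω
  | letter v c => .op (.read (.inl v) fun f a => { f with res := a.any c })
  | arith t₁ t₂ t₃ v => .seq (copy (.inl v) (.inr 0) (.inr 1)) (.seq (setRes true)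
      (.seq (times 2 dec t₃) (.seq (times 3 (times 2 dec t₂) t₁)
        (ifStart (.inr 0) skip (setRes false)))))
  | not φ => .seq φ.prog notRes
  | and φ ψ => .seq φ.prog (.ite Flags.res ψ.prog skip)
  | ex v φ => .seq (rewind (.inl v)) (.seq (setRes false)
      (.seq (.op (.read (.inl v) fun f a => { f with aux := a.isSome }))
        (.loop (fun f => f.aux && !f.res) (.seq φ.prog (.seq (.op (.right (.inl v)))
          (.op (.read (.inl v) fun f a => { f with aux := a.isSome })))))))

/-- The program counts down the auxiliary head `0` by `b`, moving otherwise only heads in `S`,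
if the heads of the variables are as in `e`. -/
def Drains (u : List α) (e : V → ℕ) (S : Set (Fin 4)) (p : Prog α Flags (V ⊕ Fin 4) Ω)
    (b : ℕ) : Prop :=
  ∀ P r o, (∀ v, P (.inl v) = e v) → ∃ P',
    Runs u p ⟨P, r, o⟩ ⟨P', r && decide (b ≤ P (.inr 0)), o⟩ ∧
    P' (.inr 0) = P (.inr 0) - b ∧ (∀ v, P' (.inl v) = e v) ∧
    ∀ i, i ≠ 0 → i ∉ S → P' (.inr i) = P (.inr i)

variable {u : List α} {e : V → ℕ} {S : Set (Fin 4)} {p q : Prog α Flags (V ⊕ Fin 4) Ω}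

theorem drains_dec : Drains u e S (dec : Prog α Flags (V ⊕ Fin 4) Ω) 1 := by
  intro P r o hP
  refine ⟨Function.update P (.inr 0) (P (.inr 0) - 1), runs_ifStart (fun h => ?_) (fun h => ?_),
    by simp, by simpa using hP, fun i hi _ => by simp [hi]⟩
  · have : Function.update P (.inr 0) (P (.inr 0) - 1) = P := by
      conv_rhs => rw [← Function.update_eq_self (.inr 0) P]
      simp only at h
      rw [h]
    rw [this]
    simp only at h
    simpa [h] using runs_setRes false P r o
  · simp only at h
    have : 1 ≤ P (.inr 0) := Nat.one_le_iff_ne_zero.2 h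
    simpa [this] using runs_left (.inr 0) P r o

/-- Both countdowns succeed if `a ≤ m` and `b ≤ m - a`, that is, `a + b ≤ m`; truncated subtraction
composes in the same way. -/
theorem Drains.seq {a b : ℕ} (h₁ : Drains u e S p a) (h₂ : Drains u e S q b) :
    Drains u e S (.seq p q) (a + b) := by
  intro P r o hP
  obtain ⟨P', hr', h0', hv', hi'⟩ := h₁ P r o hP
  obtain ⟨P'', hr'', h0'', hv'', hi''⟩ := h₂ P' _ o hv'
  refine ⟨P'', hr'.seq ?_, by omega, hv'', fun i h hS => (hi'' i h hS).trans (hi' i h hS)⟩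
  convert hr'' using 2
  rw [Bool.and_assoc, h0', ← Bool.decide_and]
  congr 2
  rw [eq_iff_iff]
  omega

theorem Drains.rep {b : ℕ} (h : Drains u e S p b) (n : ℕ) : Drains u e S (rep p n) (n * b) := by
  induction n with
  | zero =>
    intro P r o hP
    refine ⟨P, ?_, by simp, hP, fun _ _ _ => rfl⟩
    simpa [Formula.rep] using runs_skip (u := u) ⟨P, r, o⟩
  | succ n ih =>
    rw [Nat.succ_mul, Nat.add_comm (n * b)]
    exact h.seq ih

/-- The head `i` is the loop counter, so it must not be among the heads that the body moves. -/
theorem Drains.untilStart {b : ℕ} {i : Fin 4} (hi : i ∉ S) (hi0 : i ≠ 0) (h : Drains u e S p b)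
    (P : V ⊕ Fin 4 → ℕ) (r : Bool) (o : List Ω) (hP : ∀ v, P (.inl v) = e v) :
    ∃ P', Runs u (untilStart (.inr i) (.seq (.op (.left (.inr i))) p))
      ⟨P, r, o⟩ ⟨P', r && decide (P (.inr i) * b ≤ P (.inr 0)), o⟩ ∧
    P' (.inr 0) = P (.inr 0) - P (.inr i) * b ∧ (∀ v, P' (.inl v) = e v) ∧
    ∀ j, j ≠ 0 → j ∉ S → j ≠ i → P' (.inr j) = P (.inr j) := by
  induction hn : P (.inr i) generalizing P r with
  | zero =>
    refine ⟨P, ?_, by simp, hP, fun _ _ _ _ => rfl⟩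
    simpa using runs_untilStart_zero (c := ⟨P, r, o⟩) hn
  | succ n ih =>
    obtain ⟨P', hr', h0', hv', hi'⟩ := h (Function.update P (.inr i) (P (.inr i) - 1)) r o
      (by simpa using hP)
    have hin : P' (.inr i) = n := by rw [hi' i hi0 hi]; simp [hn]
    obtain ⟨P'', hr'', h0'', hv'', hi''⟩ := ih P' _ hv' hin
    rw [Function.update_of_ne (by simpa using hi0.symm)] at h0' hr'
    refine ⟨P'', runs_untilStart_step (by simp [hn]) ((runs_left _ _ _ _).seq hr') ?_, ?_, hv'',
      fun j hj hjS hji => ?_⟩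
    · convert hr'' using 2
      rw [Bool.and_assoc, h0', ← Bool.decide_and, Nat.succ_mul]
      congr 2
      rw [eq_iff_iff]
      omega
    · rw [h0'', h0', Nat.succ_mul]
      omega
    · rw [hi'' j hj hjS hji, hi' j hj hjS, Function.update_of_ne (by simpa using hji)]

/-- The counter `i` is loaded from the head of a variable by `copy`, with the head `1` as scratch;
hence both join the set of moved heads. -/
theorem Drains.times {b : ℕ} {i : Fin 4} (hi : i ∉ S) (hi0 : i ≠ 0) (hi1 : i ≠ 1)
    (h : Drains u e S p b) (he : ∀ v, e v ≤ u.length) (t : Term V) :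
    Drains u e (S ∪ {1, i}) (times i p t) (t.val e * b) := by
  cases t with
  | const c =>
    intro P r o hP
    obtain ⟨P', hr', h0', hv', hi'⟩ := h.rep c P r o hP
    exact ⟨P', hr', h0', hv', fun j hj hjS => hi' j hj fun h => hjS (.inl h)⟩
  | var v =>
    intro P r o hP
    obtain ⟨P', hr', h0', hv', hi'⟩ := h.untilStart hi hi0
      (Function.update (Function.update P (.inr i) (P (.inl v))) (.inr 1) 0) r o (by simpa using hP)
    have e₁ : Function.update (Function.update P (.inr i) (P (.inl v))) (.inr 1) 0 (.inr i) =
        P (.inl v) := by simp [hi1]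
    have e₂ : Function.update (Function.update P (.inr i) (P (.inl v))) (.inr 1) 0 (.inr 0) =
        P (.inr 0) := by simp [hi0.symm]
    rw [e₁, e₂] at hr' h0'
    refine ⟨P', ?_, ?_, hv', fun j hj hjS => ?_⟩
    · refine (runs_copy (by simp) (by simp) (by simpa using hi1) P r o
        (by rw [hP]; exact he v)).seq ?_
      convert hr' using 4
      rw [hP]
      rfl
    · rw [h0', hP]; rfl
    · simp only [Set.mem_union, Set.mem_insert_iff, Set.mem_singleton_iff, not_or] at hjS
      rw [hi' j hj hjS.1 hjS.2.2, Function.update_of_ne (by simpa using hjS.2.1),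
        Function.update_of_ne (by simpa using hjS.2.2)]

/-- The product may exceed the length of the word, so it is never formed as a position. Instead a
copy of `v` is counted down, `t₃` times and then `t₁ * t₂` times by nested loops. Equality holds if
no countdown failed and the copy ends at the start. -/
theorem runs_arith (t₁ t₂ t₃ : Term V) (v : V) (P : V ⊕ Fin 4 → ℕ) (r : Bool) (o : List Ω)
    (hP : ∀ h, P h ≤ u.length) : ∃ P' b,
      Runs u (arith t₁ t₂ t₃ v).prog ⟨P, r, o⟩ ⟨P', b, o⟩ ∧
      (b = true ↔ (arith t₁ t₂ t₃ v).Holds u fun v => P (.inl v)) ∧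
      ∀ v, P' (.inl v) = P (.inl v) := by
  have hd : Drains u (fun v => P (.inl v)) ∅ (dec : Prog α Flags (V ⊕ Fin 4) Ω) 1 := drains_dec
  have hd₂ := fun t => hd.times (i := 2) (by simp) (by simp) (by simp) (fun v => hP (.inl v)) t
  have hd₃ := (hd₂ t₂).times (i := 3) (by simp) (by simp) (by simp) (fun v => hP (.inl v)) t₁
  set P₀ := Function.update (Function.update P (.inr 0) (P (.inl v))) (.inr 1) 0 with hP₀
  obtain ⟨P₁, hr₁, h0₁, hv₁, -⟩ := hd₂ t₃ P₀ true o (by simp [hP₀])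
  obtain ⟨P₂, hr₂, h0₂, hv₂, -⟩ := hd₃ P₁ (true && decide
    (t₃.val (fun v => P (.inl v)) * 1 ≤ P₀ (.inr 0))) o hv₁
  have h0 : P₀ (.inr 0) = P (.inl v) := by simp [hP₀]
  have hr := (runs_copy (by simp) (by simp) (by simp) P r o (hP _)).seq
    ((runs_setRes true _ _ _).seq (hr₁.seq hr₂))
  rw [h0, Nat.mul_one] at h0₁
  rw [Nat.mul_one] at h0₂
  by_cases h : P₂ (.inr 0) = 0
  · refine ⟨P₂, _, (runs_copy (by simp) (by simp) (by simp) P r o (hP _)).seq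
      ((runs_setRes true _ _ _).seq (hr₁.seq (hr₂.seq
        (runs_ifStart (fun _ => runs_skip _) (fun h' => absurd h h'))))), ?_, hv₂⟩
    simp only [Bool.true_and, Bool.and_eq_true, decide_eq_true_eq, Holds, Nat.mul_one]
    omega
  · refine ⟨P₂, _, (runs_copy (by simp) (by simp) (by simp) P r o (hP _)).seq
      ((runs_setRes true _ _ _).seq (hr₁.seq (hr₂.seq
        (runs_ifStart (fun h' => absurd h' h) (fun _ => runs_setRes false _ _ _))))), ?_, hv₂⟩
    simp only [Bool.false_eq_true, Holds, false_iff]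
    omega

/-- The program of a tidy formula finds out whether the formula holds. -/
theorem runs_prog {φ : Formula α V} (hφ : φ.Tidy) (P : V ⊕ Fin 4 → ℕ) (r : Bool) (o : List Ω)
    (hP : ∀ h, P h ≤ u.length) : ∃ P' b,
      Runs u φ.prog ⟨P, r, o⟩ ⟨P', b, o⟩ ∧ (b = true ↔ φ.Holds u fun v => P (.inl v)) ∧
      ∀ v ∉ φ.bound, P' (.inl v) = P (.inl v) := by
  induction φ generalizing P r with
  | letter v c =>
    refine ⟨P, u[P (.inl v)]?.any c, fun a ph => ⟨a, .op _ _⟩, ?_, fun _ _ => rfl⟩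
    simp only [Holds]
    cases u[P (.inl v)]? <;> simp
  | arith t₁ t₂ t₃ v =>
    obtain ⟨P', b, h₁, hb, h₂⟩ := runs_arith t₁ t₂ t₃ v P r o hP
    exact ⟨P', b, h₁, hb, fun v _ => h₂ v⟩
  | not φ ih =>
    obtain ⟨P', b, h₁, hb, h₂⟩ := ih hφ P r hP
    refine ⟨P', _, h₁.seq (runs_notRes _ _ _), ?_, h₂⟩
    rw [Holds, ← hb]
    cases b <;> simp
  | and φ ψ ih₁ ih₂ =>
    obtain ⟨hφ, hψ, hd⟩ := hφ
    obtain ⟨P', b, h₁, hb, h₂⟩ := ih₁ hφ P r hP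
    cases b with
    | true =>
      obtain ⟨P'', b', h₃, hb', h₄⟩ := ih₂ hψ P' true (h₁.le hP)
      refine ⟨P'', b', h₁.seq (runs_iteRes (fun _ => h₃) (fun h => nomatch h)), ?_,
        fun v hv => ?_⟩
      · rw [hb', Holds, and_iff_right (hb.1 rfl)]
        -- The evaluation of `φ` moves only heads of its bound variables, and tidiness keeps these
        -- apart from the free variables of `ψ`.
        exact holds_congr u fun v hv => h₂ v fun h => Finset.disjoint_left.1 hd h hv
      · simp only [bound, Finset.mem_union, not_or] at hv
        rw [h₄ v hv.2, h₂ v hv.1]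
    | false =>
      refine ⟨P', false, h₁.seq (runs_iteRes (fun h => nomatch h) (fun _ => runs_skip _)), ?_,
        fun v hv => ?_⟩
      · simp only [Bool.false_eq_true, false_iff] at hb ⊢
        exact fun h => hb h.1
      · simp only [bound, Finset.mem_union, not_or] at hv
        exact h₂ v hv.1
  | ex v φ ih =>
    obtain ⟨hφ, hv, hd⟩ := hφ
    set body : Prog α Flags (V ⊕ Fin 4) Ω := .seq φ.prog (.seq (.op (.right (.inl v)))
      (.op (.read (.inl v) fun f a => { f with aux := a.isSome }))) with hbody
    -- Loop invariant, with `k` positions left to try. The auxiliary bit says whether the head `v`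
    -- is still on a letter, and the loop stops at the first success.
    have key : ∀ k, ∀ Q : V ⊕ Fin 4 → ℕ, (∀ h, Q h ≤ u.length) →
        u.length = Q (.inl v) + k →
        (∀ w ∉ (ex v φ).bound, Q (.inl w) = P (.inl w)) → ∃ P' b,
        (∀ ph, ∃ a', Exec u (.loop (fun f => f.aux && !f.res) body)
          (Core.st ⟨Q, false, o⟩ (decide (Q (.inl v) < u.length)) ph)
          (Core.st ⟨P', b, o⟩ a' ph)) ∧
        (b = true ↔ ∃ i < u.length, Q (.inl v) ≤ i ∧
            φ.Holds u (Function.update (fun w => P (.inl w)) v i)) ∧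
        ∀ w ∉ (ex v φ).bound, P' (.inl w) = P (.inl w) := by
      intro k
      induction k with
      | zero =>
        intro Q hQ hk hQP
        have h2 : ¬ Q (.inl v) < u.length := by omega
        refine ⟨Q, false, fun ph => ⟨false, ?_⟩, ?_, hQP⟩
        · simp only [h2, decide_false]
          exact .loopEnd rfl
        · simp only [Bool.false_eq_true, false_iff]
          rintro ⟨i, hi, hi', -⟩
          omega
      | succ k ihk =>
        intro Q hQ hk hQP
        have h2 : Q (.inl v) < u.length := by omega
        obtain ⟨P₁, b₁, h₁, hb₁, hP₁⟩ := ih hφ Q false hQ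
        have hle := h₁.le hQ
        have hcongr : (φ.Holds u fun w => Q (.inl w)) ↔
            φ.Holds u (Function.update (fun w => P (.inl w)) v (Q (.inl v))) := by
          refine holds_congr u fun w hw => ?_
          by_cases e : w = v
          · subst e; simp
          · rw [Function.update_of_ne e]
            refine hQP w ?_
            simp only [bound, Finset.mem_insert, not_or]
            exact ⟨e, fun h => Finset.disjoint_left.1 hd h hw⟩
        rw [hcongr] at hb₁
        set P₂ := Function.update P₁ (.inl v) (min (P₁ (.inl v) + 1) u.length) with hP₂
        have hv₂ : P₂ (.inl v) = Q (.inl v) + 1 := by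
          rw [hP₂, Function.update_self, hP₁ v hv]
          exact Nat.min_eq_left h2
        have hle₂ : ∀ h, P₂ h ≤ u.length := (runs_right _ P₁ false o).le hle
        have hQP₂ : ∀ w ∉ (ex v φ).bound, P₂ (.inl w) = P (.inl w) := by
          intro w hw
          have hw' := hw
          simp only [bound, Finset.mem_insert, not_or] at hw'
          rw [hP₂, Function.update_of_ne (by simpa using hw'.1), hP₁ w hw'.2, hQP w hw]
        have hbody' : ∀ ph, Exec u body (Core.st ⟨Q, false, o⟩ (decide (Q (.inl v) < u.length)) ph)
            (Core.st ⟨P₂, b₁, o⟩ (decide (P₂ (.inl v) < u.length)) ph) := by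
          intro ph
          obtain ⟨a', h₁⟩ := h₁ (decide (Q (.inl v) < u.length)) ph
          refine .seq h₁ (.seq (.op _ _) ?_)
          refine exec_op_of_eq ?_
          simp only [Op.apply, Core.st, isSome_getElem?_eq]
          rfl
        cases b₁ with
        | true =>
          refine ⟨P₂, true, fun ph => ⟨_, .loopStep (by simp [Core.st, h2]) (hbody' ph)
            (.loopEnd (by simp [Core.st]))⟩, ?_, hQP₂⟩
          simp only [true_iff]
          exact ⟨_, h2, le_rfl, hb₁.1 rfl⟩
        | false =>
          obtain ⟨P', b, h₃, hb, h₄⟩ := ihk P₂ hle₂ (by omega) hQP₂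
          refine ⟨P', b, fun ph => ?_, ?_, h₄⟩
          · obtain ⟨a', h₃⟩ := h₃ ph
            exact ⟨a', .loopStep (by simp [Core.st, h2]) (hbody' ph) h₃⟩
          · rw [hb]
            refine exists_congr fun i => and_congr_right fun hi => ?_
            rw [hv₂]
            constructor
            · rintro ⟨h5, h6⟩
              exact ⟨by omega, h6⟩
            · rintro ⟨h5, h6⟩
              refine ⟨?_, h6⟩
              rcases Nat.lt_or_eq_of_le h5 with h7 | h7
              · exact h7
              · subst h7
                exact absurd (hb₁.2 h6) (by simp)
    have hQ₀ : ∀ h, Function.update P (.inl v) 0 h ≤ u.length :=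
      (runs_rewind (u := u) (.inl v) P r o).le hP
    obtain ⟨P', b, h₁, hb, hP'⟩ := key u.length (Function.update P (.inl v) 0) hQ₀ (by simp)
      (fun w hw => by
        simp only [bound, Finset.mem_insert, not_or] at hw
        rw [Function.update_of_ne (by simpa using hw.1)])
    refine ⟨P', b, (runs_rewind _ _ _ _).seq ((runs_setRes false _ _ _).seq fun a ph => ?_), ?_,
      hP'⟩
    · obtain ⟨a', h₁⟩ := h₁ ph
      refine ⟨a', .seq ?_ h₁⟩
      refine exec_op_of_eq ?_
      simp only [Op.apply, Core.st, isSome_getElem?_eq]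
    · rw [hb]
      simp [Holds]

end Formula

end HeadMachine

/-! ### Definable predicates in polynomial time and in NP; writing queries -/

namespace HeadMachine

open Turing

namespace Formula

variable {α V : Type} [DecidableEq V]

/-- Disjunction. -/
def or (φ ψ : Formula α V) : Formula α V := not (and (not φ) (not ψ))

/-- Implication. -/
def imp (φ ψ : Formula α V) : Formula α V := not (and φ (not ψ))

/-- Universal quantification. -/
def all (v : V) (φ : Formula α V) : Formula α V := not (ex v (not φ))

/-- `v = w`. -/
def eq (v w : V) : Formula α V := arith (.const 1) (.var v) (.const 0) w

/-- `v + 1 = w`. -/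
def succ (v w : V) : Formula α V := arith (.const 1) (.var v) (.const 1) w

/-- `v + w = x`. -/
def add (v w x : V) : Formula α V := arith (.const 1) (.var v) (.var w) x

/-- `v ≤ w`, with the help of the variable `z`. -/
def le (z v w : V) : Formula α V := ex z (add z v w)

variable {u : List α} {e : V → ℕ}

theorem holds_or (φ ψ : Formula α V) : (or φ ψ).Holds u e ↔ φ.Holds u e ∨ ψ.Holds u e := by
  simp only [or, Holds]; tauto

theorem holds_imp (φ ψ : Formula α V) : (imp φ ψ).Holds u e ↔ (φ.Holds u e → ψ.Holds u e) := by
  simp only [imp, Holds]; tauto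

theorem holds_all (v : V) (φ : Formula α V) :
    (all v φ).Holds u e ↔ ∀ i < u.length, φ.Holds u (Function.update e v i) := by
  simp only [all, Holds]; push Not; rfl

theorem holds_eq (v w : V) : (eq v w : Formula α V).Holds u e ↔ e v = e w := by
  simp [eq, Holds, Term.val]

theorem holds_succ (v w : V) : (succ v w : Formula α V).Holds u e ↔ e v + 1 = e w := by
  simp [succ, Holds, Term.val]

theorem holds_add (v w x : V) : (add v w x : Formula α V).Holds u e ↔ e v + e w = e x := by
  simp [add, Holds, Term.val]

/-- The difference is the witness; the bound on `w` puts it in the range of the quantifier. -/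
theorem holds_le {z v w : V} (hv : v ≠ z) (hw : w ≠ z) (h : e w < u.length) :
    (le z v w : Formula α V).Holds u e ↔ e v ≤ e w := by
  simp only [le, Holds, holds_add, Function.update_self, Function.update_of_ne hv,
    Function.update_of_ne hw]
  exact ⟨fun ⟨i, _, hi⟩ => by omega, fun h => ⟨e w - e v, by omega, by omega⟩⟩

end Formula

section Decision

variable {α V : Type} [Fintype α] [Inhabited α] [Fintype V] [DecidableEq V]

open Classical in
/-- Whether a tidy closed formula holds can be decided in polynomial time. -/
theorem polyTime_of_formula {A : Type} {ea : A → List α} {f : A → Bool} {φ : Formula α V}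
    (hφ : φ.Tidy) (hc : φ.free = ∅) (hf : ∀ a, f a = true ↔ φ.Holds (ea a) fun _ => 0) :
    Nonempty (TM2ComputableInPolyTime ea Computability.encodeBool f) := by
  refine polyTime_of_exec (H := V ⊕ Fin 4) (.seq φ.prog (.op (.emit (.inr 0) fun f _ => f.res)))
    ⟨false, false, 0⟩ fun a => ?_
  obtain ⟨P', b, h₁, hb, -⟩ := Formula.runs_prog (u := ea a) hφ (fun _ => (ea a).length) false
    ([] : List Bool) (fun _ => le_rfl)
  obtain ⟨a', h₁⟩ := h₁ false 0
  refine ⟨_, .seq h₁ (.op _ _), ?_⟩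
  have : b = f a := by
    rw [Bool.eq_iff_iff, hb, hf]
    -- The heads start at the end of the word rather than at `0`, which does not matter for a closed
    -- formula.
    exact Formula.holds_congr _ (by simp [hc])
  rw [← this]
  rfl

/-- A language is in NP if it is defined by a tidy closed formula about words and certificates of
polynomial length. -/
theorem inNP_of_formula {Γ : Type} [Fintype Γ] {φ : Formula (Γ ⊕ Bool) V}
    (hφ : φ.Tidy) (hc : φ.free = ∅) (p : Polynomial ℕ) :
    InNP {x : List Γ | ∃ w : List Bool, w.length ≤ p.eval x.length ∧
      φ.Holds (encodePair (x, w)) fun _ => 0} := by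
  classical
  refine ⟨fun a => decide (φ.Holds (encodePair a) fun _ => 0), p, ?_, fun x => ?_⟩
  · have : Inhabited (Γ ⊕ Bool) := ⟨.inr true⟩
    exact polyTime_of_formula hφ hc fun a => decide_eq_true_iff
  · simp only [decide_eq_true_eq]
    rfl

end Decision

section Queries

variable {V Ω : Type} [DecidableEq V]

/-- The word `u` with the positions up to `k` and the kind `t` of the query marked in every
letter. -/
def query (u : List Bool) (t : Bool) (k : ℕ) : List (Bool × Bool × Bool) :=
  u.mapIdx fun i b => (b, decide (i ≤ k), t)

/-- Move a head to the end. -/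
def toEnd {α H : Type} (h : H) : Prog α Flags H Ω := untilEnd h (.op (.right h))

theorem runs_toEnd {α H : Type} [DecidableEq H] {u : List α} (h : H) (P : H → ℕ) (r : Bool)
    (o : List Ω) (hP : P h ≤ u.length) :
    Runs u (toEnd h) ⟨P, r, o⟩ ⟨Function.update P h u.length, r, o⟩ := by
  obtain ⟨n, hn⟩ := Nat.exists_eq_add_of_le hP
  induction n generalizing P with
  | zero =>
    rw [hn, Nat.add_zero, Function.update_eq_self]
    exact runs_untilEnd_end (by simp [hn])
  | succ n ih =>
    refine runs_untilEnd_step (c := ⟨P, r, o⟩) (by simp only; omega) (runs_right h P r o) ?_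
    have := ih (Function.update P h (min (P h + 1) u.length)) (by simp)
      (by rw [Function.update_self]; omega)
    simp only [Function.update_idem] at this
    exact this

/-- Write a query, with the head `k` at its parameter. -/
def emitQuery (z p k : V) (t : Bool) (g : Bool × Bool × Bool → Ω) :
    Prog Bool Flags (V ⊕ Fin 4) Ω :=
  .seq (toEnd (.inl p)) (untilStart (.inl p) (.seq (.op (.left (.inl p)))
    (.seq (Formula.le z p k).prog
      (.op (.emit (.inl p) fun f a => g (a.getD false, f.res, t))))))

theorem tidy_le {α : Type} {z p k : V} : (Formula.le z p k : Formula α V).Tidy :=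
  ⟨trivial, by simp [Formula.bound, Formula.add], by simp [Formula.bound, Formula.add]⟩

/-- The output is built from its last symbol on, so `p` scans the word backwards. The mark of a
letter is the result of evaluating `p ≤ k`, with `z` as the quantified variable. -/
theorem runs_emitQuery {u : List Bool} {z p k : V} (hzp : p ≠ z) (hzk : k ≠ z) (hpk : p ≠ k)
    (t : Bool) (g : Bool × Bool × Bool → Ω) (P : V ⊕ Fin 4 → ℕ) (r : Bool) (o : List Ω)
    (hP : ∀ h, P h ≤ u.length) (hk : P (.inl k) < u.length) : ∃ P' r',
      Runs u (emitQuery z p k t g) ⟨P, r, o⟩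
        ⟨P', r', (query u t (P (.inl k))).map g ++ o⟩ ∧
      ∀ v, v ≠ z → v ≠ p → P' (.inl v) = P (.inl v) := by
  -- When `p` is at `n`, the letters of the query from `n` on have been written.
  have key : ∀ n, ∀ Q : V ⊕ Fin 4 → ℕ, ∀ r, (∀ h, Q h ≤ u.length) → Q (.inl p) = n →
      Q (.inl k) = P (.inl k) → ∃ P' r',
      Runs u (untilStart (.inl p) (.seq (.op (.left (.inl p)))
        (.seq (Formula.le z p k).prog
        (.op (.emit (.inl p) fun f a => g (a.getD false, f.res, t))))))
        ⟨Q, r, ((query u t (P (.inl k))).drop n).map g ++ o⟩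
        ⟨P', r', (query u t (P (.inl k))).map g ++ o⟩ ∧
      ∀ v, v ≠ z → v ≠ p → P' (.inl v) = Q (.inl v) := by
    intro n
    induction n with
    | zero =>
      intro Q r hQ hp hQk
      exact ⟨Q, r, runs_untilStart_zero hp, fun _ _ _ => rfl⟩
    | succ n ih =>
      intro Q r hQ hp hQk
      have hn : n < u.length := by have := hQ (.inl p); omega
      set Q₁ := Function.update Q (.inl p) (Q (.inl p) - 1) with hQ₁
      have hQ₁p : Q₁ (.inl p) = n := by simp [hQ₁, hp]
      have hQ₁k : Q₁ (.inl k) = P (.inl k) := by simp [hQ₁, hpk.symm, hQk]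
      obtain ⟨Q₂, b, h₁, hb, hQ₂⟩ := Formula.runs_prog (u := u)
        (tidy_le : (Formula.le z p k).Tidy) Q₁ r
        (((query u t (P (.inl k))).drop (n + 1)).map g ++ o) ((runs_left _ Q r o).le hQ)
      have hQ₂' : ∀ v, v ≠ z → Q₂ (.inl v) = Q₁ (.inl v) := fun v hv =>
        hQ₂ v (by simpa [Formula.le, Formula.bound, Formula.add] using hv)
      rw [Formula.holds_le hzp hzk (by rw [hQ₁k]; exact hk), hQ₁p, hQ₁k] at hb
      obtain ⟨P', r', h₂, hP'⟩ := ih Q₂ b (h₁.le ((runs_left _ Q r o).le hQ))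
        ((hQ₂' p hzp).trans hQ₁p) ((hQ₂' k hzk).trans hQ₁k)
      refine ⟨P', r', runs_untilStart_step (by simp [hp]) ((runs_left _ _ _ _).seq (h₁.seq
        fun a ph => ⟨a, exec_op_of_eq (s' := Core.st ⟨Q₂, b, _⟩ a ph) ?_⟩)) h₂, fun v hv hvp => ?_⟩
      · simp only [Op.apply, Core.st]
        congr 1
        have hb' : b = decide (n ≤ P (.inl k)) := by
          rw [Bool.eq_iff_iff, hb, decide_eq_true_iff]
        have hlen : n < (query u t (P (.inl k))).length := by simpa [query] using hn
        rw [List.drop_eq_getElem_cons hlen, hQ₂' p hzp, hQ₁p, hb']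
        simp [query, hn]
      · rw [hP' v hv hvp, hQ₂' v hv, hQ₁, Function.update_of_ne (by simpa using hvp)]
  obtain ⟨P', r', h₁, hP'⟩ := key u.length (Function.update P (.inl p) u.length) r
    ((runs_toEnd (Ω := Ω) (.inl p) P r [] (hP _)).le hP) (by simp) (by simp [hpk.symm])
  refine ⟨P', r', (runs_toEnd _ _ _ _ (hP _)).seq ?_, fun v hv hvp => ?_⟩
  · rw [List.drop_eq_nil_of_le (by simp [query])] at h₁
    simpa using h₁
  · rw [hP' v hv hvp, Function.update_of_ne (by simpa using hvp)]

/-- Write the queries for all parameters. -/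
def emitAll (z p k : V) (t : Bool) :
    Prog Bool Flags (V ⊕ Fin 4) (Option (Bool × Bool × Bool)) :=
  .seq (toEnd (.inl k)) (untilStart (.inl k) (.seq (.op (.left (.inl k)))
    (.seq (.op (.emit (.inl k) fun _ _ => none)) (emitQuery z p k t some))))

theorem encodeTable_append {Δ : Type} (s t : List (List Δ)) :
    encodeTable (s ++ t) = encodeTable s ++ encodeTable t := List.flatMap_append

/-- Again everything is written backwards: the parameter runs down, and each separator is emitted
before the query that it follows in the table. -/
theorem runs_emitAll {u : List Bool} {z p k : V} (hzp : p ≠ z) (hzk : k ≠ z) (hpk : p ≠ k)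
    (t : Bool) (P : V ⊕ Fin 4 → ℕ) (r : Bool) (o : List (Option (Bool × Bool × Bool)))
    (hP : ∀ h, P h ≤ u.length) : ∃ P' r',
      Runs u (emitAll z p k t) ⟨P, r, o⟩
        ⟨P', r', encodeTable ((List.range u.length).map (query u t)) ++ o⟩ := by
  have key : ∀ n, ∀ Q : V ⊕ Fin 4 → ℕ, ∀ r o, (∀ h, Q h ≤ u.length) → Q (.inl k) = n →
      ∃ P' r', Runs u (untilStart (.inl k) (.seq (.op (.left (.inl k)))
        (.seq (.op (.emit (.inl k) fun _ _ => none)) (emitQuery z p k t some))))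
        ⟨Q, r, o⟩ ⟨P', r', encodeTable ((List.range n).map (query u t)) ++ o⟩ := by
    intro n
    induction n with
    | zero =>
      intro Q r o hQ hk
      exact ⟨Q, r, runs_untilStart_zero hk⟩
    | succ n ih =>
      intro Q r o hQ hk
      have hn : n < u.length := by have := hQ (.inl k); omega
      set Q₁ := Function.update Q (.inl k) (Q (.inl k) - 1) with hQ₁
      have hQ₁k : Q₁ (.inl k) = n := by simp [hQ₁, hk]
      have hQ₁l : ∀ h, Q₁ h ≤ u.length := (runs_left _ Q r o).le hQ
      obtain ⟨Q₂, b, h₁, hQ₂⟩ := runs_emitQuery hzp hzk hpk t some Q₁ r (none :: o) hQ₁l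
        (by omega)
      obtain ⟨P', r', h₂⟩ := ih Q₂ b _ (h₁.le hQ₁l) ((hQ₂ k hzk hpk.symm).trans hQ₁k)
      refine ⟨P', r', runs_untilStart_step (by simp [hk]) ((runs_left _ _ _ _).seq
        (Runs.seq (c' := ⟨Q₁, r, none :: o⟩) (fun a ph => ⟨a, exec_op_of_eq rfl⟩) h₁)) ?_⟩
      convert h₂ using 2
      rw [List.range_succ, List.map_append, encodeTable_append, hQ₁k]
      simp [encodeTable]
  obtain ⟨P', r', h₁⟩ := key u.length (Function.update P (.inl k) u.length) r o
    ((runs_toEnd (Ω := Option (Bool × Bool × Bool)) (.inl k) P r [] (hP _)).le hP) (by simp)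
  exact ⟨P', r', (runs_toEnd _ _ _ _ (hP _)).seq h₁⟩

/-- The table of all queries of both kinds. -/
def queryTable (u : List Bool) : List (List (Bool × Bool × Bool)) :=
  (List.range u.length).map (query u false) ++ (List.range u.length).map (query u true)

theorem polyTime_queryTable : Nonempty (TM2ComputableInPolyTime id encodeTable queryTable) := by
  refine polyTime_of_exec (H := Fin 3 ⊕ Fin 4) (.seq (emitAll 0 1 2 true) (emitAll 0 1 2 false))
    ⟨false, false, 0⟩ fun u => ?_
  obtain ⟨P₁, r₁, h₁⟩ := runs_emitAll (u := u) (z := (0 : Fin 3)) (p := 1) (k := 2) (by decide)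
    (by decide) (by decide) true (fun _ => u.length) false [] (fun _ => le_rfl)
  obtain ⟨P₂, r₂, h₂⟩ := runs_emitAll (z := (0 : Fin 3)) (p := 1) (k := 2) (by decide)
    (by decide) (by decide) false P₁ r₁ _ (h₁.le fun _ => le_rfl)
  obtain ⟨a, h⟩ := (h₁.seq h₂) false 0
  refine ⟨_, h, ?_⟩
  simp [Core.st, queryTable, encodeTable_append]

end Queries

end HeadMachine

/-! ### Parallel access: all queries at once -/

namespace HeadMachine

open Turing

section Parallel

/-- The formula which says that for some `k` the answers at the positions `k` and `n + k` are
positive and negative, where `n` is the length of the input. -/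
def decisionFormula : Formula (Bool ⊕ Bool) (Fin 5) :=
  .ex 1 (.and (.and (.ex 0 (.and (.succ 0 1) (.letter 0 Sum.isLeft))) (.letter 1 Sum.isRight))
    (.ex 2 (.and (.letter 2 Sum.isLeft) (.ex 3 (.and (.add 1 2 3) (.and (.letter 3 (· == .inr true))
      (.ex 4 (.and (.add 1 3 4) (.letter 4 (· == .inr false))))))))))

theorem getElem?_encodePair {Γ : Type} (x : List Γ) (w : List Bool) (i : ℕ) :
    (encodePair (x, w))[i]? =
      if i < x.length then x[i]?.map Sum.inl else w[i - x.length]?.map Sum.inr := by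
  simp only [encodePair, List.getElem?_append, List.length_map, List.getElem?_map]

theorem length_encodePair {Γ : Type} (x : List Γ) (w : List Bool) :
    (encodePair (x, w)).length = x.length + w.length := by
  simp [encodePair]

/-- The variable `1` is pinned to `x.length` as the border between the two alphabets. Since both
lists of answers have that length, their entries at `k` are found by adding it once or twice. -/
theorem decisionFormula_holds (x a b : List Bool) (ha : a.length = x.length)
    (hb : b.length = x.length) (e : Fin 5 → ℕ) :
    decisionFormula.Holds (encodePair (x, a ++ b)) e ↔
      ∃ k < x.length, a[k]? = some true ∧ b[k]? = some false := by
  have hlen : (encodePair (x, a ++ b)).length = 3 * x.length := by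
    rw [length_encodePair, List.length_append]; omega
  have hL : ∀ i < 3 * x.length, (∃ c, (encodePair (x, a ++ b))[i]? = some c ∧ c.isLeft = true) ↔
      i < x.length := by
    intro i hi
    rw [getElem?_encodePair]
    split_ifs with h
    · simp [h]
    · simp [h]
  have hR : ∀ i < 3 * x.length, (∃ c, (encodePair (x, a ++ b))[i]? = some c ∧ c.isRight = true) ↔
      x.length ≤ i := by
    intro i hi
    rw [getElem?_encodePair]
    split_ifs with h
    · simp [h]
    · simp only [not_lt] at h
      have : i - x.length < (a ++ b).length := by rw [List.length_append]; omega
      rw [List.getElem?_eq_getElem this]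
      simp [h]
  have hV : ∀ v i, x.length ≤ i → ((∃ c, (encodePair (x, a ++ b))[i]? = some c ∧
      (c == Sum.inr v) = true) ↔ (a ++ b)[i - x.length]? = some v) := by
    intro v i hi
    rw [getElem?_encodePair, if_neg (by omega)]
    cases (a ++ b)[i - x.length]? with
    | none => simp
    | some c => cases c <;> cases v <;> simp <;> rfl
  simp only [decisionFormula, Formula.Holds, Formula.holds_succ, Formula.holds_add]
  rw [hlen]
  constructor
  · rintro ⟨n, hn, ⟨⟨m, hm, hmn, hml⟩, hnr⟩, k, hk, hkl, p, hp, hnp, hpv, q, hq, hpq, hqv⟩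
    have hmn : m + 1 = n := hmn
    have hml := (hL m (by omega)).1 hml
    have hnr := (hR n (by omega)).1 hnr
    have hkl := (hL k (by omega)).1 hkl
    have hnp : n + k = p := hnp
    have hpq : n + p = q := hpq
    have hpv := (hV true p (by omega)).1 hpv
    have hqv := (hV false q (by omega)).1 hqv
    rw [List.getElem?_append_left (by omega), show p - x.length = k by omega] at hpv
    rw [List.getElem?_append_right (by omega), show q - x.length - a.length = k by omega] at hqv
    exact ⟨k, hkl, hpv, hqv⟩
  · rintro ⟨k, hk, hak, hbk⟩
    -- As `k < x.length`, the input is nonempty and the border has a left neighbour.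
    have h₀ := (hL (x.length - 1) (by omega)).2 (by omega)
    have h₁ := (hR x.length (by omega)).2 le_rfl
    have h₂ := (hL k (by omega)).2 hk
    have h₃ := (hV true (x.length + k) (by omega)).2 (by
      rw [List.getElem?_append_left (by omega), Nat.add_sub_cancel_left, hak])
    have h₄ := (hV false (x.length + (x.length + k)) (by omega)).2 (by
      rw [List.getElem?_append_right (by omega),
        show x.length + (x.length + k) - x.length - a.length = k by omega, hbk])
    exact ⟨x.length, by omega, ⟨⟨x.length - 1, by omega, Nat.sub_add_cancel (by omega), h₀⟩, h₁⟩,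
      k, by omega, h₂, x.length + k, by omega, rfl, h₃, x.length + (x.length + k), by omega, rfl,
      h₄⟩

open Classical in
theorem inPParallelNP_of_query {L : Language Bool} {A : Language (Bool × Bool × Bool)}
    (hA : InNP A)
    (hL : ∀ u, u ∈ L ↔ ∃ k < u.length, query u false k ∈ A ∧ query u true k ∉ A) :
    InPParallelNP L := by
  refine ⟨_, A, queryTable, fun a => decide (decisionFormula.Holds (encodePair a) fun _ => 0),
    hA, polyTime_queryTable, ?_, fun u => ?_⟩
  · have : Inhabited (Bool ⊕ Bool) := ⟨.inr true⟩
    exact polyTime_of_formula (φ := decisionFormula) (by decide) (by decide)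
      fun a => decide_eq_true_iff
  · rw [hL, decide_eq_true_iff, queryTable, List.map_append, decisionFormula_holds _ _ _
      (by simp) (by simp)]
    refine exists_congr fun k => and_congr_right fun hk => ?_
    simp [hk]

end Parallel

/-! ### Adaptive access: binary search with logarithmically many queries -/

section Adaptive

/-- The heads `2` and `3` bound the search interval, and `4` holds the parameter of the current
query. The heads `0` and `1` serve `emitQuery`; `5` and `6` are the quantified variables of
`midFormula`. Phase `0` is the start, `1` the search, `2` means that the final query has been asked,
and `3` that the result is known. -/
abbrev QProg := Prog Bool Flags (Fin 7 ⊕ Fin 4) (Bool × Bool × Bool)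

/-- Change the phase. -/
def setPhase (j : Fin 4) : QProg := .op (.load fun f => { f with phase := j })

/-- Move the head `v` to the first position for which the formula holds. -/
def search {α V Ω : Type} [DecidableEq V] (v : V) (φ : Formula α V) :
    Prog α Flags (V ⊕ Fin 4) Ω :=
  .seq (rewind (.inl v)) (untilRes φ.prog (.op (.right (.inl v))))

/-- This turns a definition of a position into an assignment. The scan from the start must stop at
`n`, the only position where the formula holds. The end of the word is allowed as a value of `v`,
although quantifiers do not reach it. -/
theorem runs_search {α V Ω : Type} [DecidableEq V] {u : List α} {v : V} {φ : Formula α V}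
    (hφ : φ.Tidy) (hv : v ∉ φ.bound) (hd : Disjoint φ.bound φ.free) (P : V ⊕ Fin 4 → ℕ) (r : Bool)
    (o : List Ω) (hP : ∀ h, P h ≤ u.length) {n : ℕ} (hn : n ≤ u.length)
    (h : ∀ m ≤ u.length, φ.Holds u (Function.update (fun w => P (.inl w)) v m) ↔ m = n) :
    ∃ P' r', Runs u (search v φ) ⟨P, r, o⟩ ⟨P', r', o⟩ ∧ P' (.inl v) = n ∧
      ∀ w, w ≠ v → w ∉ φ.bound → P' (.inl w) = P (.inl w) := by
  have hcongr : ∀ Q : V ⊕ Fin 4 → ℕ,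
      (∀ w, w ≠ v → w ∉ φ.bound → Q (.inl w) = P (.inl w)) →
      ((φ.Holds u fun w => Q (.inl w)) ↔
        φ.Holds u (Function.update (fun w => P (.inl w)) v (Q (.inl v)))) := by
    intro Q hQ
    refine Formula.holds_congr u fun w hw => ?_
    by_cases e : w = v
    · subst e; simp
    · rw [Function.update_of_ne e]
      exact hQ w e fun h => Finset.disjoint_left.1 hd h hw
  have key : ∀ k, ∀ Q : V ⊕ Fin 4 → ℕ, ∀ r, (∀ h, Q h ≤ u.length) → n = Q (.inl v) + k →
      (∀ w, w ≠ v → w ∉ φ.bound → Q (.inl w) = P (.inl w)) → ∃ P' r',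
      Runs u (untilRes φ.prog (.op (.right (.inl v)))) ⟨Q, r, o⟩ ⟨P', r', o⟩ ∧ P' (.inl v) = n ∧
      ∀ w, w ≠ v → w ∉ φ.bound → P' (.inl w) = P (.inl w) := by
    intro k
    induction k with
    | zero =>
      intro Q r hQ hk hQP
      obtain ⟨Q₁, b, h₁, hb, hQ₁⟩ := Formula.runs_prog hφ Q r o hQ
      rw [hcongr Q hQP, h _ (hQ _)] at hb
      refine ⟨Q₁, b, runs_untilRes_true h₁ (hb.2 (by omega)), (hQ₁ v hv).trans (by omega),
        fun w hw hwb => (hQ₁ w hwb).trans (hQP w hw hwb)⟩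
    | succ k ih =>
      intro Q r hQ hk hQP
      obtain ⟨Q₁, b, h₁, hb, hQ₁⟩ := Formula.runs_prog hφ Q r o hQ
      rw [hcongr Q hQP, h _ (hQ _)] at hb
      obtain rfl : b = false := by
        cases b
        · rfl
        · have := hb.1 rfl; omega
      obtain ⟨P', r', h₂, hv', hP'⟩ := ih
        (Function.update Q₁ (.inl v) (min (Q₁ (.inl v) + 1) u.length)) false
        ((runs_right _ Q₁ false o).le (h₁.le hQ))
        (by rw [Function.update_self, hQ₁ v hv]; omega)
        (fun w hw hwb => by
          rw [Function.update_of_ne (by simpa using hw), hQ₁ w hwb, hQP w hw hwb])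
      exact ⟨P', r', runs_untilRes_false h₁ rfl (runs_right _ _ _ _) h₂, hv', hP'⟩
  obtain ⟨P', r', h₁, h₂⟩ := key n (Function.update P (.inl v) 0) r
    ((runs_rewind (u := u) (.inl v) P r o).le hP) (by simp)
    (fun w hw _ => by rw [Function.update_of_ne (by simpa using hw)])
  exact ⟨P', r', (runs_rewind _ _ _ _).seq h₁, h₂⟩

/-- The formula `4 = ⌊(2 + 3) / 2⌋`, for `2 < 3`. -/
def midFormula : Formula Bool (Fin 7) :=
  .ex 5 (.and (.succ 5 3) (.ex 6 (.and (.add 2 6 4) (.or (.add 4 6 5) (.add 4 6 3)))))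

/-- With `j = e 4 - e 2`, the formula says that `e 2 + 2 * j` is `e 3` or `e 3 - 1`. The witnesses
`e 3 - 1` and `j` are positions on the word even if `e 3` is its end. -/
theorem midFormula_holds {u : List Bool} {e : Fin 7 → ℕ} (h₁ : e 2 < e 3) (h₂ : e 3 ≤ u.length) :
    midFormula.Holds u e ↔ e 4 = e 2 + (e 3 - e 2) / 2 := by
  simp only [midFormula, Formula.Holds, Formula.holds_succ, Formula.holds_or, Formula.holds_add]
  simp
  constructor
  · rintro ⟨i, hi, h3, j, hj, h4, h5 | h5⟩ <;> omega
  · intro h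
    exact ⟨e 3 - 1, by omega, by omega, e 4 - e 2, by omega, by omega, by omega⟩

/-- Incorporate the answer to a query in the search interval. -/
def updateInterval : QProg :=
  .ite (fun f => f.phase == 0) (.seq (rewind (.inl 2)) (setPhase 1))
    (.ite Flags.res (search 2 (.succ 4 2)) (search 3 (.eq 4 3)))

/-- Ask the next query. -/
def askNext : QProg :=
  .seq (Formula.eq 2 3).prog (.ite Flags.res
    (ifStart (.inl 2) (.seq (setRes false) (setPhase 3))
      (.seq (search 4 (.succ 4 2)) (.seq (setPhase 2) (emitQuery 0 1 4 true id))))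
    (.seq (search 4 midFormula) (emitQuery 0 1 4 false id)))

/-- One round of the binary search between the heads `2` and `3`. -/
def searchRound : QProg :=
  .ite (fun f => f.phase == 2) (.seq notRes (setPhase 3)) (.seq updateInterval askNext)

variable {u : List Bool}

/-- The program gets from one core and phase to another, whatever the auxiliary bit. -/
def PhaseRuns (u : List Bool) (p : QProg) (c : Core (Fin 7 ⊕ Fin 4) (Bool × Bool × Bool))
    (ph : Fin 4) (c' : Core (Fin 7 ⊕ Fin 4) (Bool × Bool × Bool)) (ph' : Fin 4) : Prop :=
  ∀ a, ∃ a', Exec u p (c.st a ph) (c'.st a' ph')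

theorem PhaseRuns.seq {p q : QProg} {c c' c'' : Core (Fin 7 ⊕ Fin 4) (Bool × Bool × Bool)}
    {ph ph' ph'' : Fin 4} (h₁ : PhaseRuns u p c ph c' ph') (h₂ : PhaseRuns u q c' ph' c'' ph'') :
    PhaseRuns u (.seq p q) c ph c'' ph'' := by
  intro a
  obtain ⟨a', h₁⟩ := h₁ a
  obtain ⟨a'', h₂⟩ := h₂ a'
  exact ⟨a'', .seq h₁ h₂⟩

theorem Runs.phaseRuns {p : QProg} {c c' : Core (Fin 7 ⊕ Fin 4) (Bool × Bool × Bool)}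
    (h : Runs u p c c') (ph : Fin 4) : PhaseRuns u p c ph c' ph := fun a => h a ph

theorem phaseRuns_setPhase (c : Core (Fin 7 ⊕ Fin 4) (Bool × Bool × Bool)) (ph ph' : Fin 4) :
    PhaseRuns u (setPhase ph') c ph c ph' := fun a => ⟨a, .op _ _⟩

theorem phaseRuns_iteRes {p q r : QProg} {c c' : Core (Fin 7 ⊕ Fin 4) (Bool × Bool × Bool)}
    {ph ph' : Fin 4} (hr : r = bif c.res then p else q) (h : PhaseRuns u r c ph c' ph') :
    PhaseRuns u (.ite Flags.res p q) c ph c' ph' := by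
  intro a
  obtain ⟨a', h⟩ := h a
  cases e : c.res with
  | true => rw [hr, e, cond_true] at h; exact ⟨a', .iteTrue e h⟩
  | false => rw [hr, e, cond_false] at h; exact ⟨a', .iteFalse e h⟩

theorem phaseRuns_ifStart {h : Fin 7 ⊕ Fin 4} {p q : QProg}
    {c c' : Core (Fin 7 ⊕ Fin 4) (Bool × Bool × Bool)} {ph ph' : Fin 4}
    (h₁ : c.pos h = 0 → PhaseRuns u p c ph c' ph') (h₂ : c.pos h ≠ 0 → PhaseRuns u q c ph c' ph') :
    PhaseRuns u (ifStart h p q) c ph c' ph' := by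
  intro a
  by_cases h0 : c.pos h = 0
  · obtain ⟨a', h'⟩ := h₁ h0 true
    refine ⟨a', .seq (.op _ _) (.iteTrue ?_ ?_)⟩
    · simp [Op.apply, Core.st, h0]
    · simpa [Op.apply, Core.st, h0] using h'
  · obtain ⟨a', h'⟩ := h₂ h0 false
    have h0' : (c.pos h == 0) = false := by simpa using h0
    refine ⟨a', .seq (.op _ _) (.iteFalse ?_ ?_)⟩
    · simp [Op.apply, Core.st, h0]
    · simpa [Op.apply, Core.st, h0'] using h'

theorem runs_eq (v w : Fin 7) (P : Fin 7 ⊕ Fin 4 → ℕ) (r : Bool)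
    (o : List (Bool × Bool × Bool)) (hP : ∀ h, P h ≤ u.length) :
    ∃ P', Runs u (Formula.eq v w).prog ⟨P, r, o⟩
      ⟨P', decide (P (.inl v) = P (.inl w)), o⟩ ∧ ∀ x, P' (.inl x) = P (.inl x) := by
  obtain ⟨P', b, h₁, hb, hP'⟩ := Formula.runs_prog (φ := Formula.eq v w) trivial P r o hP
  rw [Formula.holds_eq] at hb
  have : b = decide (P (.inl v) = P (.inl w)) := by
    rw [Bool.eq_iff_iff, hb, decide_eq_true_iff]
  exact ⟨P', this ▸ h₁, fun x => hP' x (by simp [Formula.eq, Formula.bound])⟩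

theorem askNext_reject {P : Fin 7 ⊕ Fin 4 → ℕ} {r : Bool} (hP : ∀ h, P h ≤ u.length)
    (h₂ : P (.inl 2) = 0) (h₃ : P (.inl 3) = 0) :
    ∃ P', PhaseRuns u askNext ⟨P, r, []⟩ 1 ⟨P', false, []⟩ 3 := by
  obtain ⟨P₁, hr₁, hP₁⟩ := runs_eq 2 3 P r [] hP
  refine ⟨P₁, (hr₁.phaseRuns 1).seq (phaseRuns_iteRes (by rw [h₂, h₃]; rfl)
    (phaseRuns_ifStart (fun _ => ?_) fun h => absurd ((hP₁ 2).trans h₂) h))⟩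
  exact ((runs_setRes false _ _ _).phaseRuns 1).seq (phaseRuns_setPhase _ _ _)

/-- When the interval has shrunk to the threshold `k + 1`, the largest parameter with a positive
answer is `k`, one less than the heads show; the final query is about it. -/
theorem askNext_final {P : Fin 7 ⊕ Fin 4 → ℕ} {r : Bool} (hP : ∀ h, P h ≤ u.length) {k : ℕ}
    (h₂ : P (.inl 2) = k + 1) (h₃ : P (.inl 3) = k + 1) :
    ∃ P' r', PhaseRuns u askNext ⟨P, r, []⟩ 1 ⟨P', r', query u true k⟩ 2 := by
  have hk : k + 1 ≤ u.length := h₂ ▸ hP _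
  obtain ⟨P₁, hr₁, hP₁⟩ := runs_eq 2 3 P r [] hP
  have hl₁ := hr₁.le hP
  obtain ⟨P₂, r₂, hr₂, hv₂, hP₂⟩ := runs_search (φ := .succ (4 : Fin 7) 2) (v := 4) trivial
    (by decide) (by decide) P₁ (decide (P (.inl 2) = P (.inl 3))) [] hl₁ (n := k) (by omega)
    (fun m hm => by
      rw [Formula.holds_succ]
      simp [hP₁, h₂])
  have hl₂ := hr₂.le hl₁
  obtain ⟨P₃, r₃, hr₃, -⟩ := runs_emitQuery (z := (0 : Fin 7)) (p := 1) (k := 4) (by decide)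
    (by decide) (by decide) true id P₂ r₂ [] hl₂ (by omega)
  rw [hv₂, List.map_id, List.append_nil] at hr₃
  refine ⟨P₃, r₃, (hr₁.phaseRuns 1).seq (phaseRuns_iteRes (by simp [h₂, h₃]; rfl)
    (phaseRuns_ifStart (fun h => ?_) fun _ => ?_))⟩
  · exact absurd ((hP₁ 2).symm.trans h) (by omega)
  · exact (hr₂.phaseRuns 1).seq ((phaseRuns_setPhase _ _ _).seq (hr₃.phaseRuns 2))

theorem askNext_search {P : Fin 7 ⊕ Fin 4 → ℕ} {r : Bool} (hP : ∀ h, P h ≤ u.length)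
    (h : P (.inl 2) < P (.inl 3)) :
    ∃ P' r', PhaseRuns u askNext ⟨P, r, []⟩ 1
      ⟨P', r', query u false (P (.inl 2) + (P (.inl 3) - P (.inl 2)) / 2)⟩ 1 ∧
      (∀ h, P' h ≤ u.length) ∧ P' (.inl 2) = P (.inl 2) ∧ P' (.inl 3) = P (.inl 3) ∧
      P' (.inl 4) = P (.inl 2) + (P (.inl 3) - P (.inl 2)) / 2 := by
  have h3 := hP (.inl 3)
  obtain ⟨P₁, hr₁, hP₁⟩ := runs_eq 2 3 P r [] hP
  have hl₁ := hr₁.le hP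
  obtain ⟨P₂, r₂, hr₂, hv₂, hP₂⟩ := runs_search (φ := midFormula) (v := 4) (by decide)
    (by decide) (by decide) P₁ (decide (P (.inl 2) = P (.inl 3))) [] hl₁
    (n := P (.inl 2) + (P (.inl 3) - P (.inl 2)) / 2) (by omega)
    (fun m hm => by
      rw [midFormula_holds (by simpa [hP₁] using h) (by simpa [hP₁] using h3)]
      simp [hP₁])
  have hl₂ := hr₂.le hl₁
  obtain ⟨P₃, r₃, hr₃, hP₃⟩ := runs_emitQuery (z := (0 : Fin 7)) (p := 1) (k := 4) (by decide)
    (by decide) (by decide) false id P₂ r₂ [] hl₂ (by omega)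
  rw [hv₂, List.map_id, List.append_nil] at hr₃
  refine ⟨P₃, r₃, (hr₁.phaseRuns 1).seq (phaseRuns_iteRes (by simp [h.ne])
    ((hr₂.phaseRuns 1).seq (hr₃.phaseRuns 1))), hr₃.le hl₂, ?_, ?_, ?_⟩
  · rw [hP₃ 2 (by decide) (by decide), hP₂ 2 (by decide) (by decide), hP₁]
  · rw [hP₃ 3 (by decide) (by decide), hP₂ 3 (by decide) (by decide), hP₁]
  · rw [hP₃ 4 (by decide) (by decide), hv₂]

/-- A state at the beginning of a round from which the search continues between `l` and `h`. -/
def Searching (u : List Bool) (l h : ℕ) (s : St Flags (Fin 7 ⊕ Fin 4) (Bool × Bool × Bool)) :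
    Prop :=
  s.var.phase ≠ 2 ∧ ∃ P r a, Exec u updateInterval s (Core.st ⟨P, r, []⟩ a 1) ∧
    (∀ h, P h ≤ u.length) ∧ P (.inl 2) = l ∧ P (.inl 3) = h

theorem searching_start : Searching u 0 u.length (startSt ⟨false, false, 0⟩ u) := by
  refine ⟨by simp [startSt], ?_⟩
  obtain ⟨a, h⟩ := ((runs_rewind (Sum.inl 2 : Fin 7 ⊕ Fin 4) (fun _ => u.length) false []).phaseRuns 0).seq
    (phaseRuns_setPhase _ _ _) false (u := u)
  refine ⟨_, _, a, .iteTrue rfl h, (runs_rewind (Ω := Bool) (u := u) (Sum.inl 2 : Fin 7 ⊕ Fin 4) _ false []).le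
    fun _ => le_rfl, by simp, by simp⟩

/-- A positive answer at the midpoint puts the threshold strictly above it, hence the new lower end
is its successor. After a negative answer the midpoint itself becomes the upper end. -/
theorem searching_yes {P : Fin 7 ⊕ Fin 4 → ℕ} {a : Bool} (hP : ∀ h, P h ≤ u.length)
    (hm : P (.inl 4) < u.length) :
    Searching u (P (.inl 4) + 1) (P (.inl 3)) ⟨⟨true, a, 1⟩, P, []⟩ := by
  refine ⟨by simp, ?_⟩
  obtain ⟨P₁, r₁, hr₁, hv₁, hP₁⟩ := runs_search (φ := .succ (4 : Fin 7) 2) (v := 2) trivial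
    (by decide) (by decide) P true [] hP (n := P (.inl 4) + 1) (by omega)
    (fun m hm => by
      rw [Formula.holds_succ]
      simp [eq_comm])
  obtain ⟨a', h⟩ := hr₁ a 1
  exact ⟨P₁, r₁, a', .iteFalse (by simp) (.iteTrue rfl h), hr₁.le hP, hv₁,
    hP₁ 3 (by decide) (by decide)⟩

theorem searching_no {P : Fin 7 ⊕ Fin 4 → ℕ} {a : Bool} (hP : ∀ h, P h ≤ u.length) :
    Searching u (P (.inl 2)) (P (.inl 4)) ⟨⟨false, a, 1⟩, P, []⟩ := by
  refine ⟨by simp, ?_⟩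
  obtain ⟨P₁, r₁, hr₁, hv₁, hP₁⟩ := runs_search (φ := .eq (4 : Fin 7) 3) (v := 3) trivial
    (by decide) (by decide) P false [] hP (n := P (.inl 4)) (hP _)
    (fun m hm => by
      rw [Formula.holds_eq]
      simp [eq_comm])
  obtain ⟨a', h⟩ := hr₁ a 1
  exact ⟨P₁, r₁, a', .iteFalse (by simp) (.iteFalse rfl h), hr₁.le hP,
    hP₁ 2 (by decide) (by decide), hv₁⟩

-- Strong induction on the width `w` of the interval that contains the threshold `K`. A query at `l
-- + w / 2` leaves an interval of width `w - w / 2 - 1` or `w / 2`, at most `w / 2` in either case.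
-- At width `0` the threshold is known, and at most one query, of the other kind, remains.
open Classical in
theorem rounds_searching {A : Language (Bool × Bool × Bool)} {K : ℕ}
    (hK : ∀ k < u.length, query u false k ∈ A ↔ k < K) (w : ℕ) :
    ∀ l h s, Searching u l h s → h = l + w → l ≤ K → K ≤ h → ∃ q s',
      Rounds u searchRound (fun f => f.phase == 3) (fun f b => { f with res := b }) A s q s' ∧
      (s'.var.res = true ↔ 0 < K ∧ query u true (K - 1) ∉ A) ∧
      q ≤ if w = 0 then 1 else Nat.log 2 w + 2 := by
  induction w using Nat.strong_induction_on with
  | _ w ih =>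
  rintro l h s ⟨hph, P, r, a, he, hP, rfl, rfl⟩ hw hl hh
  have hph' : (s.var.phase == 2) = false := by simpa using hph
  rcases Nat.eq_zero_or_pos w with rfl | hw0
  · have hK3 : P (.inl 3) = K := by omega
    have hK2 : P (.inl 2) = K := by omega
    cases K with
    | zero =>
      obtain ⟨P', hr⟩ := askNext_reject (r := r) hP hK2 hK3
      obtain ⟨a', hr⟩ := hr a
      exact ⟨0, _, .done (.iteFalse hph' (.seq he hr)) rfl, by simp [Core.st], by simp⟩
    | succ k =>
      obtain ⟨P', r', hr⟩ := askNext_final (r := r) hP hK2 hK3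
      obtain ⟨a', hr⟩ := hr a
      -- After the final query, the next round only inverts the answer: the word is accepted if not
      -- every vertex can be avoided.
      refine ⟨1, _, .ask (.iteFalse hph' (.seq he hr)) rfl
        (.done (.iteTrue rfl (.seq (.op _ _) (.op _ _))) rfl), ?_, by simp⟩
      simp [Op.apply, Core.st]
      exact decide_eq_false_iff_not
  · obtain ⟨P', r', hr, hP', h2, h3, h4⟩ := askNext_search (r := r) hP (by omega)
    obtain ⟨a', hr⟩ := hr a
    have hlen := hP (.inl 3)
    have hmlt : P (.inl 2) + (P (.inl 3) - P (.inl 2)) / 2 < u.length := by omega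
    have hwd : P (.inl 3) - P (.inl 2) = w := by omega
    rw [hwd] at hr h4 hmlt
    -- Halving a width lowers its logarithm by one, which pays for the query just asked.
    have hlog : ∀ w' ≤ w / 2, (if w' = 0 then 1 else Nat.log 2 w' + 2) + 1 ≤ Nat.log 2 w + 2 := by
      intro w' hw'
      split_ifs with h0
      · omega
      · have h1 : Nat.log 2 w' ≤ Nat.log 2 (w / 2) := Nat.log_mono_right hw'
        have h2 : Nat.log 2 (w / 2) = Nat.log 2 w - 1 := Nat.log_div_base 2 w
        have h3 : 0 < Nat.log 2 w := Nat.log_pos (by omega) (by omega)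
        omega
    by_cases hA : query u false (P (.inl 2) + w / 2) ∈ A
    · have hmK := (hK _ hmlt).1 hA
      have hs := searching_yes (a := a') hP' (by omega)
      obtain ⟨q, s', hrs, hres, hq⟩ := ih (w - w / 2 - 1) (by omega) _ _ _ hs (by omega)
        (by omega) (by omega)
      refine ⟨q + 1, s', .ask (.iteFalse hph' (.seq he hr)) rfl ?_, hres, ?_⟩
      · simpa [Core.st, hA] using hrs
      · rw [if_neg hw0.ne']
        have := hlog (w - w / 2 - 1) (by omega)
        omega
    · have hmK : ¬ P (.inl 2) + w / 2 < K := fun h => hA ((hK _ hmlt).2 h)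
      have hs := searching_no (a := a') hP'
      obtain ⟨q, s', hrs, hres, hq⟩ := ih (w / 2) (by omega) _ _ _ hs (by omega)
        (by omega) (by omega)
      refine ⟨q + 1, s', .ask (.iteFalse hph' (.seq he hr)) rfl ?_, hres, ?_⟩
      · simpa [Core.st, hA] using hrs
      · rw [if_neg hw0.ne']
        have := hlog (w / 2) le_rfl
        omega

open Classical in
theorem inThetaTwoP_of_query {L : Language Bool} {A : Language (Bool × Bool × Bool)}
    (hA : InNP A)
    (hL : ∀ u, ∃ K ≤ u.length, (∀ k < u.length, query u false k ∈ A ↔ k < K) ∧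
      (u ∈ L ↔ 0 < K ∧ query u true (K - 1) ∉ A)) :
    InThetaTwoP L := by
  refine inThetaTwoP_of_rounds hA searchRound ⟨false, false, 0⟩ (fun f => f.phase == 3) Flags.res
    -- The constant `2` covers the bound `log n + 2` and also the single query allowed for `n = 0`.
    (fun f b => { f with res := b }) 2 fun u => ?_
  obtain ⟨K, hKu, hK, hu⟩ := hL u
  obtain ⟨q, s, hr, hres, hq⟩ := rounds_searching hK u.length 0 u.length _ searching_start
    (by omega) (by omega) hKu
  refine ⟨q, s, hr, ?_, ?_⟩
  · rw [Bool.eq_iff_iff, hres, decide_eq_true_iff, hu]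
  · split_ifs at hq <;> omega

end Adaptive

end HeadMachine

/-! ### The NP verifier as a formula -/

namespace HeadMachine

section Verifier

/-- The alphabet of words that consist of a query and a certificate. -/
abbrev Letter := (Bool × Bool × Bool) ⊕ Bool

/-- A letter of the query with the given bit. -/
def bitIs (b : Bool) : Letter → Bool
  | .inl c => c.1 == b
  | .inr _ => false

/-- A marked letter of the query. -/
def isMarked : Letter → Bool
  | .inl c => c.2.1
  | .inr _ => false

/-- A letter of a query about paths that avoid a vertex. -/
def isAvoiding : Letter → Bool
  | .inl c => c.2.2
  | .inr _ => false

/-- A certificate letter `true`. -/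
def isCert : Letter → Bool
  | .inl _ => false
  | .inr b => b

/-- The letter of `W` at the position `p` exists and satisfies `c`. -/
def At (W : List Letter) (c : Letter → Bool) (p : ℕ) : Prop := ∃ a, W[p]? = some a ∧ c a = true

theorem At.lt {W : List Letter} {c : Letter → Bool} {p : ℕ} (h : At W c p) : p < W.length := by
  obtain ⟨a, ha, -⟩ := h
  exact (List.getElem?_eq_some_iff.1 ha).1

theorem Term.val_var {V : Type} (e : V → ℕ) (v : V) : (Term.var v).val e = e v := rfl

theorem Term.val_const {V : Type} (e : V → ℕ) (c : ℕ) : (Term.const c : Term V).val e = c := rfl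

/-- Formulas of the verifier. The variable `0` is the length of the query, the variable `1` is
the number of vertices, and the variables `8` and `9` are auxiliary. -/
abbrev VFormula := Formula Letter (Fin 10)

namespace VFormula

variable {W : List Letter} {e : Fin 10 → ℕ}

theorem holds_letter (v : Fin 10) (c : Letter → Bool) :
    Formula.Holds W (.letter v c) e ↔ At W c (e v) := Iff.rfl

theorem holds_and (φ ψ : VFormula) : Formula.Holds W (.and φ ψ) e ↔ φ.Holds W e ∧ ψ.Holds W e :=
  Iff.rfl

theorem holds_not (φ : VFormula) : Formula.Holds W (.not φ) e ↔ ¬ φ.Holds W e := Iff.rfl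

theorem holds_ex (v : Fin 10) (φ : VFormula) :
    Formula.Holds W (.ex v φ) e ↔ ∃ i < W.length, φ.Holds W (Function.update e v i) := Iff.rfl

theorem holds_arith (t₁ t₂ t₃ : Term (Fin 10)) (v : Fin 10) :
    Formula.Holds W (.arith t₁ t₂ t₃ v) e ↔ t₁.val e * t₂.val e + t₃.val e = e v := Iff.rfl

/-- `i` is a vertex. Vertices are numbered from one. -/
def vertex (i : Fin 10) : VFormula := .and (.ex 8 (.succ 8 i)) (.le 8 i 1)

theorem holds_vertex {i : Fin 10} (hi : i ≠ 8) (h : e 1 < W.length) :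
    (vertex i).Holds W e ↔ 1 ≤ e i ∧ e i ≤ e 1 := by
  rw [vertex, Formula.Holds, Formula.holds_le hi (by decide) h]
  simp only [Formula.Holds, Formula.holds_succ, Function.update_self, Function.update_of_ne hi]
  exact and_congr_left fun h' => ⟨fun ⟨z, _, hz⟩ => by omega, fun h => ⟨e i - 1, by omega, by omega⟩⟩

/-- The vertices `i` and `j` are adjacent. -/
def adj (i j : Fin 10) : VFormula :=
  .ex 8 (.and (.arith (.var i) (.var 1) (.var j) 8) (.letter 8 (bitIs true)))

/-- Numbering the vertices from one absorbs the prefix of `n + 1` letters of the encoding: the entry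
of `i` and `j` is at the position `i * n + j`. -/
theorem holds_adj {i j : Fin 10} (hi : i ≠ 8) (hj : j ≠ 8) :
    (adj i j).Holds W e ↔ At W (bitIs true) (e i * e 1 + e j) := by
  simp only [adj, Formula.Holds, Term.val, Function.update_self, Function.update_of_ne hi,
    Function.update_of_ne hj, Function.update_of_ne (show (1 : Fin 10) ≠ 8 by decide)]
  exact ⟨fun ⟨z, _, hz, h⟩ => hz ▸ h, fun h => ⟨_, At.lt h, rfl, h⟩⟩

/-- The certificate contains the triple `(t, i, j)`. -/
def cert (t : Term (Fin 10)) (i j : Fin 10) : VFormula :=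
  .ex 8 (.and (.arith t (.var 0) (.var i) 8)
    (.ex 9 (.and (.arith (.var 8) (.var 0) (.var j) 9) (.letter 9 isCert))))

/-- The triple is read as a number in base `e 0`, computed in two stages. The intermediate value is
at most the final position because the base is positive, so it is in the range of the quantifier. -/
theorem holds_cert {t : Term (Fin 10)} {i j : Fin 10} (ht : 8 ∉ t.vars) (hi : i ≠ 8)
    (hj : j ≠ 8) (hj' : j ≠ 9) (h : 0 < e 0) :
    (cert t i j).Holds W e ↔ At W isCert ((t.val e * e 0 + e i) * e 0 + e j) := by
  have hte : ∀ z, t.val (Function.update e 8 z) = t.val e := fun z =>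
    Term.val_congr fun v hv => Function.update_of_ne (fun h => ht (by rwa [← h])) _ _
  simp only [cert, Formula.Holds, hte, Term.val_var, Function.update_self, Function.update_of_ne hi,
    Function.update_of_ne hj, Function.update_of_ne hj',
    Function.update_of_ne (show (0 : Fin 10) ≠ 8 by decide),
    Function.update_of_ne (show (0 : Fin 10) ≠ 9 by decide),
    Function.update_of_ne (show (8 : Fin 10) ≠ 9 by decide)]
  constructor
  · rintro ⟨z, _, rfl, z', _, rfl, h⟩
    exact h
  · intro h'
    refine ⟨_, ?_, rfl, _, At.lt h', rfl, h'⟩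
    have := At.lt h'
    have := Nat.le_mul_of_pos_right (t.val e * e 0 + e i) h
    omega

/-- All vertices satisfy `φ`. -/
def allV (i : Fin 10) (φ : VFormula) : VFormula := .all i (.imp (vertex i) φ)

/-- Some vertex satisfies `φ`. -/
def exV (i : Fin 10) (φ : VFormula) : VFormula := .ex i (.and (vertex i) φ)

theorem holds_allV {i : Fin 10} {φ : VFormula} (hi : i ≠ 8) (hi' : i ≠ 1) (h : e 1 < W.length) :
    (allV i φ).Holds W e ↔ ∀ a, 1 ≤ a → a ≤ e 1 → φ.Holds W (Function.update e i a) := by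
  have h1 : ∀ a, Function.update e i a 1 = e 1 := fun a => Function.update_of_ne hi'.symm _ _
  rw [allV, Formula.holds_all]
  refine forall_congr' fun a => ?_
  rw [Formula.holds_imp, holds_vertex hi (by rwa [h1]), h1, Function.update_self]
  exact ⟨fun H h₁ h₂ => H (by omega) ⟨h₁, h₂⟩, fun H _ h' => H h'.1 h'.2⟩

theorem holds_exV {i : Fin 10} {φ : VFormula} (hi : i ≠ 8) (hi' : i ≠ 1) (h : e 1 < W.length) :
    (exV i φ).Holds W e ↔ ∃ a, 1 ≤ a ∧ a ≤ e 1 ∧ φ.Holds W (Function.update e i a) := by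
  have h1 : ∀ a, Function.update e i a 1 = e 1 := fun a => Function.update_of_ne hi'.symm _ _
  rw [exV, Formula.Holds]
  refine exists_congr fun a => ?_
  rw [Formula.Holds, holds_vertex hi (by rwa [h1]), h1, Function.update_self]
  exact ⟨fun H => ⟨H.2.1.1, H.2.1.2, H.2.2⟩, fun H => ⟨by omega, ⟨H.1, H.2.1⟩, H.2.2⟩⟩

/-- All marked positions satisfy `φ`. -/
def allM (i : Fin 10) (φ : VFormula) : VFormula := .all i (.imp (.letter i isMarked) φ)

theorem holds_allM {i : Fin 10} {φ : VFormula} :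
    (allM i φ).Holds W e ↔ ∀ a, At W isMarked a → φ.Holds W (Function.update e i a) := by
  rw [allM, Formula.holds_all]
  refine forall_congr' fun a => ?_
  rw [Formula.holds_imp, Formula.Holds, Function.update_self]
  exact ⟨fun H h => H (At.lt h) h, fun H _ h => H h⟩

/-- The word has the form of an adjacency matrix of a graph with a positive number of vertices. -/
def wellFormed : VFormula :=
  .and (.letter 1 (bitIs false)) <| .and (.ex 8 (.succ 8 1)) <|
  .and (.all 2 (.imp (.le 8 2 1) (.or (.eq 2 1) (.letter 2 (bitIs true))))) <|
  .and (.ex 2 (.and (.succ 1 2) (.arith (.var 1) (.var 1) (.var 2) 0))) <|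
  .and (allV 2 (allV 3 (.imp (adj 2 3) (adj 3 2)))) (allV 2 (.not (adj 2 2)))

/-- The certificate contains the distances from the vertex `1`, increased by one. -/
def distances : VFormula :=
  .and (allV 2 (exV 3 (cert (.const 0) 2 3))) <|
  allV 2 <| allV 3 <| .imp (cert (.const 0) 2 3) <| .or (.arith (.const 0) (.const 0) (.const 1) 2) <|
    exV 4 <| exV 5 <| .and (.succ 5 3) <| .and (cert (.const 0) 4 5) (adj 4 2)

/-- For every vertex, the certificate contains a path, as long as there are marks, which avoids
the vertex if required. -/
def paths : VFormula :=
  allV 2 <| .and (allM 3 (exV 4 (cert (.var 2) 3 4))) <|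
  .and (allM 3 <| allM 4 <| .imp (.succ 3 4) <| allV 5 <| allV 6 <|
    .imp (cert (.var 2) 3 5) <| .imp (cert (.var 2) 4 6) (adj 5 6)) <|
  .and (allM 3 <| allM 4 <| allV 5 <|
    .imp (cert (.var 2) 3 5) <| .imp (cert (.var 2) 4 5) (.eq 3 4))
  (allM 3 <| .imp (.letter 3 isAvoiding) (.not (cert (.var 2) 3 2)))

/-- The formula that defines the language of the queries together with their certificates. -/
def verifier : VFormula :=
  .ex 0 <| .and (.and (.letter 0 Sum.isRight) (.ex 8 (.and (.succ 8 0) (.letter 8 Sum.isLeft)))) <|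
    .ex 1 <| .and wellFormed (.and distances paths)

theorem tidy_verifier : verifier.Tidy := by decide
theorem free_verifier : verifier.free = ∅ := by decide

/-- The meaning of `wellFormed` for a query of length `M` and `n` vertices. -/
structure WellFormed (W : List Letter) (M n : ℕ) : Prop where
  sep : At W (bitIs false) n
  pos : 0 < n
  unary : ∀ i < n, At W (bitIs true) i
  size : n * n + (n + 1) = M
  symm : ∀ i, 1 ≤ i → i ≤ n → ∀ j, 1 ≤ j → j ≤ n → At W (bitIs true) (i * n + j) →
    At W (bitIs true) (j * n + i)
  loopless : ∀ i, 1 ≤ i → i ≤ n → ¬ At W (bitIs true) (i * n + i)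

/-- The meaning of `distances` for a query of length `M` and `n` vertices. -/
structure Distances (W : List Letter) (M n : ℕ) : Prop where
  total : ∀ i, 1 ≤ i → i ≤ n → ∃ r, 1 ≤ r ∧ r ≤ n ∧ At W isCert (i * M + r)
  step : ∀ i, 1 ≤ i → i ≤ n → ∀ r, 1 ≤ r → r ≤ n → At W isCert (i * M + r) →
    1 = i ∨ ∃ j, 1 ≤ j ∧ j ≤ n ∧ ∃ s, 1 ≤ s ∧ s ≤ n ∧ s + 1 = r ∧
      At W isCert (j * M + s) ∧ At W (bitIs true) (j * n + i)

/-- The meaning of `paths` for a query of length `M`, `n` vertices, and the vertex `v`. -/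
structure AvoidingPath (W : List Letter) (M n v : ℕ) : Prop where
  total : ∀ i, At W isMarked i → ∃ a, 1 ≤ a ∧ a ≤ n ∧ At W isCert ((v * M + i) * M + a)
  adj : ∀ i, At W isMarked i → ∀ j, At W isMarked j → i + 1 = j → ∀ a, 1 ≤ a → a ≤ n →
    ∀ b, 1 ≤ b → b ≤ n → At W isCert ((v * M + i) * M + a) →
    At W isCert ((v * M + j) * M + b) → At W (bitIs true) (a * n + b)
  inj : ∀ i, At W isMarked i → ∀ j, At W isMarked j → ∀ a, 1 ≤ a → a ≤ n →
    At W isCert ((v * M + i) * M + a) → At W isCert ((v * M + j) * M + a) → i = j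
  avoid : ∀ i, At W isMarked i → At W isAvoiding i → ¬ At W isCert ((v * M + i) * M + v)

theorem wellFormed_iff {M n : ℕ} : WellFormed W M n ↔
    At W (bitIs false) n ∧ 0 < n ∧ (∀ i < n, At W (bitIs true) i) ∧ n * n + (n + 1) = M ∧
      (∀ i, 1 ≤ i → i ≤ n → ∀ j, 1 ≤ j → j ≤ n → At W (bitIs true) (i * n + j) →
        At W (bitIs true) (j * n + i)) ∧
      ∀ i, 1 ≤ i → i ≤ n → ¬ At W (bitIs true) (i * n + i) :=
  ⟨fun ⟨h₁, h₂, h₃, h₄, h₅, h₆⟩ => ⟨h₁, h₂, h₃, h₄, h₅, h₆⟩,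
    fun ⟨h₁, h₂, h₃, h₄, h₅, h₆⟩ => ⟨h₁, h₂, h₃, h₄, h₅, h₆⟩⟩

theorem distances_iff {M n : ℕ} : Distances W M n ↔
    (∀ i, 1 ≤ i → i ≤ n → ∃ r, 1 ≤ r ∧ r ≤ n ∧ At W isCert (i * M + r)) ∧
      ∀ i, 1 ≤ i → i ≤ n → ∀ r, 1 ≤ r → r ≤ n → At W isCert (i * M + r) →
        1 = i ∨ ∃ j, 1 ≤ j ∧ j ≤ n ∧ ∃ s, 1 ≤ s ∧ s ≤ n ∧ s + 1 = r ∧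
          At W isCert (j * M + s) ∧ At W (bitIs true) (j * n + i) :=
  ⟨fun ⟨h₁, h₂⟩ => ⟨h₁, h₂⟩, fun ⟨h₁, h₂⟩ => ⟨h₁, h₂⟩⟩

theorem avoidingPath_iff {M n v : ℕ} : AvoidingPath W M n v ↔
    (∀ i, At W isMarked i → ∃ a, 1 ≤ a ∧ a ≤ n ∧ At W isCert ((v * M + i) * M + a)) ∧
      (∀ i, At W isMarked i → ∀ j, At W isMarked j → i + 1 = j → ∀ a, 1 ≤ a → a ≤ n →
        ∀ b, 1 ≤ b → b ≤ n → At W isCert ((v * M + i) * M + a) →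
        At W isCert ((v * M + j) * M + b) → At W (bitIs true) (a * n + b)) ∧
      (∀ i, At W isMarked i → ∀ j, At W isMarked j → ∀ a, 1 ≤ a → a ≤ n →
        At W isCert ((v * M + i) * M + a) → At W isCert ((v * M + j) * M + a) → i = j) ∧
      ∀ i, At W isMarked i → At W isAvoiding i → ¬ At W isCert ((v * M + i) * M + v) :=
  ⟨fun ⟨h₁, h₂, h₃, h₄⟩ => ⟨h₁, h₂, h₃, h₄⟩, fun ⟨h₁, h₂, h₃, h₄⟩ => ⟨h₁, h₂, h₃, h₄⟩⟩

theorem holds_wellFormed (h : e 0 < W.length) (h1 : e 1 < W.length) :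
    wellFormed.Holds W e ↔ WellFormed W (e 0) (e 1) := by
  rw [wellFormed_iff]
  simp only [wellFormed, holds_and, holds_ex, holds_letter, Formula.holds_all, Formula.holds_imp, Formula.holds_or]
  refine and_congr Iff.rfl (and_congr ?_ (and_congr ?_ (and_congr ?_ (and_congr ?_ ?_))))
  · simp [Formula.holds_succ]
    exact ⟨fun ⟨z, _, hz⟩ => by omega, fun h' => ⟨e 1 - 1, by omega, by omega⟩⟩
  · simp [Formula.holds_le, Formula.holds_eq, h1]
    refine forall_congr' fun i => ⟨fun H hi => (H (by omega) (by omega)).resolve_left (by omega),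
      fun H hi hi' => ?_⟩
    rcases hi'.lt_or_eq with h | h
    · exact .inr (H h)
    · exact .inl h
  · simp [Formula.holds_succ, holds_arith, Term.val]
    omega
  · simp [holds_allV, holds_adj, h1, Formula.holds_imp]
  · simp [holds_allV, holds_adj, h1, holds_not]

theorem holds_distances (h : e 1 < W.length) (h0 : 0 < e 0) :
    distances.Holds W e ↔ Distances W (e 0) (e 1) := by
  rw [distances_iff]
  simp [distances, holds_and, holds_arith, holds_allV, holds_exV, holds_adj, holds_cert, h, h0,
    Formula.holds_imp, Formula.holds_or, Formula.holds_succ, Term.vars, Term.val_const]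

theorem holds_paths (h : e 1 < W.length) (h0 : 0 < e 0) :
    paths.Holds W e ↔ ∀ v, 1 ≤ v → v ≤ e 1 → AvoidingPath W (e 0) (e 1) v := by
  simp only [avoidingPath_iff]
  simp [paths, holds_and, holds_not, holds_letter, holds_allV, holds_exV, holds_allM, holds_adj, holds_cert, h, h0,
    Formula.holds_imp, Formula.holds_eq, Formula.holds_succ, Term.vars, Term.val_var]

/-- The number `M` is the border between query and certificate, and `n` is the position of the first
`false`. That these two quantifiers range only over positions costs nothing, since the stated
properties already place `M` and `n` on the word. -/
theorem holds_verifier : verifier.Holds W e ↔ ∃ M n, At W Sum.isRight M ∧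
    (∃ m, m + 1 = M ∧ At W Sum.isLeft m) ∧ WellFormed W M n ∧ Distances W M n ∧
      ∀ v, 1 ≤ v → v ≤ n → AvoidingPath W M n v := by
  have key : ∀ M n, 0 < M → M < W.length → n < W.length →
      ((VFormula.wellFormed.and (distances.and paths)).Holds W
        (Function.update (Function.update e 0 M) 1 n) ↔ WellFormed W M n ∧ Distances W M n ∧
      ∀ v, 1 ≤ v → v ≤ n → AvoidingPath W M n v) := by
    intro M n hM hMW hn
    rw [Formula.Holds, Formula.Holds, holds_wellFormed hMW hn, holds_distances hn hM,
      holds_paths hn hM]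
    rfl
  rw [verifier, Formula.Holds]
  refine exists_congr fun M => ⟨?_, ?_⟩
  · rintro ⟨hM, ⟨h₁, m, hm, h₂, h₃⟩, n, hn, H⟩
    have h₂ : m + 1 = M := by rwa [Formula.holds_succ] at h₂
    exact ⟨n, h₁, ⟨m, h₂, h₃⟩, (key M n (by omega) hM hn).1 H⟩
  · rintro ⟨n, h₁, ⟨m, h₂, h₃⟩, H⟩
    have hn := At.lt H.1.sep
    refine ⟨At.lt h₁, ⟨h₁, m, At.lt h₃, ?_, h₃⟩, n, hn, (key M n (by omega) (At.lt h₁) hn).2 H⟩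
    rw [Formula.holds_succ]
    exact h₂

end VFormula

end Verifier

end HeadMachine

/-! ### Longest paths and Gallai vertices -/

section LongestPaths

variable {V : Type*} {G : SimpleGraph V}

/-- The first `k + 1` terms of the sequence `f` are the vertices of a path. -/
def IsPathSeq (G : SimpleGraph V) (k : ℕ) (f : ℕ → V) : Prop :=
  (∀ i < k, G.Adj (f i) (f (i + 1))) ∧ Set.InjOn f (Set.Iic k)

/-- The walk grows by one edge at its end; injectivity of `f` keeps the new vertex off the support.
-/
theorem IsPathSeq.exists_walk {k : ℕ} {f : ℕ → V} (h : IsPathSeq G k f) :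
    ∃ p : G.Walk (f 0) (f k), p.IsPath ∧ p.length = k ∧ ∀ a ∈ p.support, ∃ i ≤ k, f i = a := by
  induction k with
  | zero => exact ⟨.nil, .nil, rfl, fun a ha => ⟨0, le_rfl, (by simpa using ha : a = f 0).symm⟩⟩
  | succ k ih =>
    obtain ⟨p, hp, hl, hs⟩ := ih ⟨fun i hi => h.1 i (by omega),
      h.2.mono (Set.Iic_subset_Iic.2 k.le_succ)⟩
    have hadj := h.1 k k.lt_succ_self
    refine ⟨p.concat hadj, hp.concat (fun hmem => ?_) hadj, by simp [hl], fun a ha => ?_⟩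
    · obtain ⟨i, hi, he⟩ := hs _ hmem
      have := h.2 (Set.mem_Iic.2 (hi.trans k.le_succ)) (Set.mem_Iic.2 le_rfl) he
      omega
    · rw [SimpleGraph.Walk.support_concat, List.mem_append, List.mem_singleton] at ha
      rcases ha with ha | rfl
      · obtain ⟨i, hi, he⟩ := hs a ha
        exact ⟨i, hi.trans k.le_succ, he⟩
      · exact ⟨k + 1, le_rfl, rfl⟩

theorem isPathSeq_getVert {a b : V} {p : G.Walk a b} (hp : p.IsPath) {k : ℕ} (hk : k ≤ p.length) :
    IsPathSeq G k p.getVert :=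
  ⟨fun _ hi => p.adj_getVert_succ (hi.trans_le hk),
    hp.getVert_injOn.mono fun _ hi => (Set.mem_Iic.1 hi).trans hk⟩

theorem hasPathOfLengthGE_iff {k : ℕ} : HasPathOfLengthGE G k ↔ ∃ f, IsPathSeq G k f := by
  constructor
  · rintro ⟨a, b, p, hp, hk⟩
    exact ⟨_, isPathSeq_getVert hp hk⟩
  · rintro ⟨f, hf⟩
    obtain ⟨p, hp, hl, -⟩ := hf.exists_walk
    exact ⟨_, _, p, hp, hl.ge⟩

theorem hasPathOfLengthGE_deleteVertex_iff {v : V} {k : ℕ} :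
    HasPathOfLengthGE (deleteVertex G v) k ↔ ∃ f, IsPathSeq G k f ∧ ∀ i ≤ k, f i ≠ v := by
  rw [hasPathOfLengthGE_iff]
  constructor
  · rintro ⟨f, hf, hi⟩
    exact ⟨fun i => f i, ⟨fun i h => hf i h, fun i h j h' e => hi h h' (Subtype.ext e)⟩,
      fun i _ => (f i).2⟩
  · rintro ⟨f, ⟨hf, hi⟩, hv⟩
    -- The terms of `f` beyond `k` could be `v`, so the sequence is made constant from `k` on to get
    -- values in `G - v`.
    refine ⟨fun i => ⟨f (min i k), hv _ (min_le_right _ _)⟩, fun i h => ?_, fun i h j h' e => ?_⟩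
    · change G.Adj (f (min i k)) (f (min (i + 1) k))
      rw [min_eq_left h.le, min_eq_left h]
      exact hf i h
    · have := congrArg Subtype.val e
      simp only [min_eq_left (Set.mem_Iic.1 h), min_eq_left (Set.mem_Iic.1 h')] at this
      exact hi h h' this

theorem HasPathOfLengthGE.mono {k l : ℕ} (h : HasPathOfLengthGE G l) (hkl : k ≤ l) :
    HasPathOfLengthGE G k := by
  obtain ⟨a, b, p, hp, hl⟩ := h
  exact ⟨a, b, p, hp, hkl.trans hl⟩

theorem HasPathOfLengthGE.lt_card [Fintype V] {k : ℕ} (h : HasPathOfLengthGE G k) :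
    k < Fintype.card V := by
  obtain ⟨a, b, p, hp, hl⟩ := h
  exact hl.trans_lt hp.length_lt

theorem HasPathOfLengthGE.of_deleteVertex {v : V} {k : ℕ}
    (h : HasPathOfLengthGE (deleteVertex G v) k) : HasPathOfLengthGE G k := by
  obtain ⟨f, hf, -⟩ := hasPathOfLengthGE_deleteVertex_iff.1 h
  exact hasPathOfLengthGE_iff.2 ⟨f, hf⟩

theorem hasPathOfLengthGE_zero (v : V) : HasPathOfLengthGE G 0 := ⟨v, v, .nil, .nil, le_rfl⟩

-- If there is no path, both sides are `⊥`. Otherwise a path with at least `m` edges, for the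
-- maximal such `m`, has exactly `m` edges, so the supremum is attained.
open Classical in
theorem longestPathLength_eq_max {N : ℕ} (hN : ∀ k, HasPathOfLengthGE G k → k ≤ N) :
    longestPathLength G = ((Finset.range (N + 1)).filter fun k => HasPathOfLengthGE G k).max := by
  rcases (((Finset.range (N + 1)).filter fun k => HasPathOfLengthGE G k)).eq_empty_or_nonempty with
    h | h
  · rw [h, Finset.max_empty, longestPathLength]
    suffices hS : {m : WithBot ℕ | ∃ (a b : V) (p : G.Walk a b), p.IsPath ∧
        m = (p.length : WithBot ℕ)} = ∅ by
      rw [hS, WithBot.sSup_empty]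
    rw [Set.eq_empty_iff_forall_notMem]
    rintro m ⟨a, b, p, hp, -⟩
    have : 0 ∈ (Finset.range (N + 1)).filter fun k => HasPathOfLengthGE G k :=
      Finset.mem_filter.2 ⟨by simp, hasPathOfLengthGE_zero a⟩
    simp [h] at this
  · obtain ⟨m, hm⟩ := Finset.max_of_nonempty h
    rw [hm, longestPathLength]
    refine IsGreatest.csSup_eq ⟨?_, ?_⟩
    · obtain ⟨a, b, p, hp, hl⟩ := (Finset.mem_filter.1 (Finset.mem_of_max hm)).2
      have : HasPathOfLengthGE G p.length := ⟨a, b, p, hp, le_rfl⟩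
      have := Finset.le_max_of_eq (Finset.mem_filter.2 ⟨Finset.mem_range_succ_iff.2 (hN _ this), this⟩) hm
      exact ⟨a, b, p, hp, by rw [le_antisymm hl this]; rfl⟩
    · rintro _ ⟨a, b, p, hp, rfl⟩
      have : HasPathOfLengthGE G p.length := ⟨a, b, p, hp, le_rfl⟩
      exact WithBot.coe_le_coe.2 (Finset.le_max_of_eq
        (Finset.mem_filter.2 ⟨Finset.mem_range_succ_iff.2 (hN _ this), this⟩) hm)

theorem le_longestPathLength_iff {N : ℕ} (hN : ∀ k, HasPathOfLengthGE G k → k ≤ N) {k : ℕ} :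
    (k : WithBot ℕ) ≤ longestPathLength G ↔ HasPathOfLengthGE G k := by
  classical
  rw [longestPathLength_eq_max hN]
  constructor
  · intro h
    cases e : ((Finset.range (N + 1)).filter fun k => HasPathOfLengthGE G k).max with
    | bot => rw [e] at h; simp at h
    | coe m =>
      rw [e, ← Nat.cast_withBot, Nat.cast_le] at h
      exact (Finset.mem_filter.1 (Finset.mem_of_max e)).2.mono h
  · intro h
    exact Finset.le_max (Finset.mem_filter.2 ⟨Finset.mem_range_succ_iff.2 (hN _ h), h⟩)

theorem withBot_nat_lt_iff {x y : WithBot ℕ} : x < y ↔ ∃ k : ℕ, ↑k ≤ y ∧ ¬ ↑k ≤ x := by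
  constructor
  · intro h
    cases y with
    | bot => simp at h
    | coe m => exact ⟨m, le_rfl, not_le.2 h⟩
  · rintro ⟨k, h₁, h₂⟩
    exact (not_le.1 h₂).trans_le h₁

variable [Fintype V]

/-- A strict inequality in `WithBot ℕ` is witnessed by a natural number below one side but not the
other; this also covers the value `⊥` of a graph without vertices. -/
theorem longestPathLength_deleteVertex_lt_iff {v : V} :
    longestPathLength (deleteVertex G v) < longestPathLength G ↔
      ∃ k, HasPathOfLengthGE G k ∧ ¬ HasPathOfLengthGE (deleteVertex G v) k := by
  have hN : ∀ k, HasPathOfLengthGE G k → k ≤ Fintype.card V := fun k h => h.lt_card.le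
  simp only [withBot_nat_lt_iff, le_longestPathLength_iff hN,
    le_longestPathLength_iff fun k h => hN k h.of_deleteVertex]

theorem exists_maximal_length (v : V) (G : SimpleGraph V) :
    ∃ m, ∀ k, HasPathOfLengthGE G k ↔ k ≤ m := by
  classical
  have hN : ∀ k, HasPathOfLengthGE G k → k ≤ Fintype.card V := fun k h => h.lt_card.le
  refine ⟨Nat.findGreatest (HasPathOfLengthGE G) (Fintype.card V), fun k =>
    ⟨fun h => Nat.le_findGreatest (hN k h) h, fun h => .mono ?_ h⟩⟩
  exact Nat.findGreatest_spec (Nat.zero_le _) (hasPathOfLengthGE_zero v)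

/-- If `G - v` had a path of the maximal length `m` of `G`, it would be a longest path of `G`
without `v`. Conversely, a longest path that misses `v` is a path of `G - v` and at least as long as
any path of `G`. -/
theorem isGallaiVertex_iff {v : V} : IsGallaiVertex G v ↔
    ∃ k, HasPathOfLengthGE G k ∧ ¬ HasPathOfLengthGE (deleteVertex G v) k := by
  constructor
  · intro h
    obtain ⟨m, hm⟩ := exists_maximal_length v G
    refine ⟨m, (hm m).2 le_rfl, fun hd => ?_⟩
    obtain ⟨f, hf, hv⟩ := hasPathOfLengthGE_deleteVertex_iff.1 hd
    obtain ⟨p, hp, hl, hs⟩ := hf.exists_walk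
    obtain ⟨i, hi, e⟩ := hs v (h _ _ p ⟨hp, fun c d q hq =>
      hl.symm ▸ (hm _).1 ⟨c, d, q, hq, le_rfl⟩⟩)
    exact hv i hi e
  · rintro ⟨k, ⟨c, d, q, hq, hk⟩, hd⟩ a b p hp
    by_contra hv
    refine hd (hasPathOfLengthGE_deleteVertex_iff.2 ⟨_, isPathSeq_getVert hp.1
      (hk.trans (hp.2 c d q hq)), fun i hi e => hv ?_⟩)
    exact e ▸ p.getVert_mem_support i

end LongestPaths

/-! ### Encoding of graphs by words -/

namespace HeadMachine

section Encoding

variable {n : ℕ} (G : SimpleGraph (Fin n))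

open Classical in
theorem encodeGraph_eq : encodeGraph G = List.replicate n true ++
    false :: List.ofFn fun p : Fin (n * n) => decide (G.Adj p.divNat p.modNat) := by
  rw [encodeGraph, List.ofFn_mul, List.flatMap, List.ofFn_eq_map]
  congr 4
  funext i
  rw [List.ofFn_eq_map]
  congr 1
  funext j
  have hn : 0 < n := i.pos
  have h₁ : ((i : ℕ) * n + j) / n = i := by
    rw [mul_comm, Nat.mul_add_div hn, Nat.div_eq_of_lt j.2, add_zero]
  have h₂ : ((i : ℕ) * n + j) % n = j := by
    rw [mul_comm, Nat.mul_add_mod, Nat.mod_eq_of_lt j.2]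
  simp only [Fin.divNat, Fin.modNat, h₁, h₂]

theorem length_encodeGraph : (encodeGraph G).length = n * n + (n + 1) := by
  rw [encodeGraph_eq]
  simp
  omega

theorem getElem?_encodeGraph_of_lt {p : ℕ} (hp : p < n) : (encodeGraph G)[p]? = some true := by
  rw [encodeGraph_eq, List.getElem?_append_left (by simpa using hp)]
  simp [hp]

theorem getElem?_encodeGraph_self : (encodeGraph G)[n]? = some false := by
  rw [encodeGraph_eq, List.getElem?_append_right (by simp)]
  simp

open Classical in
theorem getElem?_encodeGraph_entry (i j : Fin n) :
    (encodeGraph G)[((i : ℕ) + 1) * n + (j + 1)]? = some (decide (G.Adj i j)) := by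
  have hn : 0 < n := i.pos
  have hlt : (i : ℕ) * n + j < n * n := by
    have := Nat.mul_le_mul_right n (Nat.succ_le_of_lt i.2)
    rw [Nat.succ_mul] at this
    omega
  have h₁ : ((i : ℕ) * n + j) / n = i := by
    rw [mul_comm, Nat.mul_add_div hn, Nat.div_eq_of_lt j.2, add_zero]
  have h₂ : ((i : ℕ) * n + j) % n = j := by
    rw [mul_comm, Nat.mul_add_mod, Nat.mod_eq_of_lt j.2]
  rw [encodeGraph_eq, show ((i : ℕ) + 1) * n + (j + 1) = n + (i * n + j + 1) by ring,
    List.getElem?_append_right (by simp), List.length_replicate, Nat.add_sub_cancel_left,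
    List.getElem?_cons_succ, List.getElem?_ofFn, dif_pos hlt]
  simp only [Fin.divNat, Fin.modNat, h₁, h₂]

variable {G}

/-- The positions after the separator are exactly those of the matrix entries, by division with
remainder by `n`. Length, prefix and entries thus fix the word. -/
theorem eq_encodeGraph {x : List Bool} (hl : x.length = n * n + (n + 1))
    (hu : ∀ i < n, x[i]? = some true) (hs : x[n]? = some false)
    (hx : ∀ i j : Fin n, x[((i : ℕ) + 1) * n + (j + 1)]? = some true ↔ G.Adj i j) :
    x = encodeGraph G := by
  classical
  refine List.ext_getElem? fun p => ?_
  rcases lt_trichotomy p n with hp | rfl | hp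
  · rw [hu p hp, getElem?_encodeGraph_of_lt G hp]
  · rw [hs, getElem?_encodeGraph_self]
  · by_cases hpl : p < n * n + (n + 1)
    · obtain ⟨r, rfl⟩ : ∃ r, p = n + 1 + r := ⟨p - (n + 1), by omega⟩
      have hr : r < n * n := by omega
      have hn : 0 < n := Nat.pos_of_ne_zero fun h => by simp [h] at hr
      obtain ⟨i, j, rfl⟩ : ∃ i j : Fin n, r = i * n + j :=
        ⟨⟨r / n, Nat.div_lt_of_lt_mul hr⟩, ⟨r % n, Nat.mod_lt _ hn⟩, (Nat.div_add_mod' r n).symm⟩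
      have he : n + 1 + (i * n + j) = ((i : ℕ) + 1) * n + (j + 1) := by ring
      rw [he] at hpl ⊢
      have hsome := List.getElem?_eq_getElem (hl ▸ hpl)
      have hij := hx i j
      rw [getElem?_encodeGraph_entry]
      rw [hsome, Option.some_inj] at hij ⊢
      rw [Bool.eq_iff_iff, hij, decide_eq_true_iff]
    · rw [List.getElem?_eq_none (by omega), List.getElem?_eq_none (by
        rw [length_encodeGraph]; omega)]

/-- The position of the first `false` is the number of vertices, and then the matrix entries give
the edges. -/
theorem encodeGraph_inj {m : ℕ} {H : SimpleGraph (Fin m)} (h : encodeGraph G = encodeGraph H) :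
    (⟨n, G⟩ : Σ n, SimpleGraph (Fin n)) = ⟨m, H⟩ := by
  classical
  obtain rfl : n = m := by
    rcases lt_trichotomy n m with hl | he | hl
    · have := getElem?_encodeGraph_of_lt H hl
      rw [← h, getElem?_encodeGraph_self] at this
      simp at this
    · exact he
    · have := getElem?_encodeGraph_of_lt G hl
      rw [h, getElem?_encodeGraph_self] at this
      simp at this
  congr 1
  ext i j
  have := getElem?_encodeGraph_entry G i j
  rw [h, getElem?_encodeGraph_entry] at this
  simpa using this.symm

end Encoding

/-! ### Soundness and completeness of the verifier, and the reduction to queries -/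

section Correctness

variable {x : List Bool} {t : Bool} {k : ℕ} {w : List Bool}

theorem length_query : (query x t k).length = x.length := by simp [query]

theorem at_left {c : Letter → Bool} {p : ℕ} (h : p < x.length) :
    At (encodePair (query x t k, w)) c p ↔ c (.inl (x[p], decide (p ≤ k), t)) = true := by
  rw [At, getElem?_encodePair, length_query, if_pos h]
  simp only [query, List.getElem?_mapIdx, List.getElem?_eq_getElem h, Option.map_some,
    Option.some_inj, exists_eq_left']

theorem at_right {c : Letter → Bool} {p : ℕ} (h : x.length ≤ p) :
    At (encodePair (query x t k, w)) c p ↔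
      ∃ b, w[p - x.length]? = some b ∧ c (.inr b) = true := by
  rw [At, getElem?_encodePair, length_query, if_neg (by omega)]
  simp only [Option.map_eq_some_iff, exists_exists_and_eq_and]

theorem at_bitIs {b : Bool} {p : ℕ} :
    At (encodePair (query x t k, w)) (bitIs b) p ↔ x[p]? = some b := by
  rcases lt_or_ge p x.length with h | h
  · rw [at_left h, List.getElem?_eq_getElem h]
    simp [bitIs]
  · rw [at_right h, List.getElem?_eq_none h]
    simp [bitIs]

theorem at_isMarked {p : ℕ} (hk : k < x.length) :
    At (encodePair (query x t k, w)) isMarked p ↔ p ≤ k := by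
  rcases lt_or_ge p x.length with h | h
  · rw [at_left h]
    simp [isMarked]
  · rw [at_right h]
    simp [isMarked]
    omega

theorem at_isAvoiding {p : ℕ} (h : p < x.length) :
    At (encodePair (query x t k, w)) isAvoiding p ↔ t = true := by
  rw [at_left h]
  simp [isAvoiding]

theorem at_isCert {p : ℕ} (h : x.length ≤ p) :
    At (encodePair (query x t k, w)) isCert p ↔ w[p - x.length]? = some true := by
  rw [at_right h]
  simp [isCert]

theorem at_isLeft {p : ℕ} : At (encodePair (query x t k, w)) Sum.isLeft p ↔ p < x.length := by
  rcases lt_or_ge p x.length with h | h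
  · rw [at_left h]
    simp [h]
  · rw [at_right h]
    simp [h]

theorem at_isRight {p : ℕ} :
    At (encodePair (query x t k, w)) Sum.isRight p ↔ x.length ≤ p ∧ p < x.length + w.length := by
  rcases lt_or_ge p x.length with h | h
  · rw [at_left h]
    simp [h]
  · rw [at_right h]
    simp only [Sum.isRight_inr, and_true, h, true_and]
    rw [← Option.isSome_iff_exists, isSome_getElem?_eq, decide_eq_true_iff]
    omega

/-- The word encodes a connected graph which for every vertex `v` has a path with `k` edges, one
without `v` if `t` is `true`. -/
def HasPaths (x : List Bool) (t : Bool) (k : ℕ) : Prop :=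
  ∃ (n : ℕ) (G : SimpleGraph (Fin n)), x = encodeGraph G ∧ G.Connected ∧
    ∀ v, ∃ f, IsPathSeq G k f ∧ (t = true → ∀ i ≤ k, f i ≠ v)

/-- Soundness. The graph is read off the matrix, and the checked conditions hold for every triple in
the certificate, so it does not matter if the certificate lists more than one value where one is
expected. -/
theorem hasPaths_of_verifier {e : Fin 10 → ℕ} (hk : k < x.length)
    (h : VFormula.verifier.Holds (encodePair (query x t k, w)) e) : HasPaths x t k := by
  obtain ⟨M, n, hR, ⟨m, rfl, hL⟩, hW, hD, hP⟩ := VFormula.holds_verifier.1 h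
  rw [at_isRight] at hR
  rw [at_isLeft] at hL
  have hM : m + 1 = x.length := by omega
  rw [hM] at hW hD hP
  have hv : ∀ a, 1 ≤ a → a ≤ n → ∃ i : Fin n, a = i + 1 := fun a h₁ h₂ =>
    ⟨⟨a - 1, by omega⟩, by simp only; omega⟩
  have hv₁ : ∀ i : Fin n, 1 ≤ (i : ℕ) + 1 := fun i => by omega
  have hv₂ : ∀ i : Fin n, (i : ℕ) + 1 ≤ n := fun i => i.2
  let G : SimpleGraph (Fin n) :=
    { Adj := fun i j => x[((i : ℕ) + 1) * n + (j + 1)]? = some true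
      symm := ⟨fun i j hij => at_bitIs.1
        (hW.symm _ (hv₁ i) (hv₂ i) _ (hv₁ j) (hv₂ j) (at_bitIs.2 hij))⟩
      loopless := ⟨fun i hi => hW.loopless _ (hv₁ i) (hv₂ i) (at_bitIs.2 hi)⟩ }
  let o : Fin n := ⟨0, hW.pos⟩
  -- The recorded numbers need not be distances: each one leads to a neighbour with a number smaller
  -- by one, and the descent can only end at the first vertex.
  have hreach : ∀ r, ∀ i : Fin n, 1 ≤ r → r ≤ n →
      At (encodePair (query x t k, w)) isCert ((i + 1) * x.length + r) → G.Reachable o i := by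
    intro r
    induction r using Nat.strong_induction_on with
    | _ r ih =>
    intro i h₁ h₂ hc
    rcases hD.step _ (hv₁ i) (hv₂ i) r h₁ h₂ hc with h0 | ⟨j, hj, hj', s, hs, hs', hsr, hc', ha⟩
    · obtain rfl : i = o := Fin.ext (by simp only [o]; omega)
      exact .refl _
    · obtain ⟨j, rfl⟩ := hv j hj hj'
      exact (ih s (by omega) j hs hs' hc').trans (SimpleGraph.Adj.reachable (at_bitIs.1 ha))
  have hconn : G.Connected := by
    have hro : ∀ i, G.Reachable o i := fun i => by
      obtain ⟨r, h₁, h₂, hc⟩ := hD.total _ (hv₁ i) (hv₂ i)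
      exact hreach r i h₁ h₂ hc
    have : Nonempty (Fin n) := ⟨o⟩
    exact ⟨fun i j => (hro i).symm.trans (hro j)⟩
  refine ⟨n, G, eq_encodeGraph hW.size.symm (fun i hi => at_bitIs.1 (hW.unary i hi))
    (at_bitIs.1 hW.sep) fun i j => Iff.rfl, hconn, fun v => ?_⟩
  have hPv := hP _ (hv₁ v) (hv₂ v)
  -- Any vertex listed at place `i` will do; beyond `k` the value `o` is a dummy.
  have hex : ∀ i, ∃ a : Fin n, i ≤ k → At (encodePair (query x t k, w)) isCert
      (((v + 1) * x.length + i) * x.length + (a + 1)) := by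
    intro i
    by_cases hi : i ≤ k
    · obtain ⟨a, h₁, h₂, hc⟩ := hPv.total i ((at_isMarked hk).2 hi)
      obtain ⟨a, rfl⟩ := hv a h₁ h₂
      exact ⟨a, fun _ => hc⟩
    · exact ⟨o, fun h => absurd h hi⟩
  choose f hf using hex
  refine ⟨f, ⟨fun i hi => ?_, fun i hi j hj hij => ?_⟩, fun ht i hi he => ?_⟩
  · exact at_bitIs.1 (hPv.adj i ((at_isMarked hk).2 hi.le) _ ((at_isMarked hk).2 hi) rfl
      _ (hv₁ _) (hv₂ _) _ (hv₁ _) (hv₂ _) (hf i hi.le) (hf _ hi))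
  · exact hPv.inj i ((at_isMarked hk).2 hi) _ ((at_isMarked hk).2 hj) _ (hv₁ _) (hv₂ _)
      (hf i hi) (hij ▸ hf j hj)
  · exact hPv.avoid i ((at_isMarked hk).2 hi) ((at_isAvoiding (by omega)).2 ht) (he ▸ hf i hi)

open Classical in
/-- The table of a ternary relation on numbers less than `M`, without the first `M` entries. -/
noncomputable def relTable (M : ℕ) (T : ℕ → ℕ → ℕ → Prop) : List Bool :=
  (List.range (M ^ 3)).map fun p => decide (T ((p + M) / M / M) ((p + M) / M % M) ((p + M) % M))

/-- The first `M` positions are occupied by the query, so the table is shifted by `M`. If `a` or `b`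
is positive, the position of the triple is at least `M` and thus on the certificate. -/
theorem at_relTable {T : ℕ → ℕ → ℕ → Prop} {a b c : ℕ} (ha : a < x.length) (hb : b < x.length)
    (hc : c < x.length) (h : 0 < a ∨ 0 < b) :
    At (encodePair (query x t k, relTable x.length T)) isCert
      ((a * x.length + b) * x.length + c) ↔ T a b c := by
  classical
  set M := x.length with hM
  have hM0 : 0 < M := by omega
  have hq : 1 ≤ a * M + b := by
    rcases h with h | h
    · have := Nat.le_mul_of_pos_left M h
      omega
    · omega
  have hle : M ≤ (a * M + b) * M + c := (Nat.le_mul_of_pos_left M hq).trans (Nat.le_add_right _ _)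
  have hlt₁ : a * M + b < M * M := by
    have := Nat.mul_le_mul_right M (Nat.succ_le_of_lt ha)
    rw [Nat.succ_mul] at this
    omega
  have hlt : (a * M + b) * M + c < M ^ 3 := by
    have := Nat.mul_le_mul_right M (Nat.succ_le_of_lt hlt₁)
    rw [Nat.succ_mul] at this
    rw [show M ^ 3 = M * M * M by ring]
    omega
  have h₁ : ((a * M + b) * M + c) / M = a * M + b := by
    rw [mul_comm, Nat.mul_add_div hM0, Nat.div_eq_of_lt hc, add_zero]
  have h₂ : ((a * M + b) * M + c) % M = c := by
    rw [mul_comm, Nat.mul_add_mod, Nat.mod_eq_of_lt hc]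
  have h₃ : (a * M + b) / M = a := by
    rw [mul_comm, Nat.mul_add_div hM0, Nat.div_eq_of_lt hb, add_zero]
  have h₄ : (a * M + b) % M = b := by
    rw [mul_comm, Nat.mul_add_mod, Nat.mod_eq_of_lt hb]
  rw [at_isCert hle, relTable, List.getElem?_map, List.getElem?_range (by omega), Option.map_some,
    ← hM, Nat.sub_add_cancel hle, h₁, h₂, h₃, h₄]
  simp

/-- The certificate for a graph with the given paths. -/
def Triples {n : ℕ} (G : SimpleGraph (Fin n)) (o : Fin n) (f : Fin n → ℕ → Fin n) (a b c : ℕ) :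
    Prop :=
  (a = 0 ∧ ∃ i : Fin n, b = i + 1 ∧ c = G.dist i o + 1) ∨
    ∃ v : Fin n, a = v + 1 ∧ c = f v b + 1

/-- The first component `0` is free for the distances, since vertices are numbered from one. -/
theorem triples_zero {n : ℕ} {G : SimpleGraph (Fin n)} {o : Fin n} {f : Fin n → ℕ → Fin n}
    {i : Fin n} {c : ℕ} : Triples G o f 0 (i + 1) c ↔ c = G.dist i o + 1 := by
  constructor
  · rintro (⟨-, j, hj, h⟩ | ⟨v, hv, -⟩)
    · obtain rfl : i = j := Fin.ext (by omega)
      exact h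
    · omega
  · exact fun h => .inl ⟨rfl, i, rfl, h⟩

theorem triples_succ {n : ℕ} {G : SimpleGraph (Fin n)} {o : Fin n} {f : Fin n → ℕ → Fin n}
    {v : Fin n} {b c : ℕ} : Triples G o f (v + 1) b c ↔ c = f v b + 1 := by
  constructor
  · rintro (⟨h, -⟩ | ⟨j, hj, h⟩)
    · omega
    · obtain rfl : v = j := Fin.ext (by omega)
      exact h
  · exact fun h => .inr ⟨v, rfl, h⟩

theorem _root_.SimpleGraph.Connected.dist_lt_card {V : Type*} [Fintype V] {G : SimpleGraph V}
    (h : G.Connected) (a b : V) : G.dist a b < Fintype.card V := by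
  obtain ⟨p, hp⟩ := (h.preconnected a b).exists_isPath
  exact (SimpleGraph.dist_le p).trans_lt hp.length_lt

theorem _root_.SimpleGraph.Connected.exists_adj_dist {V : Type*} {G : SimpleGraph V}
    (h : G.Connected) {a b : V} (hab : a ≠ b) : ∃ c, G.Adj c a ∧ G.dist c b + 1 = G.dist a b := by
  obtain ⟨p, hp⟩ := h.exists_walk_length_eq_dist a b
  cases p with
  | nil => exact absurd rfl hab
  | @cons _ c _ hac q =>
    refine ⟨c, hac.symm, ?_⟩
    have h₁ := SimpleGraph.dist_le q
    have h₂ := h.dist_triangle (u := a) (v := c) (w := b)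
    have h₃ := SimpleGraph.dist_eq_one_iff_adj.2 hac
    rw [SimpleGraph.Walk.length_cons] at hp
    omega

/-- Completeness, with true distances and one path for each vertex as certificate. Vertices and
distances plus one are at most `n`, and places on a path at most `k`; all are less than `x.length`,
so the triples fit into a table of size `x.length ^ 3`. -/
theorem exists_verifier {e : Fin 10 → ℕ} (hk : k < x.length) (h : HasPaths x t k) :
    ∃ w : List Bool, w.length ≤ x.length ^ 3 ∧
      VFormula.verifier.Holds (encodePair (query x t k, w)) e := by
  classical
  obtain ⟨n, G, hx, hconn, hf⟩ := h
  choose f hf hav using hf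
  have hM : x.length = n * n + (n + 1) := by rw [hx, length_encodeGraph]
  have hnM : n < x.length := by
    have := Nat.zero_le (n * n)
    omega
  have hn : 0 < n := by
    obtain ⟨o⟩ := hconn.nonempty
    exact o.pos
  let o : Fin n := ⟨0, hn⟩
  have hv : ∀ a, 1 ≤ a → a ≤ n → ∃ i : Fin n, a = i + 1 := fun a h₁ h₂ =>
    ⟨⟨a - 1, by omega⟩, by simp only; omega⟩
  have hlen : (relTable x.length (Triples G o f)).length = x.length ^ 3 := by simp [relTable]
  have hadj : ∀ i j : Fin n, x[((i : ℕ) + 1) * n + (j + 1)]? = some true ↔ G.Adj i j := by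
    intro i j
    rw [hx, getElem?_encodeGraph_entry]
    simp
  have hdist : ∀ (i : Fin n) c, c ≤ n →
      (At (encodePair (query x t k, relTable x.length (Triples G o f))) isCert
        ((i + 1) * x.length + c) ↔ c = G.dist i o + 1) := by
    intro i c hc
    have := at_relTable (x := x) (t := t) (k := k) (T := Triples G o f) (a := 0) (b := i + 1)
      (c := c) (by omega) (by omega) (by omega) (.inr (by omega))
    rwa [Nat.zero_mul, Nat.zero_add, triples_zero] at this
  have hpath : ∀ (v : Fin n) b c, b ≤ k → c ≤ n →
      (At (encodePair (query x t k, relTable x.length (Triples G o f))) isCert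
        (((v + 1) * x.length + b) * x.length + c) ↔ c = f v b + 1) := by
    intro v b c hb hc
    rw [at_relTable (by omega) (by omega) (by omega) (.inl (by omega)), triples_succ]
  refine ⟨relTable x.length (Triples G o f), hlen.le, VFormula.holds_verifier.2 ⟨x.length, n,
    at_isRight.2 ⟨le_rfl, ?_⟩, ⟨x.length - 1, by omega, at_isLeft.2 (by omega)⟩, ⟨?_, hn, ?_, hM.symm,
    ?_, ?_⟩, ⟨?_, ?_⟩, ?_⟩⟩
  -- The certificate must be nonempty for `x.length` to be a position on it.
  · have : 0 < x.length ^ 3 := pow_pos (by omega) 3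
    omega
  · exact at_bitIs.2 (hx ▸ getElem?_encodeGraph_self G)
  · exact fun i hi => at_bitIs.2 (hx ▸ getElem?_encodeGraph_of_lt G hi)
  · intro i h₁ h₂ j h₃ h₄ h
    obtain ⟨i, rfl⟩ := hv i h₁ h₂
    obtain ⟨j, rfl⟩ := hv j h₃ h₄
    rw [at_bitIs, hadj] at h ⊢
    exact h.symm
  · intro i h₁ h₂
    obtain ⟨i, rfl⟩ := hv i h₁ h₂
    rw [at_bitIs, hadj]
    exact G.irrefl
  · intro i h₁ h₂
    obtain ⟨i, rfl⟩ := hv i h₁ h₂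
    have := hconn.dist_lt_card i o
    rw [Fintype.card_fin] at this
    exact ⟨G.dist i o + 1, by omega, this, (hdist i _ this).2 rfl⟩
  · intro i h₁ h₂ r h₃ h₄ hc
    obtain ⟨i, rfl⟩ := hv i h₁ h₂
    rw [hdist i r h₄] at hc
    by_cases hi : i = o
    · exact .inl (by rw [hi])
    · obtain ⟨j, hj, hd⟩ := hconn.exists_adj_dist hi
      exact .inr ⟨j + 1, by omega, j.2, G.dist j o + 1, by omega, by omega, by omega,
        (hdist j _ (by omega)).2 rfl, at_bitIs.2 ((hadj j i).2 hj)⟩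
  · intro v h₁ h₂
    obtain ⟨v, rfl⟩ := hv v h₁ h₂
    refine ⟨fun i hi => ?_, fun i hi j hj hij a ha ha' b hb hb' hca hcb => ?_,
      fun i hi j hj a ha ha' hci hcj => ?_, fun i hi ht hc => ?_⟩
    · rw [at_isMarked hk] at hi
      exact ⟨f v i + 1, by omega, (f v i).2, (hpath v i _ hi (f v i).2).2 rfl⟩
    · rw [at_isMarked hk] at hi hj
      rw [hpath v _ _ hi ha'] at hca
      rw [hpath v _ _ hj hb'] at hcb
      subst hca hcb hij
      exact at_bitIs.2 ((hadj _ _).2 ((hf v).1 i hj))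
    · rw [at_isMarked hk] at hi hj
      rw [hpath v _ _ hi ha'] at hci
      rw [hpath v _ _ hj ha'] at hcj
      exact (hf v).2 hi hj (Fin.ext (by omega))
    · rw [at_isMarked hk] at hi
      rw [at_isAvoiding (by omega)] at ht
      rw [hpath v _ _ hi v.2] at hc
      exact hav v ht i hi (Fin.ext (by omega))

/-- The language of all queries about paths whose answer is positive. -/
def pathQueries : Language (Bool × Bool × Bool) :=
  {q | ∃ w : List Bool, w.length ≤ (Polynomial.X ^ 3 : Polynomial ℕ).eval q.length ∧
    VFormula.verifier.Holds (encodePair (q, w)) fun _ => 0}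

theorem inNP_pathQueries : InNP pathQueries :=
  inNP_of_formula VFormula.tidy_verifier VFormula.free_verifier _

theorem query_mem_pathQueries (hk : k < x.length) :
    query x t k ∈ pathQueries ↔ HasPaths x t k := by
  constructor
  · rintro ⟨w, -, h⟩
    exact hasPaths_of_verifier hk h
  · intro h
    obtain ⟨w, hw, h⟩ := exists_verifier hk h
    exact ⟨w, by simpa [length_query] using hw, h⟩

theorem hasPaths_false {n : ℕ} {G : SimpleGraph (Fin n)} (hG : G.Connected) :
    HasPaths (encodeGraph G) false k ↔ HasPathOfLengthGE G k := by
  rw [hasPathOfLengthGE_iff]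
  constructor
  · rintro ⟨m, H, h, hH, hf⟩
    cases encodeGraph_inj h
    obtain ⟨v⟩ := hG.nonempty
    obtain ⟨f, hf, -⟩ := hf v
    exact ⟨f, hf⟩
  · rintro ⟨f, hf⟩
    exact ⟨n, G, rfl, hG, fun v => ⟨f, hf, fun h => absurd h (by decide)⟩⟩

theorem hasPaths_true {n : ℕ} {G : SimpleGraph (Fin n)} (hG : G.Connected) :
    HasPaths (encodeGraph G) true k ↔ ∀ v, HasPathOfLengthGE (deleteVertex G v) k := by
  simp only [hasPathOfLengthGE_deleteVertex_iff]
  constructor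
  · rintro ⟨m, H, h, hH, hf⟩ v
    cases encodeGraph_inj h
    obtain ⟨f, hf, hv⟩ := hf v
    exact ⟨f, hf, hv rfl⟩
  · intro hf
    refine ⟨n, G, rfl, hG, fun v => ?_⟩
    obtain ⟨f, hf, hv⟩ := hf v
    exact ⟨f, hf, fun _ => hv⟩

theorem mem_gallaiVertexProblem_iff {n : ℕ} {G : SimpleGraph (Fin n)} (hG : G.Connected) :
    encodeGraph G ∈ GallaiVertexProblem ↔ ∃ v, IsGallaiVertex G v := by
  constructor
  · rintro ⟨m, H, h, hH, hv⟩
    cases encodeGraph_inj h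
    exact hv
  · exact fun h => ⟨n, G, rfl, hG, h⟩

/-- For a connected graph, `K - 1` is the length `m` of a longest path, and no vertex is a Gallai
vertex exactly if every `G - v` still has a path with `m` edges. This universal statement over the
vertices is one query of kind `true`. -/
theorem exists_query_threshold (x : List Bool) : ∃ K ≤ x.length,
    (∀ k < x.length, query x false k ∈ pathQueries ↔ k < K) ∧
      (x ∈ GallaiVertexProblem ↔ 0 < K ∧ query x true (K - 1) ∉ pathQueries) := by
  by_cases hx : ∃ (n : ℕ) (G : SimpleGraph (Fin n)), x = encodeGraph G ∧ G.Connected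
  · obtain ⟨n, G, rfl, hG⟩ := hx
    obtain ⟨o⟩ := hG.nonempty
    obtain ⟨m, hm⟩ := exists_maximal_length o G
    have hmn := ((hm m).2 le_rfl).lt_card
    have hlen := length_encodeGraph G
    rw [Fintype.card_fin] at hmn
    refine ⟨m + 1, by omega, fun k hk => ?_, ?_⟩
    · rw [query_mem_pathQueries hk, hasPaths_false hG, hm, Nat.lt_succ_iff]
    · rw [Nat.add_sub_cancel, query_mem_pathQueries (by omega), hasPaths_true hG,
        mem_gallaiVertexProblem_iff hG, not_forall]
      simp only [isGallaiVertex_iff, Nat.succ_pos, true_and]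
      exact exists_congr fun v => ⟨fun ⟨k, h, hd⟩ h' => hd (h'.mono ((hm k).1 h)),
        fun h => ⟨m, (hm m).2 le_rfl, h⟩⟩
  -- Connectedness is part of what the queries ask, so for all other words every answer is negative
  -- and the threshold `0` means rejection.
  · refine ⟨0, Nat.zero_le _, fun k hk => ?_, ?_⟩
    · rw [query_mem_pathQueries hk]
      exact iff_of_false (fun ⟨n, G, h, hG, _⟩ => hx ⟨n, G, h, hG⟩) (by omega)
    · exact iff_of_false (fun ⟨n, G, h, hG, _⟩ => hx ⟨n, G, h, hG⟩) (by simp)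

/-- Queries of kind `true` are monotone as well, since a path may be cut off after `k` edges. So a
negative answer at some `k < K` implies one at `K - 1`. -/
theorem mem_gallaiVertexProblem_iff_query (x : List Bool) : x ∈ GallaiVertexProblem ↔
    ∃ k < x.length, query x false k ∈ pathQueries ∧ query x true k ∉ pathQueries := by
  obtain ⟨K, hK, hB, hx⟩ := exists_query_threshold x
  rw [hx]
  constructor
  · rintro ⟨h0, hq⟩
    exact ⟨K - 1, by omega, (hB _ (by omega)).2 (by omega), hq⟩
  · rintro ⟨k, hk, h₁, h₂⟩
    have hkK := (hB k hk).1 h₁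
    refine ⟨by omega, fun h => h₂ ?_⟩
    rw [query_mem_pathQueries (by omega)] at h ⊢
    obtain ⟨n, G, hG, hc, hf⟩ := h
    refine ⟨n, G, hG, hc, fun v => ?_⟩
    obtain ⟨f, ⟨ha, hi⟩, hv⟩ := hf v
    exact ⟨f, ⟨fun i h => ha i (by omega), hi.mono (Set.Iic_subset_Iic.2 (by omega))⟩,
      fun ht i h => hv ht i (by omega)⟩

end Correctness

end HeadMachine

open Classical in
theorem mainTheorem2 :
    InThetaTwoP GallaiVertexProblem ∧
    InPParallelNP GallaiVertexProblem ∧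
    (∀ {V : Type*} [Fintype V] (G : SimpleGraph V),
      longestPathLength G =
        ((Finset.range (Fintype.card V + 1)).filter fun k => HasPathOfLengthGE G k).max ∧
      (∀ v : V, longestPathLength (deleteVertex G v) =
        ((Finset.range (Fintype.card V + 1)).filter
          fun k => HasPathOfLengthGE (deleteVertex G v) k).max) ∧
      (∀ v : V, IsGallaiVertex G v ↔
        longestPathLength (deleteVertex G v) < longestPathLength G) ∧
      ((∃ v : V, IsGallaiVertex G v) ↔
        ∃ v : V, longestPathLength (deleteVertex G v) < longestPathLength G)) := by
  refine ⟨HeadMachine.inThetaTwoP_of_query HeadMachine.inNP_pathQueries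
    HeadMachine.exists_query_threshold, HeadMachine.inPParallelNP_of_query
    HeadMachine.inNP_pathQueries HeadMachine.mem_gallaiVertexProblem_iff_query, fun G => ?_⟩
  have h : ∀ v, IsGallaiVertex G v ↔
      longestPathLength (deleteVertex G v) < longestPathLength G := fun v =>
    isGallaiVertex_iff.trans longestPathLength_deleteVertex_lt_iff.symm
  exact ⟨longestPathLength_eq_max fun k hk => hk.lt_card.le,
    fun v => longestPathLength_eq_max fun k hk => hk.of_deleteVertex.lt_card.le, h,
    exists_congr h⟩
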